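/- **Setting.** Finite types are $0$ and $\rho\to\sigma$. $\mathsf{E\text{-}HA}^\omega$ is extensional Heyting arithmetic in all finite types: many-sorted intuitionistic logic, terms built from variables, $0$, $S$, the combinators $\Pi,\Sigma$ and the (simultaneous) recursors by application; primitive equality only at type $0$, with $s=_{\rho\to\tau}t$ standing for $\forall x^\rho\,(sx=_\tau tx)$; equality axioms at type $0$, extensionality $x=_\sigma y\to zx=_\tau zy$, the successor axioms, induction, and the defining equations of the constants. $\mathsf{E\text{-}HA}^\omega_{\mathrm{st}}$ has in addition predicates $\mathrm{st}^\sigma$ for each type $\sigma$. A formula is *internal* if no $\mathrm{st}^\sigma$ occurs in it; internal formulas are denoted by $\phi,\psi$ and arbitrary ones by $\Phi,\Psi$, and all may contain parameters. The induction axioms of $\mathsf{E\text{-}HA}^\omega$ are for internal formulas only, and the logic is extended to all formulas. Strong (Howard–Bezem) majorizability is given by $x\le^*_0y:\equiv x\le y$ and $x\le^*_{\rho\to\sigma}y:\equiv\forall v\forall u\,\bigl(u\le^*_\rho v\to xu\le^*_\sigma yv\wedge yu\le^*_\sigma yv\bigr)$; $x$ is *monotone* if $x\le^*x$. The quantifiers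 $\forall^{\mathrm{st}},\exists^{\mathrm{st}}$ are relativized to standard elements, $\tilde\forall,\tilde\exists$ to monotone elements, and $\tilde\forall^{\mathrm{st}},\tilde\exists^{\mathrm{st}}$ to standard monotone elements; a bound such as $\forall x\le^*t$ relativizes further to $x\le^*t$. The additional axioms of $\mathsf{E\text{-}HA}^\omega_{\mathrm{st}}$ are - $x=_\sigma y\to(\mathrm{st}(x)\to\mathrm{st}(y))$; - $\mathrm{st}(y)\to(x\le^*_\sigma y\to\mathrm{st}(x))$; - $\mathrm{st}(t)$ for every closed term $t$; - $\mathrm{st}(z)\to(\mathrm{st}(x)\to\mathrm{st}(zx))$; and there is the external induction rule: from $\Phi(0)$ and $\forall^{\mathrm{st}}n^0(\Phi(n)\to\Phi(Sn))$ infer $\forall^{\mathrm{st}}n^0\,\Phi(n)$, for every formula $\Phi$. **Principles** (for arbitrary finite tuples of variables of arbitrary types, except that $\mathsf{MAJ}^\omega$ is for single variables $x,y$ of each type): - $\mathsf{mAC}^\omega$: $\tilde\forall^{\mathrm{st}}x\,\tilde\exists^{\mathrm{st}}y\,\Phi(x,y)\to\tilde\exists^{\mathrm{st}}f\,\tilde\forall^{\mathrm{st}}x\,\tilde\exists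 y\le^*fx\,\Phi(x,y)$; - $\mathsf{R}^\omega$: $\forall x\,\exists^{\mathrm{st}}y\,\Phi(x,y)\to\tilde\exists^{\mathrm{st}}z\,\forall x\,\exists y\le^*z\,\Phi(x,y)$; - $\mathsf{I}^\omega$: $\tilde\forall^{\mathrm{st}}z\,\exists x\,\forall y\le^*z\,\phi(x,y)\to\exists x\,\forall^{\mathrm{st}}y\,\phi(x,y)$; - $\mathsf{IP}^\omega_{\tilde\forall^{\mathrm{st}}}$: $\bigl(\tilde\forall^{\mathrm{st}}x\,\phi(x)\to\tilde\exists^{\mathrm{st}}y\,\Psi(y)\bigr)\to\tilde\exists^{\mathrm{st}}y\,\bigl(\tilde\forall^{\mathrm{st}}x\,\phi(x)\to\tilde\exists z\le^*y\,\Psi(z)\bigr)$, where $y$ is not free in $\phi$; - $\mathsf{MP}^{\mathrm{st}}$: $\bigl(\tilde\forall^{\mathrm{st}}x\,\phi(x)\to\psi\bigr)\to\tilde\exists^{\mathrm{st}}y\,\bigl(\tilde\forall x\le^*y\,\phi(x)\to\psi\bigr)$; - $\mathsf{MAJ}^\omega$: $\forall^{\mathrm{st}}x\,\exists^{\mathrm{st}}y\,(x\le^*y)$.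 **Interpretation.** To each formula $\Phi$ one assigns a formula $\Phi^{\mathrm{I_{st}}}\equiv\tilde\exists^{\mathrm{st}}b\,\tilde\forall^{\mathrm{st}}c\,\Phi_{\mathrm{I_{st}}}(b,c)$, with $b,c$ (possibly empty) tuples of variables and $\Phi_{\mathrm{I_{st}}}$ internal: $\Phi^{\mathrm{I_{st}}}$ and $\Phi_{\mathrm{I_{st}}}$ are $\Phi$ if $\Phi$ is internal; $\mathrm{st}(t)^{\mathrm{I_{st}}}$ is $\tilde\exists^{\mathrm{st}}c\,[t\le^*c]$; and if $\Phi^{\mathrm{I_{st}}}$ is $\tilde\exists^{\mathrm{st}}b\,\tilde\forall^{\mathrm{st}}c\,\Phi_{\mathrm{I_{st}}}(b,c)$ and $\Psi^{\mathrm{I_{st}}}$ is $\tilde\exists^{\mathrm{st}}d\,\tilde\forall^{\mathrm{st}}e\,\Psi_{\mathrm{I_{st}}}(d,e)$, then - $(\Phi\wedge\Psi)^{\mathrm{I_{st}}}$ is $\tilde\exists^{\mathrm{st}}b,d\,\tilde\forall^{\mathrm{st}}c,e\,[\Phi_{\mathrm{I_{st}}}(b,c)\wedge\Psi_{\mathrm{I_{st}}}(d,e)]$;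 - $(\Phi\vee\Psi)^{\mathrm{I_{st}}}$ is $\tilde\exists^{\mathrm{st}}b,d\,\tilde\forall^{\mathrm{st}}c,e\,[\tilde\forall c'\le^*c\,\Phi_{\mathrm{I_{st}}}(b,c')\vee\tilde\forall e'\le^*e\,\Psi_{\mathrm{I_{st}}}(d,e')]$; - $(\Phi\to\Psi)^{\mathrm{I_{st}}}$ is $\tilde\exists^{\mathrm{st}}f,g\,\tilde\forall^{\mathrm{st}}b,e\,[\tilde\forall c\le^*gbe\,\Phi_{\mathrm{I_{st}}}(b,c)\to\Psi_{\mathrm{I_{st}}}(fb,e)]$; - $(\forall x\,\Phi(x))^{\mathrm{I_{st}}}$ is $\tilde\exists^{\mathrm{st}}b\,\tilde\forall^{\mathrm{st}}c\,[\forall x\,\Phi_{\mathrm{I_{st}}}(x,b,c)]$; - $(\exists x\,\Phi(x))^{\mathrm{I_{st}}}$ is $\tilde\exists^{\mathrm{st}}b\,\tilde\forall^{\mathrm{st}}c\,[\exists x\,\tilde\forall c'\le^*c\,\Phi_{\mathrm{I_{st}}}(x,b,c')]$; the formula in brackets being in each case the new matrix. **Theorem (Soundness).** Let $\Phi$ be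 an arbitrary formula, possibly with free variables, and suppose that $$\mathsf{E\text{-}HA}^\omega_{\mathrm{st}}+\mathsf{mAC}^\omega+\mathsf{R}^\omega+\mathsf{I}^\omega+\mathsf{MP}^{\mathrm{st}}+\mathsf{IP}^\omega_{\tilde\forall^{\mathrm{st}}}+\mathsf{MAJ}^\omega\vdash\Phi .$$ Then there is a tuple $t$ of closed terms of appropriate types, each provably monotone in $\mathsf{E\text{-}HA}^\omega_{\mathrm{st}}$, such that $$\mathsf{E\text{-}HA}^\omega_{\mathrm{st}}\vdash\tilde\forall^{\mathrm{st}}c\,\Phi_{\mathrm{I_{st}}}(t,c).$$ -/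

import Mathlib

namespace EHA

/-- Finite types: the base type `0` (here `nat`) and function types. -/
inductive Ty : Type
  | nat : Ty
  | arr : Ty → Ty → Ty

/-- A context lists the types of the free variables, the most recently bound one first. -/
abbrev Ctx := List Ty

/-- `arrs [ρ₁, …, ρₖ] τ` is the type `ρ₁ → … → ρₖ → τ`. -/
@[reducible] def arrs : List Ty → Ty → Ty
  | [], τ => τ
  | ρ :: ρs, τ => Ty.arr ρ (arrs ρs τ)

/-- Typed de Bruijn variables; also used as typed positions in a list of types. -/
inductive Var : List Ty → Ty → Type
  | zero {Γ : List Ty} {σ : Ty} : Var (σ :: Γ) σ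
  | succ {Γ : List Ty} {σ τ : Ty} : Var Γ τ → Var (σ :: Γ) τ

/-! ### Terms -/

/-- Terms of `E-HA^ω`: variables, zero, successor, the combinators `Π` and `Σ`, the
(simultaneous) recursors, and application. For a list `ρs = [ρ₁, …, ρₖ]` and a position `i`
in it, `recr i` is the `i`-th component of the simultaneous recursor `R_ρs`; it takes a number,
base values `y₁, …, yₖ` and step functions `z₁, …, zₖ` with `zⱼ : ρ₁ → … → ρₖ → 0 → ρⱼ`. -/
inductive Term : Ctx → Ty → Type
  | var {Γ : Ctx} {σ : Ty} : Var Γ σ → Term Γ σ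
  | zero {Γ : Ctx} : Term Γ Ty.nat
  | succ {Γ : Ctx} : Term Γ (Ty.arr Ty.nat Ty.nat)
  | combK {Γ : Ctx} (σ τ : Ty) : Term Γ (Ty.arr σ (Ty.arr τ σ))
  | combS {Γ : Ctx} (δ σ τ : Ty) :
      Term Γ (Ty.arr (Ty.arr δ (Ty.arr σ τ)) (Ty.arr (Ty.arr δ σ) (Ty.arr δ τ)))
  | recr {Γ : Ctx} {ρs : List Ty} {τ : Ty} (i : Var ρs τ) :
      Term Γ (Ty.arr Ty.nat (arrs ρs (arrs (ρs.map (arrs (ρs ++ [Ty.nat]))) τ)))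
  | app {Γ : Ctx} {σ τ : Ty} : Term Γ (Ty.arr σ τ) → Term Γ σ → Term Γ τ

/-- Renamings of variables. -/
abbrev Ren (Γ Δ : Ctx) := ∀ τ : Ty, Var Γ τ → Var Δ τ

/-- Simultaneous substitutions of terms for variables. -/
abbrev Sub (Γ Δ : Ctx) := ∀ τ : Ty, Var Γ τ → Term Δ τ

/-- Extend a renaming under a binder. -/
def Ren.lift {Γ Δ : Ctx} (r : Ren Γ Δ) (σ : Ty) : Ren (σ :: Γ) (σ :: Δ)
  | _, Var.zero => Var.zero
  | _, Var.succ x => Var.succ (r _ x)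

def Term.ren {Γ Δ : Ctx} (r : Ren Γ Δ) : {σ : Ty} → Term Γ σ → Term Δ σ
  | _, .var x => .var (r _ x)
  | _, .zero => .zero
  | _, .succ => .succ
  | _, .combK σ τ => .combK σ τ
  | _, .combS δ σ τ => .combS δ σ τ
  | _, .recr i => .recr i
  | _, .app s t => .app (s.ren r) (t.ren r)

/-- Weakening by one variable. -/
def Term.wk {Γ : Ctx} {σ : Ty} (ρ : Ty) (t : Term Γ σ) : Term (ρ :: Γ) σ :=
  t.ren (fun _ x => Var.succ x)

/-- Extend a substitution under a binder. -/
def Sub.lift {Γ Δ : Ctx} (s : Sub Γ Δ) (σ : Ty) : Sub (σ :: Γ) (σ :: Δ)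
  | _, Var.zero => .var Var.zero
  | _, Var.succ x => (s _ x).wk σ

def Term.subst {Γ Δ : Ctx} (s : Sub Γ Δ) : {σ : Ty} → Term Γ σ → Term Δ σ
  | _, .var x => s _ x
  | _, .zero => .zero
  | _, .succ => .succ
  | _, .combK σ τ => .combK σ τ
  | _, .combS δ σ τ => .combS δ σ τ
  | _, .recr i => .recr i
  | _, .app t u => .app (t.subst s) (u.subst s)

/-- The identity substitution. -/
def Sub.id (Γ : Ctx) : Sub Γ Γ := fun _ x => .var x

/-- Substitute `t` for the variable `0` and leave the other variables alone. -/
def Sub.inst {Γ : Ctx} {σ : Ty} (t : Term Γ σ) : Sub (σ :: Γ) Γ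
  | _, Var.zero => t
  | _, Var.succ x => .var x

/-- Replace the variable `0`, of type `0`, by its successor. -/
def Sub.incr (Γ : Ctx) : Sub (Ty.nat :: Γ) (Ty.nat :: Γ)
  | _, Var.zero => .app .succ (.var Var.zero)
  | _, Var.succ x => .var (Var.succ x)

/-! ### Tuples of terms and of variables -/

/-- A tuple of terms in context `Γ` with the given types. -/
inductive Terms (Γ : Ctx) : List Ty → Type
  | nil : Terms Γ []
  | cons {σ : Ty} {σs : List Ty} : Term Γ σ → Terms Γ σs → Terms Γ (σ :: σs)

namespace Terms

def head {Γ : Ctx} {σ : Ty} {σs : List Ty} : Terms Γ (σ :: σs) → Term Γ σ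
  | cons t _ => t

def ren {Γ Δ : Ctx} (r : Ren Γ Δ) : {σs : List Ty} → Terms Γ σs → Terms Δ σs
  | _, nil => nil
  | _, cons t ts => cons (t.ren r) (ts.ren r)

/-- Weakening by one variable. -/
def wk {Γ : Ctx} {σs : List Ty} (ρ : Ty) (ts : Terms Γ σs) : Terms (ρ :: Γ) σs :=
  ts.ren (fun _ x => Var.succ x)

def append {Γ : Ctx} : {σs τs : List Ty} → Terms Γ σs → Terms Γ τs → Terms Γ (σs ++ τs)
  | _, _, nil, us => us
  | _, _, cons t ts, us => cons t (append ts us)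

/-- The first part of a concatenated tuple. -/
def left {Γ : Ctx} : {σs τs : List Ty} → Terms Γ (σs ++ τs) → Terms Γ σs
  | [], _, _ => nil
  | _ :: _, _, cons t ts => cons t (left ts)

/-- The second part of a concatenated tuple. -/
def right {Γ : Ctx} : {σs τs : List Ty} → Terms Γ (σs ++ τs) → Terms Γ τs
  | [], _, ts => ts
  | _ :: σs, _, cons _ ts => right (σs := σs) ts

/-- The component at a given position. -/
def get {Γ : Ctx} : {σs : List Ty} → {τ : Ty} → Terms Γ σs → Var σs τ → Term Γ τ
  | _, _, cons t _, Var.zero => t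
  | _, _, cons _ ts, Var.succ i => get ts i

/-- The tuple with prescribed components. -/
def tabulate {Γ : Ctx} :
    {σs : List Ty} → (∀ τ : Ty, Var σs τ → Term Γ τ) → Terms Γ σs
  | [], _ => nil
  | _ :: _, f => cons (f _ Var.zero) (tabulate (fun τ i => f τ (Var.succ i)))

end Terms

/-- `t a₁ … aₖ`. -/
def Term.apps {Γ : Ctx} : {σs : List Ty} → {τ : Ty} →
    Term Γ (arrs σs τ) → Terms Γ σs → Term Γ τ
  | [], _, t, _ => t
  | _ :: _, _, t, .cons a as => Term.apps (Term.app t a) as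

/-- For a tuple `f₁, …, fₙ` of functions and a tuple `a` of arguments, the tuple
`f₁ a, …, fₙ a`. -/
def Terms.apps {Γ : Ctx} {σs : List Ty} : {τs : List Ty} →
    Terms Γ (τs.map (arrs σs)) → Terms Γ σs → Terms Γ τs
  | [], _, _ => .nil
  | _ :: _, .cons f fs, as => .cons (f.apps as) (Terms.apps fs as)

/-- The context `Γ` extended by a tuple of new variables. -/
@[reducible] def Ctx.ext : List Ty → Ctx → Ctx
  | [], Γ => Γ
  | σ :: σs, Γ => Ctx.ext σs (σ :: Γ)

/-- Weakening by a tuple of new variables. -/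
def Ren.wkN {Γ : Ctx} : (σs : List Ty) → Ren Γ (Ctx.ext σs Γ)
  | [], _, x => x
  | _ :: σs, _, x => Ren.wkN σs _ (Var.succ x)

/-- Extend a renaming under a tuple of binders. -/
def Ren.liftN {Γ Δ : Ctx} (r : Ren Γ Δ) : (σs : List Ty) → Ren (Ctx.ext σs Γ) (Ctx.ext σs Δ)
  | [] => r
  | σ :: σs => Ren.liftN (r.lift σ) σs

/-- Weaken the range of a substitution by a tuple of new variables. -/
def Sub.wkN {Γ Δ : Ctx} (s : Sub Γ Δ) (σs : List Ty) : Sub Γ (Ctx.ext σs Δ) :=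
  fun _ x => (s _ x).ren (Ren.wkN σs)

/-- Weaken a tuple of terms by a tuple of new variables. -/
def Terms.wkN {Γ : Ctx} {τs : List Ty} (ts : Terms Γ τs) (σs : List Ty) :
    Terms (Ctx.ext σs Γ) τs :=
  ts.ren (Ren.wkN σs)

/-- The tuple of new variables. -/
def Terms.fresh {Γ : Ctx} : (σs : List Ty) → Terms (Ctx.ext σs Γ) σs
  | [] => .nil
  | _ :: σs => .cons (.var (Ren.wkN σs _ Var.zero)) (Terms.fresh σs)

/-- The renaming from the empty context. -/
def Ren.ofEmpty (Γ : Ctx) : Ren [] Γ := fun _ x => by cases x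

/-- A closed tuple, regarded as a tuple in the context `Γ`. -/
def Terms.ofClosed {σs : List Ty} (ts : Terms [] σs) (Γ : Ctx) : Terms Γ σs :=
  ts.ren (Ren.ofEmpty Γ)

/-- A closed term, regarded as a term in the context `Γ`. -/
def Term.ofClosed {σ : Ty} (t : Term [] σ) (Γ : Ctx) : Term Γ σ :=
  t.ren (Ren.ofEmpty Γ)

/-! ### Formulas -/

/-- Formulas of `E-HA^ω_st`. The atomic formulas are equations of type `0` and the standardness
predicates `st^σ`. -/
inductive Formula : Ctx → Type
  | eq {Γ : Ctx} : Term Γ Ty.nat → Term Γ Ty.nat → Formula Γ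
  | st {Γ : Ctx} {σ : Ty} : Term Γ σ → Formula Γ
  | and {Γ : Ctx} : Formula Γ → Formula Γ → Formula Γ
  | or {Γ : Ctx} : Formula Γ → Formula Γ → Formula Γ
  | imp {Γ : Ctx} : Formula Γ → Formula Γ → Formula Γ
  | all {Γ : Ctx} (σ : Ty) : Formula (σ :: Γ) → Formula Γ
  | ex {Γ : Ctx} (σ : Ty) : Formula (σ :: Γ) → Formula Γ

namespace Formula

def ren : {Γ Δ : Ctx} → Ren Γ Δ → Formula Γ → Formula Δ
  | _, _, r, eq s t => eq (s.ren r) (t.ren r)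
  | _, _, r, st t => st (t.ren r)
  | _, _, r, and A B => and (A.ren r) (B.ren r)
  | _, _, r, or A B => or (A.ren r) (B.ren r)
  | _, _, r, imp A B => imp (A.ren r) (B.ren r)
  | _, _, r, all σ A => all σ (A.ren (r.lift σ))
  | _, _, r, ex σ A => ex σ (A.ren (r.lift σ))

/-- Weakening by one variable. -/
def wk {Γ : Ctx} (ρ : Ty) (A : Formula Γ) : Formula (ρ :: Γ) :=
  A.ren (fun _ x => Var.succ x)

def subst : {Γ Δ : Ctx} → Sub Γ Δ → Formula Γ → Formula Δ
  | _, _, s, eq t u => eq (t.subst s) (u.subst s)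
  | _, _, s, st t => st (t.subst s)
  | _, _, s, and A B => and (A.subst s) (B.subst s)
  | _, _, s, or A B => or (A.subst s) (B.subst s)
  | _, _, s, imp A B => imp (A.subst s) (B.subst s)
  | _, _, s, all σ A => all σ (A.subst (s.lift σ))
  | _, _, s, ex σ A => ex σ (A.subst (s.lift σ))

/-- `A(t)`, for `A` with a distinguished variable `0`. -/
def inst {Γ : Ctx} {σ : Ty} (A : Formula (σ :: Γ)) (t : Term Γ σ) : Formula Γ :=
  A.subst (Sub.inst t)

/-- A formula is internal if no standardness predicate occurs in it. -/
def Internal : {Γ : Ctx} → Formula Γ → Prop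
  | _, eq _ _ => True
  | _, st _ => False
  | _, and A B => A.Internal ∧ B.Internal
  | _, or A B => A.Internal ∧ B.Internal
  | _, imp A B => A.Internal ∧ B.Internal
  | _, all _ A => A.Internal
  | _, ex _ A => A.Internal

/-- Falsity is the equation `0 = S 0`. -/
def bot {Γ : Ctx} : Formula Γ := eq .zero (.app .succ .zero)

/-- Equality at type `σ`: primitive at type `0`, pointwise at function types. -/
def eqT : {Γ : Ctx} → (σ : Ty) → Term Γ σ → Term Γ σ → Formula Γ
  | _, .nat, s, t => eq s t
  | _, .arr ρ τ, s, t =>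
      all ρ (eqT τ (.app (s.wk ρ) (.var Var.zero)) (.app (t.wk ρ) (.var Var.zero)))

end Formula

/-- Addition `s + t`, by recursion on `t`; the step function `Σ (Π Π) S` sends `p, n` to `S p`. -/
def Term.add {Γ : Ctx} (s t : Term Γ Ty.nat) : Term Γ Ty.nat :=
  let step : Term Γ (Ty.arr Ty.nat (Ty.arr Ty.nat Ty.nat)) :=
    .app (.app (.combS Ty.nat Ty.nat (Ty.arr Ty.nat Ty.nat))
      (.app (.combK (Ty.arr Ty.nat (Ty.arr Ty.nat Ty.nat)) Ty.nat) (.combK Ty.nat Ty.nat))) .succ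
  .app (.app (.app (.recr (ρs := [Ty.nat]) Var.zero) t) s) step

namespace Formula

/-- `s ≤ t` at type `0`: there is `k` with `s + k = t`. -/
def le {Γ : Ctx} (s t : Term Γ Ty.nat) : Formula Γ :=
  ex Ty.nat (eq ((s.wk Ty.nat).add (.var Var.zero)) (t.wk Ty.nat))

/-- Howard–Bezem strong majorizability `s ≤*_σ t`. At a function type it is
`∀ v ∀ u (u ≤* v → s u ≤* t v ∧ t u ≤* t v)`. -/
def maj : {Γ : Ctx} → {σ : Ty} → Term Γ σ → Term Γ σ → Formula Γ
  | _, .nat, s, t => le s t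
  | Γ, .arr ρ _, s, t =>
      let v : Term (ρ :: ρ :: Γ) ρ := .var (Var.succ Var.zero)
      let u : Term (ρ :: ρ :: Γ) ρ := .var Var.zero
      let s' := (s.wk ρ).wk ρ
      let t' := (t.wk ρ).wk ρ
      all ρ (all ρ (imp (maj u v)
        (and (maj (.app s' u) (.app t' v)) (maj (.app t' u) (.app t' v)))))

/-- `t` is monotone. -/
def mon {Γ : Ctx} {σ : Ty} (t : Term Γ σ) : Formula Γ := maj t t

/-! ### Quantification over tuples, plain, relativized and bounded -/

/-- `∀ x₁ … ∀ xₙ A`. -/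
def alls : {Γ : Ctx} → (σs : List Ty) → Formula (Ctx.ext σs Γ) → Formula Γ
  | _, [], A => A
  | _, σ :: σs, A => all σ (alls σs A)

/-- `∃ x₁ … ∃ xₙ A`. -/
def exs : {Γ : Ctx} → (σs : List Ty) → Formula (Ctx.ext σs Γ) → Formula Γ
  | _, [], A => A
  | _, σ :: σs, A => ex σ (exs σs A)

/-- `∀ˢᵗ x₁ … ∀ˢᵗ xₙ A`. -/
def allSt : {Γ : Ctx} → (σs : List Ty) → Formula (Ctx.ext σs Γ) → Formula Γ
  | _, [], A => A
  | _, σ :: σs, A => all σ (imp (st (.var Var.zero)) (allSt σs A))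

/-- `∃ˢᵗ x₁ … ∃ˢᵗ xₙ A`. -/
def exSt : {Γ : Ctx} → (σs : List Ty) → Formula (Ctx.ext σs Γ) → Formula Γ
  | _, [], A => A
  | _, σ :: σs, A => ex σ (and (st (.var Var.zero)) (exSt σs A))

/-- `∀̃ˢᵗ x₁ … ∀̃ˢᵗ xₙ A`: quantification over standard monotone elements. -/
def allStMon : {Γ : Ctx} → (σs : List Ty) → Formula (Ctx.ext σs Γ) → Formula Γ
  | _, [], A => A
  | _, σ :: σs, A =>
      all σ (imp (and (st (.var Var.zero)) (mon (.var Var.zero))) (allStMon σs A))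

/-- `∃̃ˢᵗ x₁ … ∃̃ˢᵗ xₙ A`: quantification over standard monotone elements. -/
def exStMon : {Γ : Ctx} → (σs : List Ty) → Formula (Ctx.ext σs Γ) → Formula Γ
  | _, [], A => A
  | _, σ :: σs, A =>
      ex σ (and (and (st (.var Var.zero)) (mon (.var Var.zero))) (exStMon σs A))

/-- `∀ x₁ ≤* t₁ … ∀ xₙ ≤* tₙ A`. -/
def allMaj : {Γ : Ctx} → (σs : List Ty) → Terms Γ σs → Formula (Ctx.ext σs Γ) → Formula Γ
  | _, [], _, A => A
  | _, σ :: σs, .cons t ts, A =>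
      all σ (imp (maj (.var Var.zero) (t.wk σ)) (allMaj σs (ts.wk σ) A))

/-- `∃ x₁ ≤* t₁ … ∃ xₙ ≤* tₙ A`. -/
def exMaj : {Γ : Ctx} → (σs : List Ty) → Terms Γ σs → Formula (Ctx.ext σs Γ) → Formula Γ
  | _, [], _, A => A
  | _, σ :: σs, .cons t ts, A =>
      ex σ (and (maj (.var Var.zero) (t.wk σ)) (exMaj σs (ts.wk σ) A))

/-- `∀̃ x₁ ≤* t₁ … ∀̃ xₙ ≤* tₙ A`: quantification over monotone elements below the bounds. -/
def allMonMaj : {Γ : Ctx} → (σs : List Ty) → Terms Γ σs → Formula (Ctx.ext σs Γ) → Formula Γ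
  | _, [], _, A => A
  | _, σ :: σs, .cons t ts, A =>
      all σ (imp (and (mon (.var Var.zero)) (maj (.var Var.zero) (t.wk σ)))
        (allMonMaj σs (ts.wk σ) A))

/-- `∃̃ x₁ ≤* t₁ … ∃̃ xₙ ≤* tₙ A`: quantification over monotone elements below the bounds. -/
def exMonMaj : {Γ : Ctx} → (σs : List Ty) → Terms Γ σs → Formula (Ctx.ext σs Γ) → Formula Γ
  | _, [], _, A => A
  | _, σ :: σs, .cons t ts, A =>
      ex σ (and (and (mon (.var Var.zero)) (maj (.var Var.zero) (t.wk σ)))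
        (exMonMaj σs (ts.wk σ) A))

end Formula

/-! ### Derivability -/

open Formula in
/-- The axioms of `E-HA^ω`, apart from those of intuitionistic logic. -/
inductive ArithAxiom : {Γ : Ctx} → Formula Γ → Prop
  | eq_refl {Γ : Ctx} (t : Term Γ Ty.nat) : ArithAxiom (eq t t)
  | eq_symm {Γ : Ctx} (s t : Term Γ Ty.nat) : ArithAxiom (imp (eq s t) (eq t s))
  | eq_trans {Γ : Ctx} (s t u : Term Γ Ty.nat) :
      ArithAxiom (imp (and (eq s t) (eq t u)) (eq s u))
  | extensionality {Γ : Ctx} {σ τ : Ty} (z : Term Γ (Ty.arr σ τ)) (s t : Term Γ σ) :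
      ArithAxiom (imp (eqT σ s t) (eqT τ (.app z s) (.app z t)))
  | succ_ne_zero {Γ : Ctx} (t : Term Γ Ty.nat) :
      ArithAxiom (imp (eq (.app .succ t) .zero) bot)
  | succ_inj {Γ : Ctx} (s t : Term Γ Ty.nat) :
      ArithAxiom (imp (eq (.app .succ s) (.app .succ t)) (eq s t))
  | induction {Γ : Ctx} (A : Formula (Ty.nat :: Γ)) (hA : A.Internal) :
      ArithAxiom (imp (and (A.inst .zero) (all Ty.nat (imp A (A.subst (Sub.incr Γ)))))
        (all Ty.nat A))
  | combK {Γ : Ctx} {σ τ : Ty} (s : Term Γ σ) (t : Term Γ τ) :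
      ArithAxiom (eqT σ (.app (.app (.combK σ τ) s) t) s)
  | combS {Γ : Ctx} {δ σ τ : Ty} (s : Term Γ (Ty.arr δ (Ty.arr σ τ))) (t : Term Γ (Ty.arr δ σ))
      (u : Term Γ δ) :
      ArithAxiom (eqT τ (.app (.app (.app (.combS δ σ τ) s) t) u) (.app (.app s u) (.app t u)))
  | recr_zero {Γ : Ctx} {ρs : List Ty} {τ : Ty} (i : Var ρs τ) (y : Terms Γ ρs)
      (z : Terms Γ (ρs.map (arrs (ρs ++ [Ty.nat])))) :
      ArithAxiom (eqT τ (((Term.app (.recr i) .zero).apps y).apps z) (y.get i))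
  | recr_succ {Γ : Ctx} {ρs : List Ty} {τ : Ty} (i : Var ρs τ) (x : Term Γ Ty.nat)
      (y : Terms Γ ρs) (z : Terms Γ (ρs.map (arrs (ρs ++ [Ty.nat])))) :
      ArithAxiom (eqT τ (((Term.app (.recr i) (.app .succ x)).apps y).apps z)
        ((z.apps ((Terms.tabulate
          (fun _ j => ((Term.app (.recr j) x).apps y).apps z)).append (.cons x .nil))).get i))

open Formula in
/-- The standardness axioms. -/
inductive StAxiom : {Γ : Ctx} → Formula Γ → Prop
  | congr {Γ : Ctx} {σ : Ty} (s t : Term Γ σ) :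
      StAxiom (imp (eqT σ s t) (imp (st s) (st t)))
  | maj {Γ : Ctx} {σ : Ty} (s t : Term Γ σ) :
      StAxiom (imp (st t) (imp (maj s t) (st s)))
  | closed {Γ : Ctx} {σ : Ty} (t : Term [] σ) : StAxiom (st (t.ofClosed Γ))
  | app {Γ : Ctx} {σ τ : Ty} (s : Term Γ (Ty.arr σ τ)) (t : Term Γ σ) :
      StAxiom (imp (st s) (imp (st t) (st (.app s t))))

open Formula in
/-- `Derivable Ax A`: the formula `A` is provable in `E-HA^ω_st` extended by the axioms `Ax`.
Logic is many-sorted intuitionistic predicate logic for the language with the standardness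
predicates, in Hilbert style. -/
inductive Derivable (Ax : {Γ : Ctx} → Formula Γ → Prop) : {Γ : Ctx} → Formula Γ → Prop
  | or_contr {Γ : Ctx} (A : Formula Γ) : Derivable Ax (imp (or A A) A)
  | and_contr {Γ : Ctx} (A : Formula Γ) : Derivable Ax (imp A (and A A))
  | or_weak {Γ : Ctx} (A B : Formula Γ) : Derivable Ax (imp A (or A B))
  | and_weak {Γ : Ctx} (A B : Formula Γ) : Derivable Ax (imp (and A B) A)
  | or_perm {Γ : Ctx} (A B : Formula Γ) : Derivable Ax (imp (or A B) (or B A))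
  | and_perm {Γ : Ctx} (A B : Formula Γ) : Derivable Ax (imp (and A B) (and B A))
  | ex_falso {Γ : Ctx} (A : Formula Γ) : Derivable Ax (imp bot A)
  | all_elim {Γ : Ctx} {σ : Ty} (A : Formula (σ :: Γ)) (t : Term Γ σ) :
      Derivable Ax (imp (all σ A) (A.inst t))
  | ex_intro {Γ : Ctx} {σ : Ty} (A : Formula (σ :: Γ)) (t : Term Γ σ) :
      Derivable Ax (imp (A.inst t) (ex σ A))
  | mp {Γ : Ctx} {A B : Formula Γ} :
      Derivable Ax A → Derivable Ax (imp A B) → Derivable Ax B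
  | syll {Γ : Ctx} {A B C : Formula Γ} :
      Derivable Ax (imp A B) → Derivable Ax (imp B C) → Derivable Ax (imp A C)
  | exportation {Γ : Ctx} {A B C : Formula Γ} :
      Derivable Ax (imp (and A B) C) → Derivable Ax (imp A (imp B C))
  | importation {Γ : Ctx} {A B C : Formula Γ} :
      Derivable Ax (imp A (imp B C)) → Derivable Ax (imp (and A B) C)
  | expansion {Γ : Ctx} {A B : Formula Γ} (C : Formula Γ) :
      Derivable Ax (imp A B) → Derivable Ax (imp (or C A) (or C B))
  | all_intro {Γ : Ctx} {σ : Ty} {B : Formula Γ} {A : Formula (σ :: Γ)} :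
      Derivable Ax (imp (B.wk σ) A) → Derivable Ax (imp B (all σ A))
  | ex_elim {Γ : Ctx} {σ : Ty} {A : Formula (σ :: Γ)} {B : Formula Γ} :
      Derivable Ax (imp A (B.wk σ)) → Derivable Ax (imp (ex σ A) B)
  | arith {Γ : Ctx} {A : Formula Γ} : ArithAxiom A → Derivable Ax A
  | standardness {Γ : Ctx} {A : Formula Γ} : StAxiom A → Derivable Ax A
  | external_induction {Γ : Ctx} (A : Formula (Ty.nat :: Γ)) :
      Derivable Ax (A.inst .zero) →
      Derivable Ax (allSt [Ty.nat] (imp A (A.subst (Sub.incr Γ)))) →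
      Derivable Ax (allSt [Ty.nat] A)
  | ax {Γ : Ctx} {A : Formula Γ} : Ax A → Derivable Ax A

/-- Provability in `E-HA^ω_st`. -/
def EHAst {Γ : Ctx} (A : Formula Γ) : Prop := Derivable (fun _ => False) A

open Formula Ctx in
/-- The characteristic principles `mAC^ω`, `R^ω`, `I^ω`, `IP^ω_{∀̃st}`, `MP^st` (each for tuples of
variables) and `MAJ^ω`. -/
inductive Principle : {Γ : Ctx} → Formula Γ → Prop
  /-- `∀̃ˢᵗx ∃̃ˢᵗy A(x,y) → ∃̃ˢᵗf ∀̃ˢᵗx ∃̃y ≤* f x A(x,y)` -/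
  | mAC {Γ : Ctx} (xs ys : List Ty) (A : Formula (ext ys (ext xs Γ))) :
      Principle (imp (allStMon xs (exStMon ys A))
        (exStMon (ys.map (arrs xs)) (allStMon xs
          (exMonMaj ys (((Terms.fresh (ys.map (arrs xs))).wkN xs).apps (Terms.fresh xs))
            (A.ren (((Ren.wkN (ys.map (arrs xs))).liftN xs).liftN ys))))))
  /-- `∀x ∃ˢᵗy A(x,y) → ∃̃ˢᵗz ∀x ∃y ≤* z A(x,y)` -/
  | realization {Γ : Ctx} (xs ys : List Ty) (A : Formula (ext ys (ext xs Γ))) :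
      Principle (imp (alls xs (exSt ys A))
        (exStMon ys (alls xs (exMaj ys ((Terms.fresh ys).wkN xs)
          (A.ren (((Ren.wkN ys).liftN xs).liftN ys))))))
  /-- `∀̃ˢᵗz ∃x ∀y ≤* z A(x,y) → ∃x ∀ˢᵗy A(x,y)`, with `A` internal -/
  | idealization {Γ : Ctx} (xs ys : List Ty) (A : Formula (ext ys (ext xs Γ)))
      (hA : A.Internal) :
      Principle (imp
        (allStMon ys (exs xs (allMaj ys ((Terms.fresh ys).wkN xs)
          (A.ren (((Ren.wkN ys).liftN xs).liftN ys)))))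
        (exs xs (allSt ys A)))
  /-- `(∀̃ˢᵗx A(x) → ∃̃ˢᵗy B(y)) → ∃̃ˢᵗy (∀̃ˢᵗx A(x) → ∃̃z ≤* y B(z))`, with `A` internal -/
  | IP {Γ : Ctx} (xs ys : List Ty) (A : Formula (ext xs Γ)) (hA : A.Internal)
      (B : Formula (ext ys Γ)) :
      Principle (imp (imp (allStMon xs A) (exStMon ys B))
        (exStMon ys (imp ((allStMon xs A).ren (Ren.wkN ys))
          (exMonMaj ys (Terms.fresh ys) (B.ren ((Ren.wkN ys).liftN ys))))))
  /-- `(∀̃ˢᵗx A(x) → B) → ∃̃ˢᵗy (∀̃x ≤* y A(x) → B)`, with `A` and `B` internal -/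
  | MP {Γ : Ctx} (xs : List Ty) (A : Formula (ext xs Γ)) (hA : A.Internal)
      (B : Formula Γ) (hB : B.Internal) :
      Principle (imp (imp (allStMon xs A) B)
        (exStMon xs (imp
          (allMonMaj xs (Terms.fresh xs) (A.ren ((Ren.wkN xs).liftN xs)))
          (B.ren (Ren.wkN xs)))))
  /-- `∀ˢᵗx ∃ˢᵗy (x ≤* y)` -/
  | MAJ {Γ : Ctx} (σ : Ty) :
      Principle (Γ := Γ) (allSt [σ] (exSt [σ]
        (maj (.var (Var.succ Var.zero)) (.var Var.zero))))

/-! ### The functional interpretation -/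

/-- The pair of lists of types of the tuples `b` and `c` in
`Φ^{I_st} = ∃̃ˢᵗb ∀̃ˢᵗc Φ_{I_st}(b,c)`. -/
@[reducible] def interpTypes : {Γ : Ctx} → Formula Γ → List Ty × List Ty
  | _, .eq _ _ => ([], [])
  | _, .st (σ := σ) _ => ([σ], [])
  | _, .and A B =>
      ((interpTypes A).1 ++ (interpTypes B).1, (interpTypes A).2 ++ (interpTypes B).2)
  | _, .or A B =>
      ((interpTypes A).1 ++ (interpTypes B).1, (interpTypes A).2 ++ (interpTypes B).2)
  | _, .imp A B =>
      ((interpTypes B).1.map (arrs (interpTypes A).1) ++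
          (interpTypes A).2.map (arrs ((interpTypes A).1 ++ (interpTypes B).2)),
        (interpTypes A).1 ++ (interpTypes B).2)
  | _, .all _ A => interpTypes A
  | _, .ex _ A => interpTypes A

/-- The types of the tuple `b` in `Φ^{I_st} = ∃̃ˢᵗb ∀̃ˢᵗc Φ_{I_st}(b,c)`. -/
abbrev exTypes {Γ : Ctx} (A : Formula Γ) : List Ty := (interpTypes A).1

/-- The types of the tuple `c` in `Φ^{I_st} = ∃̃ˢᵗb ∀̃ˢᵗc Φ_{I_st}(b,c)`. -/
abbrev allTypes {Γ : Ctx} (A : Formula Γ) : List Ty := (interpTypes A).2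

open Formula in
/-- The matrix `Φ_{I_st}(b,c)`, with the tuples `b` and `c` of terms put in for the new variables
and, simultaneously, the terms `s` for the free variables of `Φ`. For a formula without
standardness predicates the tuples `b` and `c` are empty and the matrix is the formula itself
(after substituting `s`). -/
def matrix : {Γ Δ : Ctx} → (A : Formula Γ) → Sub Γ Δ →
    Terms Δ (exTypes A) → Terms Δ (allTypes A) → Formula Δ
  | _, _, .eq t u, s, _, _ => eq (t.subst s) (u.subst s)
  | _, _, .st t, s, b, _ => maj (t.subst s) b.head
  | _, _, .and A B, s, bd, ce =>
      and (matrix A s bd.left ce.left) (matrix B s bd.right ce.right)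
  | _, _, .or A B, s, bd, ce =>
      or (allMonMaj (allTypes A) ce.left
          (matrix A (s.wkN (allTypes A)) (bd.left.wkN (allTypes A)) (Terms.fresh (allTypes A))))
        (allMonMaj (allTypes B) ce.right
          (matrix B (s.wkN (allTypes B)) (bd.right.wkN (allTypes B)) (Terms.fresh (allTypes B))))
  | _, _, .imp A B, s, fg, be =>
      let f := Terms.left (σs := (exTypes B).map (arrs (exTypes A))) fg
      let g := Terms.right (σs := (exTypes B).map (arrs (exTypes A))) fg
      let b := Terms.left (σs := exTypes A) be
      let e := Terms.right (σs := exTypes A) be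
      imp (allMonMaj (allTypes A) (g.apps be)
          (matrix A (s.wkN (allTypes A)) (b.wkN (allTypes A)) (Terms.fresh (allTypes A))))
        (matrix B s (f.apps b) e)
  | _, _, .all σ A, s, b, c => all σ (matrix A (s.lift σ) (b.wk σ) (c.wk σ))
  | _, _, .ex σ A, s, b, c =>
      ex σ (allMonMaj (allTypes A) (c.wk σ)
        (matrix A ((s.lift σ).wkN (allTypes A)) ((b.wk σ).wkN (allTypes A))
          (Terms.fresh (allTypes A))))

/-- A tuple of closed terms is monotone if `E-HA^ω_st` proves each of its members monotone. -/
def Terms.Monotone : {σs : List Ty} → Terms [] σs → Prop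
  | _, .nil => True
  | _, .cons t ts => EHAst (Formula.mon t) ∧ ts.Monotone

/-- `∀̃ˢᵗc Φ_{I_st}(t,c)`, for a tuple `t` of closed terms. -/
def allMatrix {Γ : Ctx} (A : Formula Γ) (t : Terms [] (exTypes A)) : Formula Γ :=
  Formula.allStMon (allTypes A)
    (matrix A ((Sub.id Γ).wkN (allTypes A)) (t.ofClosed _) (Terms.fresh (allTypes A)))

end EHA

/-! The proof has two layers: a semantics that replaces derivations inside E-HA^ω_st by
inequalities, and a calculus of reductions between realizability problems that replaces the usual
manipulation of interpreted formulas.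

For the first layer, one Heyting-valued structure `theModel` is fixed in which the formulas of value
`⊤` under every valuation are exactly those provable in E-HA^ω_st (`exists_model`). It is the
Lindenbaum structure over an infinite supply of variables, with provably equal terms identified and
truth values in the MacNeille completion. That completion keeps the infima and suprema which
interpret the quantifiers (`canonical_eval`). An assertion about provability becomes `p ≤ v` in a
complete Heyting algebra, read as "p forces v", and the laws of arithmetic and of majorizability are
proved by forcing arguments. Since provably equal elements are equal, the equations for combinators
and recursors can be used for rewriting.

For the second layer, a formula is turned into a problem: two lists of types and a truth-valued
relation between realizers `b` and challenges `c` that persists when `b` is replaced by a majorant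
(`sem_mono`). A problem is realized if closed monotone terms meet every standard monotone challenge.
A reduction `Le P Q` sends realizers forward and challenges backward, the backward map giving only a
bound on the challenges to `P`. Realizing an implication is the same as giving a reduction
(`realized_imp_iff`), so the logical axioms and rules say that reducibility behaves like the order
of a Heyting algebra with quantifiers. Because challenges matter only up to majorization,
contraction needs no decision between two challenges: a common monotone bound suffices (`Mor.max`,
`Prob.and_contr`). The same bound combines the two realizers in `Prob.or_contr`. Quantifiers are
uniform, so realizers never see the values of the free variables.

The nonlogical axioms come next. An internal formula is a problem with empty tuples whose relation
is its truth value, so arithmetic needs no witnesses. Standardness asks for a majorant, and each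
closed term has one (`Term.exists_majorant`). The hard case there is the recursor, which is monotone
in its numerical argument only after its steps are made inflationary. External induction is realized
by iterating the realizer of the step, and the correctness of the iteration is itself shown by
external induction (`external_induction_realized`).

For the characteristic principles, universal properties bring relativized quantifiers over tuples to
a normal form, up to mutual reducibility (`Guards.eqv_all`, `Guards.eqv_ex`). After that, premise
and conclusion of each principle have the same challenges and differ by at most a rearrangement of
realizers. -/

namespace EHA

/-! ### Substitution -/

/-- Composition of substitutions. -/
def Sub.comp {Γ Δ Θ : Ctx} (s : Sub Γ Δ) (s' : Sub Δ Θ) : Sub Γ Θ :=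
  fun _ x => (s _ x).subst s'

/-- A renaming as a substitution. -/
def Ren.toSub {Γ Δ : Ctx} (r : Ren Γ Δ) : Sub Γ Δ := fun _ x => .var (r _ x)

/-- Extend a substitution by a term for a new variable. -/
def Sub.cons {Γ Δ : Ctx} {σ : Ty} (t : Term Δ σ) (s : Sub Γ Δ) : Sub (σ :: Γ) Δ
  | _, Var.zero => t
  | _, Var.succ x => s _ x

theorem Sub.ext_cons {Γ Δ : Ctx} {σ : Ty} {s s' : Sub (σ :: Γ) Δ}
    (h0 : s _ Var.zero = s' _ Var.zero)
    (h1 : ∀ τ (x : Var Γ τ), s _ (Var.succ x) = s' _ (Var.succ x)) : s = s' := by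
  funext τ x
  cases x with
  | zero => exact h0
  | succ x => exact h1 _ x

theorem Term.ren_eq_subst {Γ Δ : Ctx} {σ : Ty} (r : Ren Γ Δ) (t : Term Γ σ) :
    t.ren r = t.subst r.toSub := by
  induction t with
  | app s t hs ht => simp only [Term.ren, Term.subst, hs, ht]
  | _ => rfl

theorem Term.wk_eq_subst {Γ : Ctx} {σ : Ty} (ρ : Ty) (t : Term Γ σ) :
    t.wk ρ = t.subst (Ren.toSub fun _ x => Var.succ x) := Term.ren_eq_subst _ _

theorem Term.subst_subst {Γ Δ Θ : Ctx} {σ : Ty} (s : Sub Γ Δ) (s' : Sub Δ Θ) (t : Term Γ σ) :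
    (t.subst s).subst s' = t.subst (s.comp s') := by
  induction t with
  | app s t hs ht => simp only [Term.subst, hs, ht]
  | _ => rfl

theorem Term.subst_id {Γ : Ctx} {σ : Ty} (t : Term Γ σ) : t.subst (Sub.id Γ) = t := by
  induction t with
  | app s t hs ht => simp only [Term.subst, hs, ht]
  | _ => rfl

theorem Ren.toSub_lift {Γ Δ : Ctx} (r : Ren Γ Δ) (σ : Ty) :
    (r.lift σ).toSub = r.toSub.lift σ :=
  Sub.ext_cons rfl fun _ _ => rfl

theorem Term.wk_subst_cons {Γ Δ : Ctx} {σ τ : Ty} (t : Term Γ τ) (u : Term Δ σ) (s : Sub Γ Δ) :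
    (t.wk σ).subst (Sub.cons u s) = t.subst s := by
  rw [Term.wk_eq_subst, Term.subst_subst]; rfl

theorem Term.wk_subst_lift {Γ Δ : Ctx} {σ τ : Ty} (t : Term Γ τ) (s : Sub Γ Δ) :
    (t.wk σ).subst (s.lift σ) = (t.subst s).wk σ := by
  rw [Term.wk_eq_subst, Term.wk_eq_subst, Term.subst_subst, Term.subst_subst]
  congr 1
  funext τ x
  exact (Term.wk_eq_subst σ (s _ x))

theorem Sub.inst_eq_cons {Γ : Ctx} {σ : Ty} (t : Term Γ σ) :
    Sub.inst t = Sub.cons t (Sub.id Γ) := Sub.ext_cons rfl fun _ _ => rfl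

theorem Term.wk_subst_inst {Γ : Ctx} {σ τ : Ty} (t : Term Γ τ) (u : Term Γ σ) :
    (t.wk σ).subst (Sub.inst u) = t := by
  rw [Sub.inst_eq_cons, Term.wk_subst_cons, Term.subst_id]

theorem Sub.lift_comp {Γ Δ Θ : Ctx} (s : Sub Γ Δ) (s' : Sub Δ Θ) (σ : Ty) :
    (s.comp s').lift σ = (s.lift σ).comp (s'.lift σ) :=
  Sub.ext_cons rfl fun _ x => (Term.wk_subst_lift (s _ x) s').symm

theorem Sub.lift_id (Γ : Ctx) (σ : Ty) : (Sub.id Γ).lift σ = Sub.id (σ :: Γ) :=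
  Sub.ext_cons rfl fun _ _ => rfl

theorem Formula.ren_eq_subst {Γ Δ : Ctx} (r : Ren Γ Δ) (A : Formula Γ) :
    A.ren r = A.subst r.toSub := by
  induction A generalizing Δ with
  | eq s t => simp only [Formula.ren, Formula.subst, Term.ren_eq_subst]
  | st t => simp only [Formula.ren, Formula.subst, Term.ren_eq_subst]
  | and A B hA hB => simp only [Formula.ren, Formula.subst, hA, hB]
  | or A B hA hB => simp only [Formula.ren, Formula.subst, hA, hB]
  | imp A B hA hB => simp only [Formula.ren, Formula.subst, hA, hB]
  | all σ A hA => simp only [Formula.ren, Formula.subst, hA, Ren.toSub_lift]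
  | ex σ A hA => simp only [Formula.ren, Formula.subst, hA, Ren.toSub_lift]

theorem Formula.wk_eq_subst {Γ : Ctx} (ρ : Ty) (A : Formula Γ) :
    A.wk ρ = A.subst (Ren.toSub fun _ x => Var.succ x) := Formula.ren_eq_subst _ _

theorem Formula.subst_subst {Γ Δ Θ : Ctx} (s : Sub Γ Δ) (s' : Sub Δ Θ) (A : Formula Γ) :
    (A.subst s).subst s' = A.subst (s.comp s') := by
  induction A generalizing Δ Θ with
  | eq s t => simp only [Formula.subst, Term.subst_subst]
  | st t => simp only [Formula.subst, Term.subst_subst]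
  | and A B hA hB => simp only [Formula.subst, hA, hB]
  | or A B hA hB => simp only [Formula.subst, hA, hB]
  | imp A B hA hB => simp only [Formula.subst, hA, hB]
  | all σ A hA => simp only [Formula.subst, hA, Sub.lift_comp]
  | ex σ A hA => simp only [Formula.subst, hA, Sub.lift_comp]

theorem Formula.subst_id {Γ : Ctx} (A : Formula Γ) : A.subst (Sub.id Γ) = A := by
  induction A with
  | eq s t => simp only [Formula.subst, Term.subst_id]
  | st t => simp only [Formula.subst, Term.subst_id]
  | and A B hA hB => simp only [Formula.subst, hA, hB]
  | or A B hA hB => simp only [Formula.subst, hA, hB]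
  | imp A B hA hB => simp only [Formula.subst, hA, hB]
  | all σ A hA => simp only [Formula.subst, hA, Sub.lift_id]
  | ex σ A hA => simp only [Formula.subst, hA, Sub.lift_id]

theorem Formula.wk_subst_cons {Γ Δ : Ctx} {σ : Ty} (A : Formula Γ) (u : Term Δ σ) (s : Sub Γ Δ) :
    (A.wk σ).subst (Sub.cons u s) = A.subst s := by
  rw [Formula.wk_eq_subst, Formula.subst_subst]; rfl

theorem Formula.wk_subst_lift {Γ Δ : Ctx} {σ : Ty} (A : Formula Γ) (s : Sub Γ Δ) :
    (A.wk σ).subst (s.lift σ) = (A.subst s).wk σ := by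
  rw [Formula.wk_eq_subst, Formula.wk_eq_subst, Formula.subst_subst, Formula.subst_subst]
  congr 1
  funext τ x
  exact (Term.wk_eq_subst σ (s _ x))

theorem Formula.wk_inst {Γ : Ctx} {σ : Ty} (A : Formula Γ) (u : Term Γ σ) :
    (A.wk σ).inst u = A := by
  rw [Formula.inst, Sub.inst_eq_cons, Formula.wk_subst_cons, Formula.subst_id]

theorem Sub.lift_comp_inst {Γ Δ : Ctx} {σ : Ty} (s : Sub Γ Δ) (t : Term Δ σ) :
    (s.lift σ).comp (Sub.inst t) = Sub.cons t s :=
  Sub.ext_cons rfl fun _ _ => Term.wk_subst_inst _ _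

theorem Formula.subst_lift_inst {Γ Δ : Ctx} {σ : Ty} (A : Formula (σ :: Γ)) (s : Sub Γ Δ)
    (t : Term Δ σ) : (A.subst (s.lift σ)).inst t = A.subst (Sub.cons t s) := by
  rw [Formula.inst, Formula.subst_subst, Sub.lift_comp_inst]

theorem Formula.inst_subst {Γ Δ : Ctx} {σ : Ty} (A : Formula (σ :: Γ)) (t : Term Γ σ)
    (s : Sub Γ Δ) : (A.inst t).subst s = (A.subst (s.lift σ)).inst (t.subst s) := by
  rw [Formula.subst_lift_inst, Formula.inst, Formula.subst_subst]
  congr 1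
  exact Sub.ext_cons rfl fun _ _ => rfl

theorem Formula.ren_lift_inst_zero {Γ : Ctx} {σ : Ty} (A : Formula (σ :: Γ)) :
    (A.ren (Ren.lift (fun _ x => Var.succ x) σ)).inst (.var Var.zero) = A := by
  rw [Formula.ren_eq_subst, Ren.toSub_lift, Formula.subst_lift_inst]
  conv_rhs => rw [← Formula.subst_id A]
  congr 1
  exact Sub.ext_cons rfl fun _ _ => rfl

/-- This commutation is what keeps instances of induction, internal and external, closed under
substitution. -/
theorem Sub.incr_comp_lift {Γ Δ : Ctx} (s : Sub Γ Δ) :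
    (Sub.incr Γ).comp (s.lift Ty.nat) = (s.lift Ty.nat).comp (Sub.incr Δ) :=
  Sub.ext_cons rfl fun _ x => by
    have : ∀ {τ : Ty} (t : Term Δ τ), (t.wk Ty.nat).subst (Sub.incr Δ) = t.wk Ty.nat := by
      intro τ t
      rw [Term.wk_eq_subst, Term.subst_subst]; rfl
    exact (this _).symm

theorem Formula.incr_subst {Γ Δ : Ctx} (A : Formula (Ty.nat :: Γ)) (s : Sub Γ Δ) :
    (A.subst (Sub.incr Γ)).subst (s.lift Ty.nat) =
      (A.subst (s.lift Ty.nat)).subst (Sub.incr Δ) := by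
  rw [Formula.subst_subst, Formula.subst_subst, Sub.incr_comp_lift]

theorem Formula.Internal.subst {Γ Δ : Ctx} {A : Formula Γ} (hA : A.Internal) (s : Sub Γ Δ) :
    (A.subst s).Internal := by
  induction A generalizing Δ with
  | eq s t => trivial
  | st t => exact hA
  | and A B ihA ihB => exact ⟨ihA hA.1 s, ihB hA.2 s⟩
  | or A B ihA ihB => exact ⟨ihA hA.1 s, ihB hA.2 s⟩
  | imp A B ihA ihB => exact ⟨ihA hA.1 s, ihB hA.2 s⟩
  | all σ A ihA => exact ihA hA _
  | ex σ A ihA => exact ihA hA _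

theorem Formula.subst_eqT {Γ Δ : Ctx} {σ : Ty} (t u : Term Γ σ) (s : Sub Γ Δ) :
    (eqT σ t u).subst s = eqT σ (t.subst s) (u.subst s) := by
  induction σ generalizing Γ Δ with
  | nat => rfl
  | arr ρ τ _ ih =>
    simp only [eqT, Formula.subst, ih, Term.subst, Term.wk_subst_lift, Sub.lift]

theorem Term.subst_add {Γ Δ : Ctx} (t u : Term Γ Ty.nat) (s : Sub Γ Δ) :
    (t.add u).subst s = (t.subst s).add (u.subst s) := rfl

theorem Formula.subst_maj {Γ Δ : Ctx} {σ : Ty} (t u : Term Γ σ) (s : Sub Γ Δ) :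
    (maj t u).subst s = maj (t.subst s) (u.subst s) := by
  induction σ generalizing Γ Δ with
  | nat => simp only [maj, le, Formula.subst, Term.subst_add, Term.wk_subst_lift]; rfl
  | arr ρ τ ih1 ih2 =>
    simp only [maj, Formula.subst, ih1, ih2, Term.subst, Term.wk_subst_lift, Sub.lift]; rfl

/-! ### Substitution in tuples -/

/-- Substitution in a tuple of terms. -/
def Terms.subst {Γ Δ : Ctx} (s : Sub Γ Δ) : {σs : List Ty} → Terms Γ σs → Terms Δ σs
  | _, .nil => .nil
  | _, .cons t ts => .cons (t.subst s) (ts.subst s)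

theorem Terms.ren_eq_subst {Γ Δ : Ctx} {σs : List Ty} (r : Ren Γ Δ) (ts : Terms Γ σs) :
    ts.ren r = ts.subst r.toSub := by
  induction ts with
  | nil => rfl
  | cons t ts ih => simp only [Terms.ren, Terms.subst, ih, Term.ren_eq_subst]

theorem Terms.subst_append {Γ Δ : Ctx} {σs τs : List Ty} (s : Sub Γ Δ) (ts : Terms Γ σs)
    (us : Terms Γ τs) : (ts.append us).subst s = (ts.subst s).append (us.subst s) := by
  induction ts with
  | nil => rfl
  | cons t ts ih => simp only [Terms.append, Terms.subst, ih]

theorem Terms.get_subst {Γ Δ : Ctx} {σs : List Ty} {τ : Ty} (s : Sub Γ Δ) (ts : Terms Γ σs)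
    (i : Var σs τ) : (ts.subst s).get i = (ts.get i).subst s := by
  induction i with
  | zero => cases ts; rfl
  | succ i ih => cases ts; exact ih _

theorem Terms.subst_tabulate {Γ Δ : Ctx} {σs : List Ty} (s : Sub Γ Δ)
    (f : ∀ τ : Ty, Var σs τ → Term Γ τ) :
    (Terms.tabulate f).subst s = Terms.tabulate fun _ i => (f _ i).subst s := by
  induction σs with
  | nil => rfl
  | cons σ σs ih => simp only [Terms.tabulate, Terms.subst, ih]

theorem Term.subst_apps {Γ Δ : Ctx} {σs : List Ty} {τ : Ty} (s : Sub Γ Δ)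
    (t : Term Γ (arrs σs τ)) (as : Terms Γ σs) :
    (t.apps as).subst s = (t.subst s).apps (as.subst s) := by
  induction as with
  | nil => rfl
  | cons a as ih => exact ih _

theorem Terms.subst_apps {Γ Δ : Ctx} {σs τs : List Ty} (s : Sub Γ Δ)
    (ts : Terms Γ (τs.map (arrs σs))) (as : Terms Γ σs) :
    (ts.apps as).subst s = (ts.subst s).apps (as.subst s) := by
  induction τs with
  | nil => rfl
  | cons τ τs ih =>
    cases ts with
    | cons t ts => simp only [Terms.apps, Terms.subst, Term.subst_apps, ih]

theorem Term.ofClosed_subst {Γ Δ : Ctx} {σ : Ty} (t : Term [] σ) (s : Sub Γ Δ) :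
    (t.ofClosed Γ).subst s = t.ofClosed Δ := by
  simp only [Term.ofClosed, Term.ren_eq_subst, Term.subst_subst]
  congr 1
  funext τ x
  cases x

/-! ### Stability of axioms and derivations under substitution -/

theorem ArithAxiom.subst {Γ Δ : Ctx} {A : Formula Γ} (h : ArithAxiom A) (s : Sub Γ Δ) :
    ArithAxiom (A.subst s) := by
  cases h with
  | eq_refl t => exact .eq_refl _
  | eq_symm t u => exact .eq_symm _ _
  | eq_trans t u v => exact .eq_trans _ _ _
  | extensionality z t u =>
    simp only [Formula.subst, Formula.subst_eqT]
    exact .extensionality _ _ _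
  | succ_ne_zero t => exact .succ_ne_zero _
  | succ_inj t u => exact .succ_inj _ _
  | induction A hA =>
    simp only [Formula.subst, Formula.inst_subst, Formula.incr_subst]
    exact .induction _ (hA.subst _)
  | combK t u => rw [Formula.subst_eqT]; exact .combK _ _
  | combS t u v => rw [Formula.subst_eqT]; exact .combS _ _ _
  | recr_zero i y z =>
    rw [Formula.subst_eqT, ← Terms.get_subst, Term.subst_apps, Term.subst_apps]
    exact .recr_zero i _ _
  | recr_succ i x y z =>
    rw [Formula.subst_eqT, ← Terms.get_subst, Term.subst_apps, Term.subst_apps,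
      Terms.subst_apps, Terms.subst_append, Terms.subst_tabulate]
    simp only [Term.subst_apps, Term.subst]
    exact .recr_succ i _ _ _

theorem StAxiom.subst {Γ Δ : Ctx} {A : Formula Γ} (h : StAxiom A) (s : Sub Γ Δ) :
    StAxiom (A.subst s) := by
  cases h with
  | congr t u =>
    simp only [Formula.subst, Formula.subst_eqT]
    exact .congr _ _
  | maj t u =>
    simp only [Formula.subst, Formula.subst_maj]
    exact .maj _ _
  | closed t =>
    simp only [Formula.subst, Term.ofClosed_subst]
    exact .closed _
  | app t u => exact .app _ _

/-- Induction on derivations. In the rules with an eigenvariable the induction hypothesis is used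
for the substitution lifted under the binder, which commutes with weakening of the side formula. -/
theorem EHAst.subst {Γ Δ : Ctx} {A : Formula Γ} (h : EHAst A) (s : Sub Γ Δ) :
    EHAst (A.subst s) := by
  unfold EHAst at h
  induction h generalizing Δ with
  | or_contr A => exact .or_contr _
  | and_contr A => exact .and_contr _
  | or_weak A B => exact .or_weak _ _
  | and_weak A B => exact .and_weak _ _
  | or_perm A B => exact .or_perm _ _
  | and_perm A B => exact .and_perm _ _
  | ex_falso A => exact .ex_falso _
  | all_elim A t =>
    simp only [Formula.subst, Formula.inst_subst]
    exact .all_elim _ _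
  | ex_intro A t =>
    simp only [Formula.subst, Formula.inst_subst]
    exact .ex_intro _ _
  | mp _ _ h1 h2 => exact .mp (h1 s) (h2 s)
  | syll _ _ h1 h2 => exact .syll (h1 s) (h2 s)
  | exportation _ h => exact .exportation (h s)
  | importation _ h => exact .importation (h s)
  | expansion C _ h => exact .expansion _ (h s)
  | all_intro _ h =>
    refine .all_intro ?_
    have := h (s.lift _)
    simp only [Formula.subst, Formula.wk_subst_lift] at this
    exact this
  | ex_elim _ h =>
    refine .ex_elim ?_
    have := h (s.lift _)
    simp only [Formula.subst, Formula.wk_subst_lift] at this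
    exact this
  | arith h => exact .arith (h.subst s)
  | standardness h => exact .standardness (h.subst s)
  | external_induction A _ _ h1 h2 =>
    have h1 := h1 s
    have h2 := h2 s
    simp only [Formula.allSt, Formula.subst, Formula.inst_subst, Formula.incr_subst] at h1 h2 ⊢
    exact .external_induction _ h1 h2
  | ax h => exact h.elim

end EHA

namespace EHA

open Formula

/-! ### Derived rules of intuitionistic logic -/

theorem EHAst.imp_refl {Γ : Ctx} (A : Formula Γ) : EHAst (imp A A) :=
  .syll (.and_contr A) (.and_weak A A)

theorem EHAst.and_right {Γ : Ctx} (A B : Formula Γ) : EHAst (imp (and A B) B) :=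
  .syll (.and_perm A B) (.and_weak B A)

theorem EHAst.imp_and {Γ : Ctx} {A B C : Formula Γ} (h1 : EHAst (imp A B))
    (h2 : EHAst (imp A C)) : EHAst (imp A (and B C)) := by
  have a1 : EHAst (imp A (imp C (and B C))) := .syll h1 (.exportation (imp_refl _))
  have a2 : EHAst (imp C (imp A (and B C))) :=
    .exportation (.syll (.and_perm _ _) (.importation a1))
  exact .syll (.and_contr A) (.importation (.syll h2 a2))

theorem EHAst.or_right {Γ : Ctx} (A B : Formula Γ) : EHAst (imp B (or A B)) :=
  .syll (.or_weak B A) (.or_perm B A)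

theorem EHAst.or_imp {Γ : Ctx} {A B C : Formula Γ} (h1 : EHAst (imp A C))
    (h2 : EHAst (imp B C)) : EHAst (imp (or A B) C) :=
  .syll (.expansion A h2) (.syll (.or_perm _ _) (.syll (.expansion C h1) (.or_contr C)))

/-- A provable formula. -/
def verum (Γ : Ctx) : Formula Γ := eq .zero .zero

theorem EHAst.verum (Γ : Ctx) : EHAst (verum Γ) := .arith (.eq_refl _)

theorem EHAst.imp_of {Γ : Ctx} {A : Formula Γ} (B : Formula Γ) (h : EHAst A) :
    EHAst (imp B A) :=
  .mp h (.exportation (.and_weak A B))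

theorem EHAst.all_intro {Γ : Ctx} {σ : Ty} {A : Formula (σ :: Γ)} (h : EHAst A) :
    EHAst (all σ A) :=
  .mp (EHAst.verum Γ) (.all_intro (h.imp_of _))

theorem EHAst.all_inst {Γ : Ctx} {σ : Ty} {A : Formula (σ :: Γ)} (h : EHAst (all σ A))
    (t : Term Γ σ) : EHAst (A.inst t) := .mp h (.all_elim A t)

theorem EHAst.wk {Γ : Ctx} {A : Formula Γ} (h : EHAst A) (σ : Ty) : EHAst (A.wk σ) := by
  rw [Formula.wk_eq_subst]; exact EHAst.subst h _

/-- Weaken by a variable and instantiate the quantifier with that same variable. -/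
theorem EHAst.all_body {Γ : Ctx} {σ : Ty} {A : Formula (σ :: Γ)} (h : EHAst (all σ A)) :
    EHAst A := by
  have := EHAst.all_inst (h.wk σ) (.var Var.zero)
  rwa [Formula.ren_lift_inst_zero] at this

/-- A closed term of each type. -/
def Term.default {Γ : Ctx} : (σ : Ty) → Term Γ σ
  | .nat => .zero
  | .arr ρ τ => .app (.combK τ ρ) (Term.default τ)

/-- All types are inhabited by closed terms, so an idle variable can be instantiated away. -/
theorem EHAst.of_wk {Γ : Ctx} {A : Formula Γ} {σ : Ty} (h : EHAst (A.wk σ)) : EHAst A := by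
  have := EHAst.all_inst (EHAst.all_intro h) (Term.default σ)
  rwa [Formula.wk_inst] at this

/-! ### Provable equality -/

theorem EHAst.eqT_refl {Γ : Ctx} {σ : Ty} (t : Term Γ σ) : EHAst (eqT σ t t) := by
  induction σ generalizing Γ with
  | nat => exact .arith (.eq_refl t)
  | arr ρ τ _ ih => exact EHAst.all_intro (ih _)

theorem EHAst.eqT_symm {Γ : Ctx} {σ : Ty} {s t : Term Γ σ} (h : EHAst (eqT σ s t)) :
    EHAst (eqT σ t s) := by
  induction σ generalizing Γ with
  | nat => exact .mp h (.arith (.eq_symm s t))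
  | arr ρ τ _ ih => exact EHAst.all_intro (ih (EHAst.all_body h))

theorem EHAst.eqT_trans {Γ : Ctx} {σ : Ty} {s t u : Term Γ σ} (h : EHAst (eqT σ s t))
    (h' : EHAst (eqT σ t u)) : EHAst (eqT σ s u) := by
  induction σ generalizing Γ with
  | nat => exact .mp (.mp h' (.mp h (.exportation (EHAst.imp_refl _)))) (.arith (.eq_trans s t u))
  | arr ρ τ _ ih => exact EHAst.all_intro (ih (EHAst.all_body h) (EHAst.all_body h'))

theorem EHAst.eqT_app {Γ : Ctx} {σ τ : Ty} {s s' : Term Γ (.arr σ τ)} {t t' : Term Γ σ}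
    (h : EHAst (eqT _ s s')) (h' : EHAst (eqT σ t t')) :
    EHAst (eqT τ (.app s t) (.app s' t')) := by
  refine EHAst.eqT_trans (.mp h' (.arith (.extensionality s t t'))) ?_
  have := EHAst.all_inst h t'
  simp only [Formula.inst, Formula.subst_eqT, Term.subst, Term.wk_subst_inst] at this
  exact this

/-! ### Tuples of elements -/

/-- Tuples of elements of a typed structure. -/
def Tup (D : Ty → Type) : List Ty → Type
  | [] => Unit
  | σ :: σs => D σ × Tup D σs

namespace Tup

variable {D : Ty → Type}

def nil : Tup D [] := ()

def cons {σ : Ty} {σs : List Ty} (d : D σ) (a : Tup D σs) : Tup D (σ :: σs) := (d, a)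

def hd {σ : Ty} {σs : List Ty} (a : Tup D (σ :: σs)) : D σ := a.1

def tl {σ : Ty} {σs : List Ty} (a : Tup D (σ :: σs)) : Tup D σs := a.2

end Tup

infixr:67 " ∷ " => Tup.cons

namespace Tup

variable {D : Ty → Type}

theorem cons_congr {σ : Ty} {σs : List Ty} {d d' : D σ} {a a' : Tup D σs} (h : d = d')
    (h' : a = a') : d ∷ a = d' ∷ a' := congrArg₂ _ h h'

def get : {σs : List Ty} → {τ : Ty} → Tup D σs → Var σs τ → D τ
  | _ :: _, _, a, .zero => a.hd
  | _ :: _, _, a, .succ i => get a.tl i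

def tabulate : {σs : List Ty} → (∀ τ, Var σs τ → D τ) → Tup D σs
  | [], _ => nil
  | _ :: _, f => f _ .zero ∷ tabulate fun _ i => f _ (.succ i)

def append : {σs τs : List Ty} → Tup D σs → Tup D τs → Tup D (σs ++ τs)
  | [], _, _, b => b
  | _ :: _, _, a, b => a.hd ∷ append a.tl b

def left : {σs τs : List Ty} → Tup D (σs ++ τs) → Tup D σs
  | [], _, _ => nil
  | σ :: σs, τs, a => hd (σ := σ) (σs := σs ++ τs) a ∷ left (tl (σ := σ) (σs := σs ++ τs) a)

def right : {σs τs : List Ty} → Tup D (σs ++ τs) → Tup D τs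
  | [], _, a => a
  | σ :: σs, τs, a => right (σs := σs) (tl (σ := σ) (σs := σs ++ τs) a)

@[simp] theorem left_append {σs τs : List Ty} (a : Tup D σs) (b : Tup D τs) :
    (append a b).left = a := by
  induction σs with
  | nil => rfl
  | cons σ σs ih => exact cons_congr rfl (ih a.tl)

@[simp] theorem right_append {σs τs : List Ty} (a : Tup D σs) (b : Tup D τs) :
    (append a b).right = b := by
  induction σs with
  | nil => rfl
  | cons σ σs ih => exact ih _

@[simp] theorem append_left_right {σs τs : List Ty} (a : Tup D (σs ++ τs)) :
    append (left a) (right a) = a := by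
  induction σs with
  | nil => rfl
  | cons σ σs ih => exact cons_congr rfl (ih (tl (σ := σ) (σs := σs ++ τs) a))

@[simp] theorem get_tabulate {σs : List Ty} {τ : Ty} (f : ∀ τ, Var σs τ → D τ) (i : Var σs τ) :
    get (tabulate f) i = f τ i := by
  induction i with
  | zero => rfl
  | succ i ih => exact ih _

theorem ext_get {σs : List Ty} {a b : Tup D σs} (h : ∀ τ (i : Var σs τ), a.get i = b.get i) :
    a = b := by
  induction σs with
  | nil => rfl
  | cons σ σs ih =>
    exact cons_congr (d := a.hd) (d' := b.hd) (h _ .zero) (ih fun τ i => h τ (.succ i))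

@[simp] theorem tabulate_get {σs : List Ty} (a : Tup D σs) : tabulate (fun _ i => get a i) = a :=
  ext_get fun _ _ => get_tabulate _ _

/-- Extend a tuple of values for a context by values for a tuple of new variables. -/
def ext : {σs : List Ty} → {Γ : Ctx} → Tup D σs → Tup D Γ → Tup D (Ctx.ext σs Γ)
  | [], _, _, ρ => ρ
  | _ :: σs, _, a, ρ => ext (σs := σs) a.tl (a.hd ∷ ρ)

end Tup

/-! ### Heyting-valued structures -/

/-- The data of a Heyting-valued structure for the language of `E-HA^ω_st`. -/
structure PreModel where
  H : Type
  frame : Order.Frame H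
  D : Ty → Type
  app {σ τ : Ty} : D (.arr σ τ) → D σ → D τ
  zero : D .nat
  succ : D (.arr .nat .nat)
  K (σ τ : Ty) : D (.arr σ (.arr τ σ))
  S (δ σ τ : Ty) : D (.arr (.arr δ (.arr σ τ)) (.arr (.arr δ σ) (.arr δ τ)))
  R {ρs : List Ty} {τ : Ty} (i : Var ρs τ) :
    D (.arr .nat (arrs ρs (arrs (ρs.map (arrs (ρs ++ [.nat]))) τ)))
  eq : D .nat → D .nat → H
  st {σ : Ty} : D σ → H

attribute [instance] PreModel.frame

namespace PreModel

variable (M : PreModel)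

/-- The value of a term. -/
def ev {Γ : Ctx} (ρ : Tup M.D Γ) : {σ : Ty} → Term Γ σ → M.D σ
  | _, .var x => ρ.get x
  | _, .zero => M.zero
  | _, .succ => M.succ
  | _, .combK σ τ => M.K σ τ
  | _, .combS δ σ τ => M.S δ σ τ
  | _, .recr i => M.R i
  | _, .app s t => M.app (ev ρ s) (ev ρ t)

/-- The truth value of a formula. -/
def eval : {Γ : Ctx} → Formula Γ → Tup M.D Γ → M.H
  | _, .eq s t, ρ => M.eq (M.ev ρ s) (M.ev ρ t)
  | _, .st t, ρ => M.st (M.ev ρ t)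
  | _, .and A B, ρ => eval A ρ ⊓ eval B ρ
  | _, .or A B, ρ => eval A ρ ⊔ eval B ρ
  | _, .imp A B, ρ => eval A ρ ⇨ eval B ρ
  | _, .all σ A, ρ => ⨅ d : M.D σ, eval A (d ∷ ρ)
  | _, .ex σ A, ρ => ⨆ d : M.D σ, eval A (d ∷ ρ)

end PreModel

/-- A structure in which exactly the provable formulas are valid and provably equal elements are
equal. -/
structure Model extends PreModel where
  complete {Γ : Ctx} (A : Formula Γ) : EHAst A ↔ ∀ ρ, toPreModel.eval A ρ = ⊤
  separated {σ : Ty} (a b : toPreModel.D σ) :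
    toPreModel.eval (Γ := [σ, σ]) (eqT σ (.var .zero) (.var (.succ .zero))) (a ∷ b ∷ Tup.nil) = ⊤ →
      a = b
  bot_eq : toPreModel.eq toPreModel.zero (toPreModel.app toPreModel.succ toPreModel.zero) = ⊥

end EHA

namespace EHA

noncomputable section

open Formula Filter

/-! ### Growing contexts -/

def Ty.code : Ty → ℕ
  | .nat => 0
  | .arr ρ τ => Nat.pair ρ.code τ.code + 1

theorem Ty.code_injective : Function.Injective Ty.code := by
  intro σ
  induction σ with
  | nat => intro τ h; cases τ with
    | nat => rfl
    | arr _ _ => simp [Ty.code] at h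
  | arr ρ₁ ρ₂ ih1 ih2 =>
    intro τ h
    cases τ with
    | nat => simp [Ty.code] at h
    | arr τ₁ τ₂ =>
      simp only [Ty.code, Nat.add_right_cancel_iff, Nat.pair_eq_pair] at h
      rw [ih1 h.1, ih2 h.2]

instance : Inhabited Ty := ⟨.nat⟩

/-- A sequence of types in which each type occurs infinitely often. -/
def Ty.seq (n : ℕ) : Ty := Function.invFun Ty.code (Nat.unpair n).1

/-- The first component of the unpaired index codes the type; the second is free and pushes the
index beyond any bound. -/
theorem Ty.exists_seq_eq (σ : Ty) (N : ℕ) : ∃ n, N ≤ n ∧ σ = Ty.seq n :=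
  ⟨Nat.pair σ.code N, Nat.right_le_pair _ _, by
    rw [Ty.seq, Nat.unpair_pair]
    exact (Function.leftInverse_invFun Ty.code_injective σ).symm⟩

/-- An increasing sequence of contexts. -/
def Ctx.omega : ℕ → Ctx
  | 0 => []
  | n + 1 => Ty.seq n :: Ctx.omega n

/-- Terms over the union of the contexts `Ctx.omega n`, as eventually coherent sequences. -/
structure GTerm (σ : Ty) where
  seq : ∀ n, Term (Ctx.omega n) σ
  coh : ∀ᶠ n in atTop, seq (n + 1) = (seq n).wk (Ty.seq n)

/-- Formulas over the union of the contexts `Ctx.omega n`. -/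
structure GForm where
  seq : ∀ n, Formula (Ctx.omega n)
  coh : ∀ᶠ n in atTop, seq (n + 1) = (seq n).wk (Ty.seq n)

/-- Substitutions into the union of the contexts `Ctx.omega n`. -/
structure GSub (Γ : Ctx) where
  seq : ∀ n, Sub Γ (Ctx.omega n)
  coh : ∀ᶠ n in atTop, ∀ τ x, seq (n + 1) τ x = (seq n τ x).wk (Ty.seq n)

/-- The renaming from `Ctx.omega n` to `Ctx.omega (n + 1)`. -/
def omegaSucc (n : ℕ) : Sub (Ctx.omega n) (Ctx.omega (n + 1)) :=
  Ren.toSub fun _ x => Var.succ x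

theorem Sub.comp_omegaSucc {Γ : Ctx} (n : ℕ) (s : Sub Γ (Ctx.omega n)) :
    s.comp (omegaSucc n) = fun τ x => (s τ x).wk (Ty.seq n) := by
  funext τ x
  exact (Term.wk_eq_subst _ _).symm

theorem Term.wk_omega {n : ℕ} {σ : Ty} (t : Term (Ctx.omega n) σ) :
    t.wk (Ty.seq n) = t.subst (omegaSucc n) := Term.wk_eq_subst _ _

theorem Formula.wk_omega {n : ℕ} (A : Formula (Ctx.omega n)) :
    A.wk (Ty.seq n) = A.subst (omegaSucc n) := Formula.wk_eq_subst _ _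

def GTerm.cons {Γ : Ctx} {σ : Ty} (d : GTerm σ) (s : GSub Γ) : GSub (σ :: Γ) where
  seq n := Sub.cons (d.seq n) (s.seq n)
  coh := by
    filter_upwards [d.coh, s.coh] with n h1 h2 τ x
    cases x with
    | zero => exact h1
    | succ x => exact h2 _ x

def GTerm.ofTerm {Γ : Ctx} {σ : Ty} (t : Term Γ σ) (s : GSub Γ) : GTerm σ where
  seq n := t.subst (s.seq n)
  coh := by
    filter_upwards [s.coh] with n h
    rw [Term.wk_omega, Term.subst_subst, Sub.comp_omegaSucc]
    congr 1
    funext τ x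
    exact h τ x

def GForm.ofFormula {Γ : Ctx} (A : Formula Γ) (s : GSub Γ) : GForm where
  seq n := A.subst (s.seq n)
  coh := by
    filter_upwards [s.coh] with n h
    rw [Formula.wk_omega, Formula.subst_subst, Sub.comp_omegaSucc]
    congr 1
    funext τ x
    exact h τ x

def GForm.map₂ (f : ∀ n, Formula (Ctx.omega n) → Formula (Ctx.omega n) → Formula (Ctx.omega n))
    (hf : ∀ n A B, (f n A B).wk (Ty.seq n) = f (n + 1) (A.wk (Ty.seq n)) (B.wk (Ty.seq n)))
    (A B : GForm) : GForm where
  seq n := f n (A.seq n) (B.seq n)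
  coh := by
    filter_upwards [A.coh, B.coh] with n h1 h2
    rw [h1, h2, hf]

def GForm.and : GForm → GForm → GForm := GForm.map₂ (fun _ => .and) fun _ _ _ => rfl
def GForm.imp : GForm → GForm → GForm := GForm.map₂ (fun _ => .imp) fun _ _ _ => rfl

def GForm.Valid (A : GForm) : Prop := ∀ᶠ n in atTop, EHAst (A.seq n)

/-- Past the stage where the sequence has become coherent, provability travels upwards by weakening.
The next lemma moves it downwards by removing idle variables, so validity can be tested at a single
late stage. -/
theorem GForm.valid_of {A : GForm} {N : ℕ} (h : EHAst (A.seq N))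
    (hN : ∀ m ≥ N, A.seq (m + 1) = (A.seq m).wk (Ty.seq m)) : A.Valid := by
  refine eventually_atTop.2 ⟨N, fun m hm => ?_⟩
  induction m, hm using Nat.le_induction with
  | base => exact h
  | succ m hm ih => rw [hN m hm]; exact ih.wk _

theorem GForm.Valid.at {A : GForm} (h : A.Valid) {N : ℕ}
    (hN : ∀ m ≥ N, A.seq (m + 1) = (A.seq m).wk (Ty.seq m)) : EHAst (A.seq N) := by
  obtain ⟨m, hm⟩ := eventually_atTop.1 h
  have : ∀ k, EHAst (A.seq (N + k)) → EHAst (A.seq N) := by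
    intro k
    induction k with
    | zero => exact id
    | succ k ih =>
      intro hk
      rw [← Nat.add_assoc, hN (N + k) (Nat.le_add_right _ _)] at hk
      exact ih hk.of_wk
  exact this m (hm _ (Nat.le_add_left _ _))

/-- Formulas are not identified modulo provable equivalence here; the passage to truth values does
that later. -/
instance : Preorder GForm where
  le A B := (A.imp B).Valid
  le_refl A := Eventually.of_forall fun _ => EHAst.imp_refl _
  le_trans A B C h1 h2 := by
    filter_upwards [h1, h2] with n h1 h2
    exact .syll h1 h2

theorem GForm.le_def {A B : GForm} : A ≤ B ↔ ∀ᶠ n in atTop, EHAst (.imp (A.seq n) (B.seq n)) :=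
  Iff.rfl

theorem GForm.le_and {A B C : GForm} : C ≤ A.and B ↔ C ≤ A ∧ C ≤ B := by
  constructor
  · intro h
    exact ⟨h.mono fun n h => .syll h (.and_weak _ _),
      h.mono fun n h => .syll h (EHAst.and_right _ _)⟩
  · rintro ⟨h1, h2⟩
    filter_upwards [h1, h2] with n h1 h2
    exact EHAst.imp_and h1 h2

theorem GForm.le_imp {A B C : GForm} : C ≤ A.imp B ↔ C.and A ≤ B :=
  ⟨fun h => h.mono fun _ h => .importation h, fun h => h.mono fun _ h => .exportation h⟩

theorem GForm.or_le {Γ : Ctx} {A B : Formula Γ} {s : GSub Γ} {C : GForm} :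
    ofFormula (.or A B) s ≤ C ↔ ofFormula A s ≤ C ∧ ofFormula B s ≤ C := by
  constructor
  · intro h
    exact ⟨h.mono fun n h => .syll (.or_weak _ _) h, h.mono fun n h => .syll (EHAst.or_right _ _) h⟩
  · rintro ⟨h1, h2⟩
    filter_upwards [h1, h2] with n h1 h2
    exact EHAst.or_imp h1 h2

/-- The germ of a term over `Ctx.omega N`. -/
def GTerm.seqOf {σ : Ty} (N : ℕ) (t : Term (Ctx.omega N) σ) :
    ∀ m, Term (Ctx.omega m) σ
  | 0 => if h : N = 0 then h ▸ t else Term.default σ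
  | m + 1 => if h : N = m + 1 then h ▸ t else (GTerm.seqOf N t m).wk _

theorem GTerm.seqOf_self {σ : Ty} (N : ℕ) (t : Term (Ctx.omega N) σ) : seqOf N t N = t := by
  cases N <;> simp [seqOf]

theorem GTerm.seqOf_succ {σ : Ty} {N m : ℕ} (t : Term (Ctx.omega N) σ) (h : N ≤ m) :
    seqOf N t (m + 1) = (seqOf N t m).wk _ := by
  exact dif_neg (by omega)

def GTerm.germ {σ : Ty} (N : ℕ) (t : Term (Ctx.omega N) σ) : GTerm σ where
  seq := seqOf N t
  coh := eventually_atTop.2 ⟨N, fun _ h => seqOf_succ t h⟩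

/-- Supplies a stage at which all data have settled and the very next variable has the required
type, so that this variable is fresh for them. -/
theorem GForm.exists_coherent {Γ : Ctx} (σ : Ty) (s : GSub Γ) (B : GForm) :
    ∃ N, σ = Ty.seq N ∧ (∀ m ≥ N, B.seq (m + 1) = (B.seq m).wk (Ty.seq m)) ∧
      (∀ m ≥ N, ∀ τ x, s.seq (m + 1) τ x = (s.seq m τ x).wk (Ty.seq m)) := by
  obtain ⟨N₁, h1⟩ := eventually_atTop.1 B.coh
  obtain ⟨N₂, h2⟩ := eventually_atTop.1 s.coh
  obtain ⟨N, hN, hσ⟩ := Ty.exists_seq_eq σ (max N₁ N₂)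
  exact ⟨N, hσ, fun m hm => h1 m (((le_max_left _ _).trans hN).trans hm),
    fun m hm => h2 m (((le_max_right _ _).trans hN).trans hm)⟩

/-- The witness is the variable introduced at stage `N + 1`. It is a generic element: instantiating
with it gives the body of the quantified formula. -/
theorem GForm.exists_fresh {Γ : Ctx} {N : ℕ} (A : Formula (Ty.seq N :: Γ)) (s : GSub Γ)
    (hs : ∀ m ≥ N, ∀ τ x, s.seq (m + 1) τ x = (s.seq m τ x).wk (Ty.seq m)) :
    ∃ d : GTerm (Ty.seq N),
      (∀ m ≥ N + 1, (ofFormula A (d.cons s)).seq (m + 1) =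
        ((ofFormula A (d.cons s)).seq m).wk (Ty.seq m)) ∧
      (ofFormula A (d.cons s)).seq (N + 1) = A.subst ((s.seq N).lift (Ty.seq N)) := by
  refine ⟨GTerm.germ (N + 1) (.var (Γ := Ty.seq N :: Ctx.omega N) .zero), fun m hm => ?_, ?_⟩
  · show A.subst _ = (A.subst _).wk _
    rw [Formula.wk_omega, Formula.subst_subst, Sub.comp_omegaSucc]
    congr 1
    exact Sub.ext_cons (GTerm.seqOf_succ _ hm) (hs m ((Nat.le_succ N).trans hm))
  · show A.subst _ = A.subst _
    congr 1
    exact Sub.ext_cons (GTerm.seqOf_self _ _) (hs N le_rfl)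

/-- A universal formula is the infimum of its instances. That it is a lower bound is instantiation.
That it is the greatest one follows from the single instance at a fresh variable, by generalization.
The enlarged supply of variables exists for the sake of this lemma and its dual for `∃`. -/
theorem GForm.le_all {Γ : Ctx} {σ : Ty} {A : Formula (σ :: Γ)} {s : GSub Γ} {B : GForm} :
    B ≤ ofFormula (.all σ A) s ↔ ∀ d : GTerm σ, B ≤ ofFormula A (d.cons s) := by
  constructor
  · intro h d
    refine h.mono fun n h => .syll h ?_
    have := Derivable.all_elim (Ax := fun _ => False) (A.subst ((s.seq n).lift σ)) (d.seq n)
    rw [Formula.subst_lift_inst] at this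
    exact this
  · intro h
    obtain ⟨N, rfl, h1, h2⟩ := exists_coherent σ s B
    obtain ⟨d, h3, h4⟩ := exists_fresh A s h2
    -- Validity of the generic instance is brought down to stage `N + 1`, where its variable is the
    -- outermost one and can be generalized.
    have h5 : EHAst (.imp ((B.seq N).wk (Ty.seq N)) (A.subst ((s.seq N).lift (Ty.seq N)))) := by
      have := GForm.Valid.at (h d) (N := N + 1) fun m hm => by
        show Formula.imp _ _ = (Formula.imp _ _).wk _
        rw [h1 m ((Nat.le_succ N).trans hm), h3 m hm]; rfl
      change EHAst (Formula.imp _ _) at this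
      rw [h1 N le_rfl, h4] at this
      exact this
    refine GForm.valid_of (N := N) (Derivable.all_intro h5) fun m hm => ?_
    show Formula.imp _ _ = (Formula.imp _ _).wk _
    rw [h1 m hm]
    congr 1
    show (Formula.all _ A).subst _ = ((Formula.all _ A).subst _).wk _
    rw [Formula.wk_omega, Formula.subst_subst, Sub.comp_omegaSucc]
    congr 1
    funext τ x
    exact h2 m hm τ x

theorem GForm.ex_le {Γ : Ctx} {σ : Ty} {A : Formula (σ :: Γ)} {s : GSub Γ} {B : GForm} :
    ofFormula (.ex σ A) s ≤ B ↔ ∀ d : GTerm σ, ofFormula A (d.cons s) ≤ B := by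
  constructor
  · intro h d
    refine h.mono fun n h => .syll ?_ h
    have := Derivable.ex_intro (Ax := fun _ => False) (A.subst ((s.seq n).lift σ)) (d.seq n)
    rw [Formula.subst_lift_inst] at this
    exact this
  · intro h
    obtain ⟨N, rfl, h1, h2⟩ := exists_coherent σ s B
    obtain ⟨d, h3, h4⟩ := exists_fresh A s h2
    have h5 : EHAst (.imp (A.subst ((s.seq N).lift (Ty.seq N))) ((B.seq N).wk (Ty.seq N))) := by
      have := GForm.Valid.at (h d) (N := N + 1) fun m hm => by
        show Formula.imp _ _ = (Formula.imp _ _).wk _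
        rw [h1 m ((Nat.le_succ N).trans hm), h3 m hm]; rfl
      change EHAst (Formula.imp _ _) at this
      rw [h1 N le_rfl, h4] at this
      exact this
    refine GForm.valid_of (N := N) (Derivable.ex_elim h5) fun m hm => ?_
    show Formula.imp _ _ = (Formula.imp _ _).wk _
    rw [h1 m hm]
    congr 1
    show (Formula.ex _ A).subst _ = ((Formula.ex _ A).subst _).wk _
    rw [Formula.wk_omega, Formula.subst_subst, Sub.comp_omegaSucc]
    congr 1
    funext τ x
    exact h2 m hm τ x

/-! ### The MacNeille completion -/

/-- The closure operation of the MacNeille completion, on lower sets. -/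
def macNeilleClosure (U : LowerSet GForm) : LowerSet GForm where
  carrier := lowerBounds (upperBounds U)
  lower' := fun _ _ h hA _ hB => h.trans (hA hB)

/-- The closure preserves binary meets because formulas have implications. Fixed points of a nucleus
on a frame form a frame, so the completion is again a complete Heyting algebra. -/
def macNeille : Nucleus (LowerSet GForm) where
  toFun := macNeilleClosure
  map_inf' U V := by
    apply le_antisymm
    · refine le_inf ?_ ?_ <;> intro A hA B hB <;> refine hA fun C hC => hB ?_
      · exact hC.1
      · exact hC.2
    · rintro A ⟨hU, hV⟩ B hB
      -- For `D` in `U` and `C` in `V` the conjunction lies in both sets, hence below `B`. Moving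
      -- `C` to the right leaves a bound for all of `U`, and so for `A`; exchanging `A` and `C` then
      -- gives a bound for all of `V`, and so again for `A`.
      have h1 : ∀ C ∈ V, C ≤ A.imp B := fun C hC => by
        have : A ≤ C.imp B := hU fun D hD => GForm.le_imp.2 (hB
          ⟨U.lower (GForm.le_and.1 le_rfl).1 hD, V.lower (GForm.le_and.1 le_rfl).2 hC⟩)
        refine GForm.le_imp.2 (le_trans ?_ (GForm.le_imp.1 this))
        exact GForm.le_and.2 ⟨(GForm.le_and.1 le_rfl).2, (GForm.le_and.1 le_rfl).1⟩
      exact le_trans (GForm.le_and.2 ⟨le_rfl, le_rfl⟩) (GForm.le_imp.1 (hV h1))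
  idempotent' U := fun A hA B hB => hA fun C hC => hC hB
  le_apply' U := fun A hA B hB => hB hA

/-- The complete Heyting algebra of truth values. -/
abbrev Truth : Type := Set.range macNeille

/-- The truth value of a formula. -/
def GForm.toTruth (A : GForm) : Truth := macNeille.restrict (LowerSet.Iic A)

theorem GForm.toTruth_le_iff {A : GForm} {h : Truth} : A.toTruth ≤ h ↔ A ∈ h.1 := by
  have : A.toTruth ≤ h ↔ LowerSet.Iic A ≤ h.1 := macNeille.giRestrict.gc _ _
  rw [this, LowerSet.Iic_le]

/-- Principal lower sets are already closed, so no new inequalities between formulas appear in the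
completion. -/
theorem GForm.toTruth_le_toTruth {A B : GForm} : A.toTruth ≤ B.toTruth ↔ A ≤ B := by
  rw [toTruth_le_iff]
  constructor
  · intro h
    exact h fun C hC => hC
  · intro h C hC
    exact h.trans (hC (le_refl B))

/-- Formulas are join-dense in the completion and, by the next lemma, meet-dense. Infima and
implications are therefore identified by testing formulas from below, and suprema by testing from
above. -/
theorem Truth.le_of_lower {h h' : Truth} (H : ∀ A : GForm, A.toTruth ≤ h → A.toTruth ≤ h') :
    h ≤ h' := fun A hA => GForm.toTruth_le_iff.1 (H A (GForm.toTruth_le_iff.2 hA))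

theorem Truth.le_of_upper {h h' : Truth} (H : ∀ A : GForm, h' ≤ A.toTruth → h ≤ A.toTruth) :
    h ≤ h' := by
  intro A hA
  obtain ⟨_, U, rfl⟩ := h'
  refine fun B hB => ?_
  have h1 : (⟨macNeille U, U, rfl⟩ : Truth) ≤ B.toTruth :=
    macNeille.monotone (fun C hC => hB hC)
  have := H B h1
  exact GForm.toTruth_le_toTruth.1 (le_trans (GForm.toTruth_le_iff.2 hA) this)

theorem Truth.ext_lower {h h' : Truth} (H : ∀ A : GForm, A.toTruth ≤ h ↔ A.toTruth ≤ h') :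
    h = h' := le_antisymm (le_of_lower fun A => (H A).1) (le_of_lower fun A => (H A).2)

theorem Truth.ext_upper {h h' : Truth} (H : ∀ A : GForm, h ≤ A.toTruth ↔ h' ≤ A.toTruth) :
    h = h' := le_antisymm (le_of_upper fun A => (H A).2) (le_of_upper fun A => (H A).1)

theorem GForm.toTruth_and (A B : GForm) : (A.and B).toTruth = A.toTruth ⊓ B.toTruth :=
  Truth.ext_lower fun C => by simp only [le_inf_iff, toTruth_le_toTruth, le_and]

theorem GForm.toTruth_imp (A B : GForm) : (A.imp B).toTruth = A.toTruth ⇨ B.toTruth :=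
  Truth.ext_lower fun C => by
    rw [le_himp_iff, ← toTruth_and, toTruth_le_toTruth, toTruth_le_toTruth, le_imp]

/-! ### The canonical model -/

instance GTerm.setoid (σ : Ty) : Setoid (GTerm σ) where
  r s t := ∀ᶠ n in atTop, EHAst (eqT σ (s.seq n) (t.seq n))
  iseqv :=
    { refl := fun s => Eventually.of_forall fun n => EHAst.eqT_refl _
      symm := fun h => h.mono fun n h => h.eqT_symm
      trans := fun h1 h2 => by
        filter_upwards [h1, h2] with n h1 h2
        exact h1.eqT_trans h2 }

def GTerm.app {σ τ : Ty} (s : GTerm (.arr σ τ)) (t : GTerm σ) : GTerm τ where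
  seq n := .app (s.seq n) (t.seq n)
  coh := by
    filter_upwards [s.coh, t.coh] with n h1 h2
    rw [h1, h2]; rfl

def GTerm.const {σ : Ty} (t : ∀ Γ, Term Γ σ) (ht : ∀ Γ ρ, t (ρ :: Γ) = (t Γ).wk ρ) : GTerm σ where
  seq _ := t _
  coh := Eventually.of_forall fun _ => ht _ _

def GForm.eq (s t : GTerm .nat) : GForm where
  seq n := .eq (s.seq n) (t.seq n)
  coh := by
    filter_upwards [s.coh, t.coh] with n h1 h2
    rw [h1, h2]; rfl

def GForm.st {σ : Ty} (t : GTerm σ) : GForm where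
  seq n := .st (t.seq n)
  coh := by
    filter_upwards [t.coh] with n h1
    rw [h1]; rfl

theorem GForm.eq_le_eq {s t s' t' : GTerm .nat} (hs : s ≈ s') (ht : t ≈ t') :
    GForm.eq s t ≤ GForm.eq s' t' := by
  refine GForm.le_def.2 ?_
  filter_upwards [hs, ht] with n hs ht
  have h1 : EHAst (.imp (.eq (s.seq n) (t.seq n)) (.eq (s.seq n) (t'.seq n))) :=
    .syll (EHAst.imp_and (EHAst.imp_refl _) (ht.imp_of _)) (.arith (.eq_trans _ _ _))
  exact .syll (EHAst.imp_and (hs.eqT_symm.imp_of _) h1) (.arith (.eq_trans _ _ _))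

theorem GForm.st_le_st {σ : Ty} {s t : GTerm σ} (h : s ≈ t) : GForm.st s ≤ GForm.st t :=
  Eventually.mono h fun _ h => .mp h (.standardness (.congr _ _))

/-- Application respects the quotient by extensionality, equality by transitivity, and standardness
by its congruence axiom. -/
abbrev canonicalPreModel : PreModel where
  H := Truth
  frame := inferInstance
  D σ := Quotient (GTerm.setoid σ)
  app := Quotient.map₂ GTerm.app fun _ _ h1 _ _ h2 => by
    filter_upwards [h1, h2] with n h1 h2
    exact EHAst.eqT_app h1 h2
  zero := ⟦.const (fun _ => .zero) fun _ _ => rfl⟧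
  succ := ⟦.const (fun _ => .succ) fun _ _ => rfl⟧
  K σ τ := ⟦.const (fun _ => .combK σ τ) fun _ _ => rfl⟧
  S δ σ τ := ⟦.const (fun _ => .combS δ σ τ) fun _ _ => rfl⟧
  R i := ⟦.const (fun _ => .recr i) fun _ _ => rfl⟧
  eq := Quotient.lift₂ (fun s t => (GForm.eq s t).toTruth) fun _ _ _ _ h1 h2 =>
    le_antisymm (GForm.toTruth_le_toTruth.2 (GForm.eq_le_eq h1 h2))
      (GForm.toTruth_le_toTruth.2 (GForm.eq_le_eq (Setoid.symm h1) (Setoid.symm h2)))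
  st := Quotient.lift (fun s => (GForm.st s).toTruth) fun _ _ h =>
    le_antisymm (GForm.toTruth_le_toTruth.2 (GForm.st_le_st h))
      (GForm.toTruth_le_toTruth.2 (GForm.st_le_st (Setoid.symm h)))

/-- The tuple of values given by a substitution. -/
def GSub.toTup : {Γ : Ctx} → GSub Γ → Tup canonicalPreModel.D Γ
  | [], _ => Tup.nil
  | _ :: _, s =>
    Tup.cons (D := canonicalPreModel.D)
      ⟦⟨fun n => s.seq n _ .zero, s.coh.mono fun _ h => h _ .zero⟩⟧
      (GSub.toTup ⟨fun n _ x => s.seq n _ (.succ x), s.coh.mono fun _ h _ x => h _ (.succ x)⟩)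

theorem GSub.get_toTup {Γ : Ctx} (s : GSub Γ) {τ : Ty} (x : Var Γ τ) :
    s.toTup.get x = ⟦⟨fun n => s.seq n _ x, s.coh.mono fun _ h => h _ x⟩⟧ := by
  induction x with
  | zero => rfl
  | succ x ih => exact ih _

theorem GSub.toTup_surjective {Γ : Ctx} (ρ : Tup canonicalPreModel.D Γ) :
    ∃ s : GSub Γ, s.toTup = ρ := by
  induction Γ with
  | nil => exact ⟨⟨fun _ _ x => (nomatch x), Eventually.of_forall fun _ _ x => (nomatch x)⟩, rfl⟩
  | cons σ Γ ih =>
    obtain ⟨d, ρ⟩ := ρ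
    obtain ⟨s, rfl⟩ := ih ρ
    induction d using Quotient.inductionOn with
    | h d => exact ⟨d.cons s, rfl⟩

theorem canonical_ev {Γ : Ctx} {σ : Ty} (s : GSub Γ) (t : Term Γ σ) :
    canonicalPreModel.ev s.toTup t = ⟦GTerm.ofTerm t s⟧ := by
  induction t with
  | var x => exact GSub.get_toTup s x
  | app t u ht hu => rw [PreModel.ev, ht, hu]; rfl
  | _ => rfl

/-- The truth lemma. Each connective is compared with arbitrary formulas on the side where it has a
universal property: conjunction, implication and `∀` from below, disjunction and `∃` from above. -/
theorem canonical_eval {Γ : Ctx} (A : Formula Γ) (s : GSub Γ) :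
    canonicalPreModel.eval A s.toTup = (GForm.ofFormula A s).toTruth := by
  induction A with
  | eq t u => rw [PreModel.eval, canonical_ev, canonical_ev]; rfl
  | st t => rw [PreModel.eval, canonical_ev]; rfl
  | and A B hA hB =>
    rw [PreModel.eval, hA, hB]
    exact (GForm.toTruth_and _ _).symm
  | or A B hA hB =>
    rw [PreModel.eval, hA, hB]
    refine Truth.ext_upper fun C => ?_
    rw [GForm.toTruth_le_toTruth, GForm.or_le]
    exact sup_le_iff.trans (by simp only [GForm.toTruth_le_toTruth])
  | imp A B hA hB =>
    rw [PreModel.eval, hA, hB]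
    exact (GForm.toTruth_imp _ _).symm
  | all σ A hA =>
    refine Truth.ext_lower fun C => ?_
    rw [GForm.toTruth_le_toTruth, GForm.le_all]
    refine le_iInf_iff.trans ⟨fun h d => ?_, fun h d => ?_⟩
    · have := h ⟦d⟧
      rw [← GForm.toTruth_le_toTruth, ← hA]
      exact this
    · induction d using Quotient.inductionOn with
      | h d =>
        have := h d
        rw [← GForm.toTruth_le_toTruth, ← hA] at this
        exact this
  | ex σ A hA =>
    refine Truth.ext_upper fun C => ?_
    rw [GForm.toTruth_le_toTruth, GForm.ex_le]
    refine iSup_le_iff.trans ⟨fun h d => ?_, fun h d => ?_⟩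
    · have := h ⟦d⟧
      rw [← GForm.toTruth_le_toTruth, ← hA]
      exact this
    · induction d using Quotient.inductionOn with
      | h d =>
        have := h d
        rw [← GForm.toTruth_le_toTruth, ← hA] at this
        exact this

theorem GForm.toTruth_eq_top {A : GForm} : A.toTruth = ⊤ ↔ A.Valid := by
  rw [eq_top_iff]
  constructor
  · intro h
    have h1 : (⟨fun _ => verum _, Eventually.of_forall fun _ => rfl⟩ : GForm) ≤ A :=
      toTruth_le_toTruth.1 (le_top.trans h)
    exact h1.mono fun n h => .mp (EHAst.verum _) h
  · intro h
    refine Truth.le_of_lower fun B _ => toTruth_le_toTruth.2 ?_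
    exact Eventually.mono h fun n h => h.imp_of _

/-! ### Completeness of the canonical model -/

/-- The universal closure. -/
def Formula.closure : {Γ : Ctx} → Formula Γ → Formula []
  | [], A => A
  | σ :: _, A => (all σ A).closure

theorem EHAst.of_closure {Γ : Ctx} {A : Formula Γ} (h : EHAst A.closure) : EHAst A := by
  induction Γ with
  | nil => exact h
  | cons σ Γ ih => exact (ih (A := all σ A) h).all_body

theorem PreModel.eval_closure (M : PreModel) {Γ : Ctx} {A : Formula Γ} (h : ∀ ρ, M.eval A ρ = ⊤) :
    M.eval A.closure Tup.nil = ⊤ := by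
  induction Γ with
  | nil => exact h Tup.nil
  | cons σ Γ ih => exact ih (A := all σ A) fun ρ => iInf_eq_top.2 fun d => h (d ∷ ρ)

theorem canonical_complete {Γ : Ctx} (A : Formula Γ) :
    EHAst A ↔ ∀ ρ, canonicalPreModel.eval A ρ = ⊤ := by
  constructor
  · intro h ρ
    obtain ⟨s, rfl⟩ := GSub.toTup_surjective ρ
    rw [canonical_eval]
    exact GForm.toTruth_eq_top.2 (Eventually.of_forall fun n => h.subst _)
  · intro h
    -- For a sentence only the empty valuation has to be considered.
    refine EHAst.of_closure ?_
    obtain ⟨s, hs⟩ := GSub.toTup_surjective (Γ := []) Tup.nil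
    have h1 := PreModel.eval_closure _ h
    rw [← hs, canonical_eval] at h1
    obtain ⟨n, hn⟩ := (GForm.toTruth_eq_top.1 h1).exists
    -- The sentence is provable in the context of some stage `n`; closed default terms for the
    -- variables of that stage bring the proof back to the empty context.
    have h2 := EHAst.subst (Δ := []) hn fun σ _ => Term.default σ
    change EHAst (Formula.subst _ (Formula.subst _ _)) at h2
    rw [Formula.subst_subst] at h2
    convert h2
    conv_lhs => rw [← Formula.subst_id A.closure]
    congr 1
    funext τ x
    cases x

theorem exists_model : Nonempty Model := by
  refine ⟨{ canonicalPreModel with complete := canonical_complete, separated := ?_, bot_eq := ?_ }⟩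
  · intro σ a b h
    obtain ⟨s, hs⟩ := GSub.toTup_surjective (Γ := [σ, σ]) (a ∷ b ∷ Tup.nil)
    have h' : canonicalPreModel.eval (Γ := [σ, σ]) (eqT σ (.var .zero) (.var (.succ .zero)))
      (a ∷ b ∷ Tup.nil) = ⊤ := h
    rw [← hs, canonical_eval, GForm.toTruth_eq_top] at h'
    have ha : a = ⟦⟨fun n => s.seq n _ .zero, s.coh.mono fun _ h => h _ .zero⟩⟧ :=
      (congrArg Tup.hd hs).symm
    have hb : b = ⟦⟨fun n => s.seq n _ (.succ .zero), s.coh.mono fun _ h => h _ (.succ .zero)⟩⟧ :=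
      (congrArg (fun p => p.tl.hd) hs).symm
    rw [ha, hb]
    refine Quotient.sound (Eventually.mono h' fun n h => ?_)
    have h1 : EHAst ((eqT σ _ _).subst (s.seq n)) := h
    rw [Formula.subst_eqT] at h1
    exact h1
  -- By meet-density it is enough that `0 = S 0` implies each formula, which is ex falso.
  · refine le_antisymm (Truth.le_of_upper fun A _ => ?_) bot_le
    refine GForm.toTruth_le_toTruth.2 (Eventually.of_forall fun n => ?_)
    exact .ex_falso _


/-! ### Values in a fixed model -/

def theModel : Model := Classical.choice exists_model

/-- Truth values. -/
abbrev H : Type := theModel.H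

/-- Elements of type `σ`. -/
abbrev D (σ : Ty) : Type := theModel.D σ

/-- Tuples of elements; also valuations of contexts. -/
abbrev V (σs : List Ty) : Type := Tup theModel.D σs

instance {σ τ : Ty} : CoeFun (D (.arr σ τ)) fun _ => D σ → D τ := ⟨theModel.app⟩

def Term.ev {Γ : Ctx} {σ : Ty} (t : Term Γ σ) (ρ : V Γ) : D σ := theModel.ev ρ t

def Formula.val {Γ : Ctx} (A : Formula Γ) (ρ : V Γ) : H := theModel.eval A ρ

def Terms.ev {Γ : Ctx} : {σs : List Ty} → Terms Γ σs → V Γ → V σs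
  | _, .nil, _ => Tup.nil
  | _, .cons t ts, ρ => t.ev ρ ∷ ts.ev ρ

def Sub.ev {Γ Δ : Ctx} (s : Sub Γ Δ) (ρ : V Δ) : V Γ := Tup.tabulate fun _ x => (s _ x).ev ρ

def Ren.ev {Γ Δ : Ctx} (r : Ren Γ Δ) (ρ : V Δ) : V Γ := Tup.tabulate fun _ x => ρ.get (r _ x)

@[simp] theorem Term.ev_var {Γ : Ctx} {σ : Ty} (x : Var Γ σ) (ρ : V Γ) :
    (Term.var x).ev ρ = ρ.get x := rfl

@[simp] theorem Term.ev_app {Γ : Ctx} {σ τ : Ty} (s : Term Γ (.arr σ τ)) (t : Term Γ σ) (ρ : V Γ) :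
    (Term.app s t).ev ρ = s.ev ρ (t.ev ρ) := rfl

@[simp] theorem Sub.ev_lift {Γ Δ : Ctx} {σ : Ty} (s : Sub Γ Δ) (d : D σ) (ρ : V Δ)
    (h : ∀ {τ : Ty} (t : Term Δ τ), (t.wk σ).ev (d ∷ ρ) = t.ev ρ) :
    (s.lift σ).ev (d ∷ ρ) = d ∷ s.ev ρ := by
  refine Tup.cons_congr rfl (Tup.ext_get fun τ x => ?_)
  simp only [Sub.ev, Tup.get_tabulate]
  exact h _

theorem Term.ev_subst {Γ Δ : Ctx} {σ : Ty} (s : Sub Γ Δ) (t : Term Γ σ) (ρ : V Δ) :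
    (t.subst s).ev ρ = t.ev (s.ev ρ) := by
  induction t with
  | var x => exact (Tup.get_tabulate (fun _ x => (s _ x).ev ρ) x).symm
  | app t u ht hu => simp only [Term.subst, Term.ev_app, ht, hu]
  | _ => rfl

theorem Term.ev_ren {Γ Δ : Ctx} {σ : Ty} (r : Ren Γ Δ) (t : Term Γ σ) (ρ : V Δ) :
    (t.ren r).ev ρ = t.ev (r.ev ρ) := by
  rw [Term.ren_eq_subst, Term.ev_subst]; rfl

theorem Ren.ev_succ {Γ : Ctx} {σ : Ty} (d : D σ) (ρ : V Γ) :
    Ren.ev (fun _ x => Var.succ x) (d ∷ ρ) = ρ := Tup.tabulate_get ρ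

@[simp] theorem Term.ev_wk {Γ : Ctx} {σ τ : Ty} (t : Term Γ τ) (d : D σ) (ρ : V Γ) :
    (t.wk σ).ev (d ∷ ρ) = t.ev ρ := by
  rw [Term.wk, Term.ev_ren, Ren.ev_succ]

theorem Sub.ev_lift' {Γ Δ : Ctx} {σ : Ty} (s : Sub Γ Δ) (d : D σ) (ρ : V Δ) :
    (s.lift σ).ev (d ∷ ρ) = d ∷ s.ev ρ := Sub.ev_lift s d ρ fun _ => Term.ev_wk _ _ _

theorem Sub.ev_id {Γ : Ctx} (ρ : V Γ) : (Sub.id Γ).ev ρ = ρ := Tup.tabulate_get ρ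

theorem Sub.ev_inst {Γ : Ctx} {σ : Ty} (t : Term Γ σ) (ρ : V Γ) :
    (Sub.inst t).ev ρ = t.ev ρ ∷ ρ :=
  Tup.cons_congr rfl (Tup.tabulate_get ρ)

theorem Sub.ev_incr {Γ : Ctx} (n : D .nat) (ρ : V Γ) :
    (Sub.incr Γ).ev (n ∷ ρ) = (theModel.succ n ∷ ρ) :=
  Tup.cons_congr rfl (Tup.tabulate_get ρ)

theorem Formula.val_subst {Γ Δ : Ctx} (s : Sub Γ Δ) (A : Formula Γ) (ρ : V Δ) :
    (A.subst s).val ρ = A.val (s.ev ρ) := by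
  unfold Formula.val
  induction A generalizing Δ with
  | eq t u => exact congrArg₂ theModel.eq (Term.ev_subst s t ρ) (Term.ev_subst s u ρ)
  | st t => exact congrArg theModel.st (Term.ev_subst s t ρ)
  | and A B hA hB => exact congrArg₂ _ (hA s ρ) (hB s ρ)
  | or A B hA hB => exact congrArg₂ _ (hA s ρ) (hB s ρ)
  | imp A B hA hB => exact congrArg₂ _ (hA s ρ) (hB s ρ)
  | all σ A hA => exact iInf_congr fun d => (hA _ _).trans (by rw [Sub.ev_lift'])
  | ex σ A hA => exact iSup_congr fun d => (hA _ _).trans (by rw [Sub.ev_lift'])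

theorem Formula.val_ren {Γ Δ : Ctx} (r : Ren Γ Δ) (A : Formula Γ) (ρ : V Δ) :
    (A.ren r).val ρ = A.val (r.ev ρ) := by
  rw [Formula.ren_eq_subst, Formula.val_subst]; rfl

theorem Ren.ev_wkN {Γ : Ctx} {σs : List Ty} (a : V σs) (ρ : V Γ) :
    (Ren.wkN σs).ev (Tup.ext a ρ) = ρ := by
  refine Tup.ext_get fun τ x => ?_
  rw [Ren.ev, Tup.get_tabulate]
  induction σs generalizing Γ with
  | nil => rfl
  | cons σ σs ih => exact ih a.tl (Γ := σ :: Γ) (a.hd ∷ ρ) (.succ x)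

theorem Ren.ev_liftN {Γ Δ : Ctx} {σs : List Ty} (r : Ren Γ Δ) (a : V σs) (ρ : V Δ) :
    (r.liftN σs).ev (Tup.ext a ρ) = Tup.ext a (r.ev ρ) := by
  induction σs generalizing Γ Δ with
  | nil => rfl
  | cons σ σs ih => exact ih (r.lift σ) a.tl (a.hd ∷ ρ)

theorem Sub.ev_wkN {Γ Δ : Ctx} {σs : List Ty} (s : Sub Γ Δ) (a : V σs) (ρ : V Δ) :
    (s.wkN σs).ev (Tup.ext a ρ) = s.ev ρ := by
  refine Tup.ext_get fun τ x => ?_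
  rw [Sub.ev, Sub.ev, Tup.get_tabulate, Tup.get_tabulate, Sub.wkN, Term.ev_ren, Ren.ev_wkN]

theorem Terms.ev_subst {Γ Δ : Ctx} {σs : List Ty} (s : Sub Γ Δ) (ts : Terms Γ σs) (ρ : V Δ) :
    (ts.subst s).ev ρ = ts.ev (s.ev ρ) := by
  induction ts with
  | nil => rfl
  | cons t ts ih => exact Tup.cons_congr (Term.ev_subst s t ρ) ih

theorem Terms.ev_ren {Γ Δ : Ctx} {σs : List Ty} (r : Ren Γ Δ) (ts : Terms Γ σs) (ρ : V Δ) :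
    (ts.ren r).ev ρ = ts.ev (r.ev ρ) := by
  rw [Terms.ren_eq_subst, Terms.ev_subst]; rfl

@[simp] theorem Terms.ev_wk {Γ : Ctx} {σs : List Ty} {σ : Ty} (ts : Terms Γ σs) (d : D σ)
    (ρ : V Γ) : (ts.wk σ).ev (d ∷ ρ) = ts.ev ρ := by
  rw [Terms.wk, Terms.ev_ren, Ren.ev_succ]

@[simp] theorem Terms.ev_wkN {Γ : Ctx} {σs τs : List Ty} (ts : Terms Γ τs) (a : V σs) (ρ : V Γ) :
    (ts.wkN σs).ev (Tup.ext a ρ) = ts.ev ρ := by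
  rw [Terms.wkN, Terms.ev_ren, Ren.ev_wkN]

@[simp] theorem Terms.ev_fresh {Γ : Ctx} {σs : List Ty} (a : V σs) (ρ : V Γ) :
    (Terms.fresh σs).ev (Tup.ext a ρ) = a := by
  induction σs generalizing Γ with
  | nil => rfl
  | cons σ σs ih =>
    refine Tup.cons_congr ?_ (ih a.tl (Γ := σ :: Γ) (a.hd ∷ ρ))
    have := congrArg (fun v : V (σ :: Γ) => v.hd) (Ren.ev_wkN (Γ := σ :: Γ) a.tl (a.hd ∷ ρ))
    exact this

@[simp] theorem Terms.ev_ofClosed {Γ : Ctx} {σs : List Ty} (ts : Terms [] σs) (ρ : V Γ) :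
    (ts.ofClosed Γ).ev ρ = ts.ev Tup.nil := by
  rw [Terms.ofClosed, Terms.ev_ren]; rfl

@[simp] theorem Term.ev_ofClosed {Γ : Ctx} {σ : Ty} (t : Term [] σ) (ρ : V Γ) :
    (t.ofClosed Γ).ev ρ = t.ev Tup.nil := by
  rw [Term.ofClosed, Term.ev_ren]; rfl

@[simp] theorem Terms.ev_append {Γ : Ctx} {σs τs : List Ty} (ts : Terms Γ σs) (us : Terms Γ τs)
    (ρ : V Γ) : (ts.append us).ev ρ = (ts.ev ρ).append (us.ev ρ) := by
  induction ts with
  | nil => rfl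
  | cons t ts ih => exact Tup.cons_congr rfl ih

@[simp] theorem Terms.ev_left {Γ : Ctx} {σs τs : List Ty} (ts : Terms Γ (σs ++ τs)) (ρ : V Γ) :
    (ts.left (σs := σs)).ev ρ = (ts.ev ρ).left := by
  induction σs with
  | nil => rfl
  | cons σ σs ih => cases ts with
    | cons t ts => exact Tup.cons_congr rfl (ih ts)

@[simp] theorem Terms.ev_right {Γ : Ctx} {σs τs : List Ty} (ts : Terms Γ (σs ++ τs)) (ρ : V Γ) :
    (ts.right (σs := σs)).ev ρ = (ts.ev ρ).right := by
  induction σs with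
  | nil => rfl
  | cons σ σs ih => cases ts with
    | cons t ts => exact ih ts

theorem Terms.ev_get {Γ : Ctx} {σs : List Ty} {τ : Ty} (ts : Terms Γ σs) (i : Var σs τ) (ρ : V Γ) :
    (ts.get i).ev ρ = (ts.ev ρ).get i := by
  induction i with
  | zero => cases ts; rfl
  | succ i ih => cases ts; exact ih _

theorem Terms.ev_tabulate {Γ : Ctx} {σs : List Ty} (f : ∀ τ : Ty, Var σs τ → Term Γ τ) (ρ : V Γ) :
    (Terms.tabulate f).ev ρ = Tup.tabulate fun _ i => (f _ i).ev ρ := by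
  induction σs with
  | nil => rfl
  | cons σ σs ih => exact Tup.cons_congr rfl (ih _)

/-- Iterated application. -/
def appD : {σs : List Ty} → {τ : Ty} → D (arrs σs τ) → V σs → D τ
  | [], _, f, _ => f
  | σ :: σs, τ, f, a => appD (σs := σs) (theModel.app (σ := σ) (τ := arrs σs τ) f a.hd) a.tl

/-- Application of a tuple of functions to a tuple of arguments. -/
def appT {σs : List Ty} : {τs : List Ty} → V (τs.map (arrs σs)) → V σs → V τs
  | [], _, _ => Tup.nil
  | _ :: τs, f, a => appD (σs := σs) f.hd a ∷ appT (τs := τs) f.tl a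

@[simp] theorem Term.ev_apps {Γ : Ctx} {σs : List Ty} {τ : Ty} (t : Term Γ (arrs σs τ))
    (as : Terms Γ σs) (ρ : V Γ) : (t.apps as).ev ρ = appD (t.ev ρ) (as.ev ρ) := by
  induction as with
  | nil => rfl
  | cons a as ih => exact ih _

@[simp] theorem Terms.ev_apps {Γ : Ctx} {σs τs : List Ty} (ts : Terms Γ (τs.map (arrs σs)))
    (as : Terms Γ σs) (ρ : V Γ) : (ts.apps as).ev ρ = appT (ts.ev ρ) (as.ev ρ) := by
  induction τs with
  | nil => rfl
  | cons τ τs ih => cases ts with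
    | cons t ts => exact Tup.cons_congr (Term.ev_apps t as ρ) (ih ts)

/-- The tuple of all variables of a context. -/
def Terms.vars (Γ : Ctx) : Terms Γ Γ := Terms.tabulate fun _ x => .var x

@[simp] theorem Terms.ev_vars {Γ : Ctx} (ρ : V Γ) : (Terms.vars Γ).ev ρ = ρ := by
  rw [Terms.vars, Terms.ev_tabulate]; exact Tup.tabulate_get ρ

/-- A tuple of terms as a substitution. -/
def Terms.toSub {Γ Δ : Ctx} (ts : Terms Δ Γ) : Sub Γ Δ := fun _ x => ts.get x

theorem Terms.ev_toSub {Γ Δ : Ctx} (ts : Terms Δ Γ) (ρ : V Δ) : ts.toSub.ev ρ = ts.ev ρ := by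
  refine Tup.ext_get fun τ x => ?_
  rw [Sub.ev, Tup.get_tabulate, Terms.toSub, Terms.ev_get]

/-! ### Values of the defined formulas -/

def add (x y : D .nat) : D .nat :=
  (Term.add (Γ := [.nat, .nat]) (.var .zero) (.var (.succ .zero))).ev (x ∷ y ∷ Tup.nil)

theorem Term.ev_add {Γ : Ctx} (s t : Term Γ .nat) (ρ : V Γ) :
    (s.add t).ev ρ = EHA.add (s.ev ρ) (t.ev ρ) := rfl

/-- Extensional equality. -/
def eqD : {σ : Ty} → D σ → D σ → H
  | .nat, x, y => theModel.eq x y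
  | .arr ρ τ, x, y => ⨅ u : D ρ, eqD (σ := τ) (theModel.app x u) (theModel.app y u)

/-- Majorizability. -/
def mjr : {σ : Ty} → D σ → D σ → H
  | .nat, x, y => ⨆ k : D .nat, theModel.eq (add x k) y
  | .arr ρ τ, x, y => ⨅ (v : D ρ) (u : D ρ), mjr (σ := ρ) u v ⇨
      mjr (σ := τ) (theModel.app x u) (theModel.app y v) ⊓
        mjr (σ := τ) (theModel.app y u) (theModel.app y v)

theorem Formula.val_eqT {Γ : Ctx} {σ : Ty} (s t : Term Γ σ) (ρ : V Γ) :
    (eqT σ s t).val ρ = eqD (s.ev ρ) (t.ev ρ) := by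
  induction σ generalizing Γ with
  | nat => rfl
  | arr σ τ _ ih =>
    refine iInf_congr fun u => (ih _ _ _).trans ?_
    simp only [Term.ev_app, Term.ev_wk]; rfl

theorem Formula.val_maj {Γ : Ctx} {σ : Ty} (s t : Term Γ σ) (ρ : V Γ) :
    (maj s t).val ρ = mjr (s.ev ρ) (t.ev ρ) := by
  induction σ generalizing Γ with
  | nat =>
    refine iSup_congr fun k => ?_
    refine congrArg₂ theModel.eq ?_ (Term.ev_wk t k ρ)
    exact (Term.ev_add _ _ _).trans (congrArg₂ _ (Term.ev_wk s k ρ) rfl)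
  | arr σ τ ih1 ih2 =>
    refine iInf_congr fun v => iInf_congr fun u => ?_
    refine congrArg₂ _ (ih1 _ _ _) (congrArg₂ _ ((ih2 _ _ _).trans ?_) ((ih2 _ _ _).trans ?_))
    all_goals simp only [Term.ev_app, Term.ev_wk]; rfl

/-- Componentwise majorizability. -/
def mjrT : {σs : List Ty} → V σs → V σs → H
  | [], _, _ => ⊤
  | _ :: _, a, b => mjr a.hd b.hd ⊓ mjrT a.tl b.tl

/-- Componentwise standardness. -/
def stT : {σs : List Ty} → V σs → H
  | [], _ => ⊤
  | _ :: _, a => theModel.st a.hd ⊓ stT a.tl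

/-- Lets a chain of guarded quantifiers, one per variable, be read as one guarded infimum over
tuples. -/
theorem iInf_prod_himp {σ : Ty} {σs : List Ty} (φ : D σ → H) (ψ χ : D σ → V σs → H) :
    (⨅ x, φ x ⇨ ⨅ a, ψ x a ⇨ χ x a) = ⨅ a : V (σ :: σs), φ a.hd ⊓ ψ a.hd a.tl ⇨ χ a.hd a.tl := by
  refine eq_of_forall_le_iff fun p => ?_
  simp only [le_iInf_iff, le_himp_iff]
  constructor
  · intro h a
    have := h a.hd a.tl
    rwa [inf_assoc] at this
  · intro h x a
    have := h (x, a)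
    rwa [← inf_assoc] at this

theorem Formula.val_allStMon {Γ : Ctx} {σs : List Ty} (A : Formula (Ctx.ext σs Γ)) (ρ : V Γ) :
    (allStMon σs A).val ρ = ⨅ a : V σs, stT a ⊓ mjrT a a ⇨ A.val (Tup.ext a ρ) := by
  induction σs generalizing Γ with
  | nil =>
    refine eq_of_forall_le_iff fun p => ?_
    simp only [le_iInf_iff, le_himp_iff]
    exact ⟨fun h _ => inf_le_left.trans h,
      fun h => (le_inf le_rfl (by simp [stT, mjrT])).trans (h Tup.nil)⟩
  | cons σ σs ih =>
    have h1 : (allStMon (σ :: σs) A).val ρ = ⨅ x : D σ, theModel.st x ⊓ mjr x x ⇨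
        ⨅ a : V σs, stT a ⊓ mjrT a a ⇨ A.val (Tup.ext (σs := σs) (Γ := σ :: Γ) a (x ∷ ρ)) :=
      iInf_congr fun x => congrArg₂ _ (congrArg₂ _ rfl (Formula.val_maj _ _ _)) (ih A (x ∷ ρ))
    rw [h1, iInf_prod_himp]
    refine iInf_congr fun a => congrArg₂ _ ?_ rfl
    exact inf_inf_inf_comm _ _ _ _

theorem Formula.val_allMonMaj {Γ : Ctx} {σs : List Ty} (ts : Terms Γ σs)
    (A : Formula (Ctx.ext σs Γ)) (ρ : V Γ) :
    (allMonMaj σs ts A).val ρ =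
      ⨅ a : V σs, mjrT a a ⊓ mjrT a (ts.ev ρ) ⇨ A.val (Tup.ext a ρ) := by
  induction σs generalizing Γ with
  | nil =>
    refine eq_of_forall_le_iff fun p => ?_
    simp only [le_iInf_iff, le_himp_iff]
    exact ⟨fun h _ => inf_le_left.trans h,
      fun h => (le_inf le_rfl (by simp [mjrT])).trans (h Tup.nil)⟩
  | cons σ σs ih =>
    cases ts with
    | cons t ts =>
      have h1 : (allMonMaj (σ :: σs) (.cons t ts) A).val ρ =
          ⨅ x : D σ, mjr x x ⊓ mjr x (t.ev ρ) ⇨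
          ⨅ a : V σs, mjrT a a ⊓ mjrT a (ts.ev ρ) ⇨
            A.val (Tup.ext (σs := σs) (Γ := σ :: Γ) a (x ∷ ρ)) := by
        refine iInf_congr fun x => congrArg₂ _ (congrArg₂ _ (Formula.val_maj _ _ _) ?_) ?_
        · exact (Formula.val_maj _ _ _).trans (congrArg₂ _ rfl (Term.ev_wk _ _ _))
        · exact (ih _ A (x ∷ ρ)).trans (by rw [Terms.ev_wk])
      rw [h1, iInf_prod_himp]
      refine iInf_congr fun a => congrArg₂ _ ?_ rfl
      exact inf_inf_inf_comm _ _ _ _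

theorem Formula.val_allMaj {Γ : Ctx} {σs : List Ty} (ts : Terms Γ σs)
    (A : Formula (Ctx.ext σs Γ)) (ρ : V Γ) :
    (allMaj σs ts A).val ρ = ⨅ a : V σs, mjrT a (ts.ev ρ) ⇨ A.val (Tup.ext a ρ) := by
  induction σs generalizing Γ with
  | nil =>
    refine eq_of_forall_le_iff fun p => ?_
    simp only [le_iInf_iff, le_himp_iff]
    exact ⟨fun h _ => inf_le_left.trans h,
      fun h => (le_inf le_rfl (by simp [mjrT])).trans (h Tup.nil)⟩
  | cons σ σs ih =>
    cases ts with
    | cons t ts =>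
      have h1 : (allMaj (σ :: σs) (.cons t ts) A).val ρ = ⨅ x : D σ, mjr x (t.ev ρ) ⇨
          ⨅ a : V σs, mjrT a (ts.ev ρ) ⇨ A.val (Tup.ext (σs := σs) (Γ := σ :: Γ) a (x ∷ ρ)) := by
        refine iInf_congr fun x => congrArg₂ (· ⇨ ·) ?_ ?_
        · exact (Formula.val_maj _ _ _).trans (congrArg₂ _ rfl (Term.ev_wk _ _ _))
        · exact (ih _ A (x ∷ ρ)).trans (by rw [Terms.ev_wk])
      rw [h1, iInf_prod_himp]
      rfl

theorem Formula.val_exs {Γ : Ctx} {σs : List Ty} (A : Formula (Ctx.ext σs Γ)) (ρ : V Γ) :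
    (exs σs A).val ρ = ⨆ a : V σs, A.val (Tup.ext a ρ) := by
  induction σs generalizing Γ with
  | nil => exact (iSup_const (ι := Unit)).symm
  | cons σ σs ih =>
    have h1 : (exs (σ :: σs) A).val ρ =
        ⨆ x : D σ, ⨆ a : V σs, A.val (Tup.ext (σs := σs) (Γ := σ :: Γ) a (x ∷ ρ)) :=
      iSup_congr fun x => ih A (x ∷ ρ)
    rw [h1]
    exact (iSup_prod (f := fun p : D σ × V σs =>
      A.val (Tup.ext (σs := σs) (Γ := σ :: Γ) p.2 (p.1 ∷ ρ)))).symm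

/-! ### Laws of the model -/

theorem EHAst.val_eq_top {Γ : Ctx} {A : Formula Γ} (h : EHAst A) (ρ : V Γ) : A.val ρ = ⊤ :=
  (theModel.complete A).1 h ρ

theorem EHAst.of_val {Γ : Ctx} {A : Formula Γ} (h : ∀ ρ, A.val ρ = ⊤) : EHAst A :=
  (theModel.complete A).2 h

/-- Separation of the model. It turns provable equations into identities, which makes the conversion
rules available to `rw`; equations of a smaller truth value still need congruence lemmas. -/
theorem eq_of_eqD {σ : Ty} {x y : D σ} (h : eqD x y = ⊤) : x = y := by
  refine theModel.separated x y ?_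
  rw [← h]
  exact Formula.val_eqT (Γ := [σ, σ]) (.var .zero) (.var (.succ .zero)) (x ∷ y ∷ Tup.nil)

theorem EHAst.ev_eq {Γ : Ctx} {σ : Ty} {s t : Term Γ σ} (h : EHAst (eqT σ s t)) (ρ : V Γ) :
    s.ev ρ = t.ev ρ :=
  eq_of_eqD ((Formula.val_eqT s t ρ).symm.trans (h.val_eq_top ρ))

theorem K_app {σ τ : Ty} (x : D σ) (y : D τ) :
    theModel.app (theModel.app (theModel.K σ τ) x) y = x :=
  EHAst.ev_eq (Γ := [σ, τ]) (.arith (.combK (.var .zero) (.var (.succ .zero)))) (x ∷ y ∷ Tup.nil)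

theorem S_app {δ σ τ : Ty} (x : D (.arr δ (.arr σ τ))) (y : D (.arr δ σ)) (z : D δ) :
    theModel.app (theModel.app (theModel.app (theModel.S δ σ τ) x) y) z = (x z) (y z) :=
  EHAst.ev_eq (Γ := [.arr δ (.arr σ τ), .arr δ σ, δ])
    (.arith (.combS (.var .zero) (.var (.succ .zero)) (.var (.succ (.succ .zero)))))
    (x ∷ y ∷ z ∷ Tup.nil)

/-- The tuple of simultaneous recursors. -/
def recT {ρs : List Ty} (n : D .nat) (y : V ρs) (z : V (ρs.map (arrs (ρs ++ [.nat])))) : V ρs :=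
  Tup.tabulate fun τ i => appD (σs := ρs.map (arrs (ρs ++ [.nat]))) (τ := τ)
    (appD (σs := ρs) (theModel.app (theModel.R i) n) y) z

theorem recT_zero {ρs : List Ty} (y : V ρs) (z : V (ρs.map (arrs (ρs ++ [.nat])))) :
    recT theModel.zero y z = y := by
  refine Tup.ext_get fun τ i => ?_
  have := EHAst.ev_eq (.arith (.recr_zero i (Terms.vars (ρs ++ ρs.map (arrs (ρs ++ [.nat])))).left
    (Terms.vars (ρs ++ ρs.map (arrs (ρs ++ [.nat])))).right)) (Tup.append y z)
  simp only [Term.ev_apps, Terms.ev_left, Terms.ev_right, Terms.ev_vars, Tup.left_append,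
    Tup.right_append, Terms.ev_get] at this
  rw [recT, Tup.get_tabulate, ← this]; rfl

theorem recT_succ {ρs : List Ty} (n : D .nat) (y : V ρs) (z : V (ρs.map (arrs (ρs ++ [.nat])))) :
    recT (theModel.succ n) y z = appT z ((recT n y z).append (n ∷ Tup.nil)) := by
  refine Tup.ext_get fun τ i => ?_
  let Γ : Ctx := .nat :: (ρs ++ ρs.map (arrs (ρs ++ [.nat])))
  let vs : Terms Γ (ρs ++ ρs.map (arrs (ρs ++ [.nat]))) := (Terms.vars _).wk .nat
  have := EHAst.ev_eq (.arith (.recr_succ i (.var .zero) vs.left vs.right))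
    ((n ∷ Tup.append y z) : V Γ)
  simp only [vs, Term.ev_apps, Terms.ev_left, Terms.ev_right, Terms.ev_vars, Tup.left_append,
    Tup.right_append, Terms.ev_get, Terms.ev_wk, Terms.ev_apps, Terms.ev_append,
    Terms.ev_tabulate] at this
  rw [recT, Tup.get_tabulate]
  exact this

theorem eqD_app {σ τ : Ty} (z : D (.arr σ τ)) (x y : D σ) : eqD x y ≤ eqD (z x) (z y) := by
  have := EHAst.val_eq_top (Γ := [.arr σ τ, σ, σ]) (.arith (.extensionality (.var .zero)
    (.var (.succ .zero)) (.var (.succ (.succ .zero))))) (z ∷ x ∷ y ∷ Tup.nil)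
  have h : (eqT σ _ _).val _ ⇨ (eqT τ _ _).val _ = ⊤ := this
  rw [himp_eq_top_iff, Formula.val_eqT, Formula.val_eqT] at h
  exact h

theorem eq_refl (x : D .nat) : theModel.eq x x = ⊤ :=
  EHAst.val_eq_top (Γ := [.nat]) (.arith (.eq_refl (.var .zero))) (x ∷ Tup.nil)

theorem eq_symm (x y : D .nat) : theModel.eq x y ≤ theModel.eq y x :=
  himp_eq_top_iff.1 (EHAst.val_eq_top (Γ := [.nat, .nat])
    (.arith (.eq_symm (.var .zero) (.var (.succ .zero)))) (x ∷ y ∷ Tup.nil))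

theorem eq_trans {p : H} {x y z : D .nat} (h1 : p ≤ theModel.eq x y) (h2 : p ≤ theModel.eq y z) :
    p ≤ theModel.eq x z :=
  (le_inf h1 h2).trans (himp_eq_top_iff.1 (EHAst.val_eq_top (Γ := [.nat, .nat, .nat])
    (.arith (.eq_trans (.var .zero) (.var (.succ .zero)) (.var (.succ (.succ .zero)))))
      (x ∷ y ∷ z ∷ Tup.nil)))

theorem st_app {p : H} {σ τ : Ty} {z : D (.arr σ τ)} {x : D σ} (hz : p ≤ theModel.st z)
    (hx : p ≤ theModel.st x) : p ≤ theModel.st (z x) := by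
  have := himp_eq_top_iff.1 (EHAst.val_eq_top (Γ := [.arr σ τ, σ])
    (.standardness (.app (.var .zero) (.var (.succ .zero)))) (z ∷ x ∷ Tup.nil))
  exact (le_inf (hz.trans this) hx).trans himp_inf_le

theorem st_of_mjr {p : H} {σ : Ty} {x y : D σ} (hy : p ≤ theModel.st y) (h : p ≤ mjr x y) :
    p ≤ theModel.st x := by
  have h1 := himp_eq_top_iff.1 (EHAst.val_eq_top (Γ := [σ, σ])
    (.standardness (.maj (.var .zero) (.var (.succ .zero)))) (x ∷ y ∷ Tup.nil))
  have h2 : theModel.st y ≤ mjr x y ⇨ theModel.st x := by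
    refine h1.trans (le_of_eq ?_)
    exact congrArg₂ _ (Formula.val_maj _ _ _) rfl
  exact (le_inf (hy.trans h2) h).trans himp_inf_le

theorem st_closed {σ : Ty} (t : Term [] σ) : theModel.st (t.ev Tup.nil) = ⊤ := by
  have : theModel.st ((t.ofClosed []).ev Tup.nil) = ⊤ :=
    EHAst.val_eq_top (Γ := []) (.standardness (.closed t)) Tup.nil
  rwa [Term.ev_ofClosed] at this

theorem bot_le' (p : H) : (Formula.bot (Γ := [])).val Tup.nil ≤ p :=
  (le_of_eq theModel.bot_eq).trans bot_le

/-- Induction for internal formulas. -/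
theorem internal_induction {Γ : Ctx} {A : Formula (.nat :: Γ)} (hA : A.Internal) {ρ : V Γ} {p : H}
    (h0 : p ≤ A.val (theModel.zero ∷ ρ))
    (h1 : ∀ n q, q ≤ p → q ≤ A.val (n ∷ ρ) → q ≤ A.val (theModel.succ n ∷ ρ)) (n : D .nat) :
    p ≤ A.val (n ∷ ρ) := by
  have h : ((A.inst .zero).val ρ ⊓ ⨅ n : D .nat, A.val (n ∷ ρ) ⇨
      (A.subst (Sub.incr Γ)).val (n ∷ ρ)) ⇨
      ⨅ n : D .nat, A.val (n ∷ ρ) = ⊤ := EHAst.val_eq_top (.arith (.induction A hA)) ρ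
  rw [himp_eq_top_iff] at h
  refine (le_inf ?_ (le_iInf fun n => ?_)).trans (h.trans (iInf_le _ n))
  · rw [Formula.inst, Formula.val_subst, Sub.ev_inst]; exact h0
  · rw [Formula.val_subst, Sub.ev_incr]
    exact le_himp_iff.2 (h1 n _ inf_le_left inf_le_right)


/-! ### Forcing -/

/-- The Kripke-style clause for implication. With the next two lemmas, which rest on distributivity
of the frame, it allows reasoning in the model by introducing hypotheses and splitting cases at
smaller conditions. -/
theorem le_himp_iff_forall {p a b : H} : p ≤ a ⇨ b ↔ ∀ q ≤ p, q ≤ a → q ≤ b := by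
  rw [le_himp_iff]
  exact ⟨fun h q h1 h2 => (le_inf h1 h2).trans h, fun h => h _ inf_le_left inf_le_right⟩

theorem le_of_le_iSup {ι : Type} {p c : H} {a : ι → H} (h : p ≤ ⨆ i, a i)
    (H : ∀ i, ∀ q ≤ p, q ≤ a i → q ≤ c) : p ≤ c := by
  have : p ≤ p ⊓ ⨆ i, a i := le_inf le_rfl h
  rw [inf_iSup_eq] at this
  exact this.trans (iSup_le fun i => H i _ inf_le_left inf_le_right)

theorem le_of_le_sup {p a b c : H} (h : p ≤ a ⊔ b) (ha : ∀ q ≤ p, q ≤ a → q ≤ c)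
    (hb : ∀ q ≤ p, q ≤ b → q ≤ c) : p ≤ c := by
  have : p ≤ p ⊓ (a ⊔ b) := le_inf le_rfl h
  rw [inf_sup_left] at this
  exact this.trans (sup_le (ha _ inf_le_left inf_le_right) (hb _ inf_le_left inf_le_right))

/-! ### Arithmetic -/

theorem add_zero' (x : D .nat) : add x theModel.zero = x :=
  congrArg Tup.hd (recT_zero (ρs := [.nat]) (x ∷ Tup.nil)
    (theModel.app (theModel.app (theModel.S .nat .nat (.arr .nat .nat))
      (theModel.app (theModel.K (.arr .nat (.arr .nat .nat)) .nat) (theModel.K .nat .nat)))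
      theModel.succ ∷ Tup.nil))

theorem add_succ' (x y : D .nat) : add x (theModel.succ y) = theModel.succ (add x y) := by
  refine (congrArg Tup.hd (recT_succ (ρs := [.nat]) y (x ∷ Tup.nil)
    (theModel.app (theModel.app (theModel.S .nat .nat (.arr .nat .nat))
      (theModel.app (theModel.K (.arr .nat (.arr .nat .nat)) .nat) (theModel.K .nat .nat)))
      theModel.succ ∷ Tup.nil))).trans ?_
  change theModel.app (theModel.app (theModel.app (theModel.app (theModel.S .nat .nat _) _) _)
    (add x y)) y = _
  rw [S_app, K_app, K_app]

theorem eq_of_eq_top {x y : D .nat} (h : ⊤ ≤ theModel.eq x y) : x = y :=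
  eq_of_eqD (σ := .nat) (top_le_iff.1 h)

theorem le_eq_refl {p : H} (x : D .nat) : p ≤ theModel.eq x x := (eq_refl x).symm ▸ le_top

theorem le_eq_succ {p : H} {x y : D .nat} (h : p ≤ theModel.eq x y) :
    p ≤ theModel.eq (theModel.succ x) (theModel.succ y) :=
  h.trans (eqD_app (σ := .nat) (τ := .nat) theModel.succ x y)

theorem zero_add' (x : D .nat) : add theModel.zero x = x := by
  refine eq_of_eq_top (internal_induction (Γ := [])
    (A := .eq (Term.zero.add (.var .zero)) (.var .zero)) (ρ := Tup.nil) trivial ?_ ?_ x)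
  · change ⊤ ≤ theModel.eq (add theModel.zero theModel.zero) theModel.zero
    rw [add_zero']
    exact le_eq_refl _
  · intro n q _ h
    change q ≤ theModel.eq (add theModel.zero (theModel.succ n)) (theModel.succ n)
    rw [add_succ']
    exact le_eq_succ h

theorem add_assoc' (x y z : D .nat) : add (add x y) z = add x (add y z) := by
  refine eq_of_eq_top (internal_induction (Γ := [.nat, .nat])
    (A := .eq (((Term.var (.succ .zero)).add (.var (.succ (.succ .zero)))).add (.var .zero))
      ((Term.var (.succ .zero)).add ((Term.var (.succ (.succ .zero))).add (.var .zero))))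
    (ρ := x ∷ y ∷ Tup.nil) trivial ?_ ?_ z)
  · change ⊤ ≤ theModel.eq (add (add x y) theModel.zero) (add x (add y theModel.zero))
    rw [add_zero', add_zero']
    exact le_eq_refl _
  · intro n q _ h
    change q ≤ theModel.eq (add (add x y) (theModel.succ n)) (add x (add y (theModel.succ n)))
    rw [add_succ', add_succ', add_succ']
    exact le_eq_succ h

theorem succ_add' (x y : D .nat) : add (theModel.succ x) y = theModel.succ (add x y) := by
  refine eq_of_eq_top (internal_induction (Γ := [.nat])
    (A := .eq ((Term.app .succ (.var (.succ .zero))).add (.var .zero))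
      (.app .succ ((Term.var (.succ .zero)).add (.var .zero))))
    (ρ := x ∷ Tup.nil) trivial ?_ ?_ y)
  · change ⊤ ≤ theModel.eq (add (theModel.succ x) theModel.zero)
      (theModel.succ (add x theModel.zero))
    rw [add_zero', add_zero']
    exact le_eq_refl _
  · intro n q _ h
    change q ≤ theModel.eq (add (theModel.succ x) (theModel.succ n))
      (theModel.succ (add x (theModel.succ n)))
    rw [add_succ', add_succ']
    exact le_eq_succ h

theorem add_comm' (x y : D .nat) : add x y = add y x := by
  refine eq_of_eq_top (internal_induction (Γ := [.nat])
    (A := .eq ((Term.var (.succ .zero)).add (.var .zero))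
      ((Term.var .zero).add (.var (.succ .zero))))
    (ρ := x ∷ Tup.nil) trivial ?_ ?_ y)
  · change ⊤ ≤ theModel.eq (add x theModel.zero) (add theModel.zero x)
    rw [add_zero', zero_add']
    exact le_eq_refl _
  · intro n q _ h
    change q ≤ theModel.eq (add x (theModel.succ n)) (add (theModel.succ n) x)
    rw [add_succ', succ_add']
    exact le_eq_succ h

/-! ### Extensional equality is a congruence -/

theorem eqD_fun {p : H} {σ τ : Ty} {f g : D (.arr σ τ)} (h : p ≤ eqD f g) (x : D σ) :
    p ≤ eqD (f x) (g x) := h.trans (iInf_le _ x)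

theorem eqD_appD {p : H} {σs : List Ty} {τ : Ty} {f g : D (arrs σs τ)} (h : p ≤ eqD f g)
    (a : V σs) : p ≤ eqD (appD f a) (appD g a) := by
  induction σs with
  | nil => exact h
  | cons σ σs ih => exact ih (eqD_fun (σ := σ) (τ := arrs σs τ) h a.hd) a.tl

theorem eqD_refl {p : H} {σ : Ty} (x : D σ) : p ≤ eqD x x := by
  induction σ with
  | nat => exact le_eq_refl x
  | arr σ τ _ ih => exact le_iInf fun u => ih _

/-- A sum is the recursor applied to its arguments one at a time, so extensionality is applied to
the recursor with its first argument fixed. -/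
theorem add_congr_left {p : H} {x x' : D .nat} (h : p ≤ theModel.eq x x') (k : D .nat) :
    p ≤ theModel.eq (add x k) (add x' k) := by
  have h1 := h.trans (eqD_app (σ := .nat) (τ := .arr (.arr .nat (.arr .nat .nat)) .nat)
    (theModel.app (theModel.R (ρs := [.nat]) .zero) k) x x')
  exact h1.trans (iInf_le _ _)

theorem add_congr_right {p : H} {k k' : D .nat} (x : D .nat) (h : p ≤ theModel.eq k k') :
    p ≤ theModel.eq (add x k) (add x k') := by
  have h1 := h.trans (eqD_app (σ := .nat) (τ := .arr .nat (.arr (.arr .nat (.arr .nat .nat)) .nat))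
    (theModel.R (ρs := [.nat]) .zero) k k')
  exact (h1.trans (iInf_le _ x)).trans (iInf_le _ _)

/-- Needed because an equation forced only at `p` does not identify the elements. -/
theorem mjr_congr {p : H} {σ : Ty} {x x' y y' : D σ} (hx : p ≤ eqD x x') (hy : p ≤ eqD y y')
    (h : p ≤ mjr x y) : p ≤ mjr x' y' := by
  induction σ generalizing p with
  | nat =>
    refine le_of_le_iSup h fun k q hq hk => le_trans ?_ (le_iSup _ k)
    exact eq_trans (eq_trans ((add_congr_left (hq.trans hx) k).trans (eq_symm _ _)) hk)
      (hq.trans hy)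
  | arr σ τ _ ih =>
    refine le_iInf fun v => le_iInf fun u => le_himp_iff_forall.2 fun q hq huv => ?_
    have h1 := le_himp_iff_forall.1 ((h.trans (iInf_le _ v)).trans (iInf_le _ u)) q hq huv
    exact le_inf
      (ih (hq.trans (eqD_fun hx u)) (hq.trans (eqD_fun hy v)) (h1.trans inf_le_left))
      (ih (hq.trans (eqD_fun hy u)) (hq.trans (eqD_fun hy v)) (h1.trans inf_le_right))

/-! ### Majorizability -/

theorem mjr_arr_iff {p : H} {σ τ : Ty} {f g : D (.arr σ τ)} :
    p ≤ mjr f g ↔ ∀ q ≤ p, ∀ u v : D σ, q ≤ mjr u v →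
      q ≤ mjr (f u) (g v) ∧ q ≤ mjr (g u) (g v) := by
  constructor
  · intro h q hq u v huv
    exact le_inf_iff.1 (le_himp_iff_forall.1 ((h.trans (iInf_le _ v)).trans (iInf_le _ u)) q hq huv)
  · intro h
    refine le_iInf fun v => le_iInf fun u => le_himp_iff_forall.2 fun q hq huv => ?_
    exact le_inf_iff.2 (h q hq u v huv)

theorem mjr_app {p : H} {σ τ : Ty} {f g : D (.arr σ τ)} {u v : D σ} (h : p ≤ mjr f g)
    (h' : p ≤ mjr u v) : p ≤ mjr (f u) (g v) := (mjr_arr_iff.1 h p le_rfl u v h').1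

theorem mjr_add_right {p : H} (x y : D .nat) : p ≤ mjr x (add x y) :=
  le_trans (le_eq_refl _) (le_iSup (fun k => theModel.eq (add x k) (add x y)) y)

theorem mjr_nat_refl {p : H} (x : D .nat) : p ≤ mjr x x := by
  have := mjr_add_right (p := p) x theModel.zero
  rwa [add_zero'] at this

/-- The second conjunct in the definition of strong majorizability is there for this property: a
majorant is automatically monotone. -/
theorem mjr_right {p : H} {σ : Ty} {x y : D σ} (h : p ≤ mjr x y) : p ≤ mjr y y := by
  cases σ with
  | nat => exact mjr_nat_refl y
  | arr σ τ =>
    exact mjr_arr_iff.2 fun q hq u v huv =>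
      have := (mjr_arr_iff.1 h q hq u v huv).2
      ⟨this, this⟩

theorem mjr_trans {p : H} {σ : Ty} {x y z : D σ} (h : p ≤ mjr x y) (h' : p ≤ mjr y z) :
    p ≤ mjr x z := by
  induction σ generalizing p with
  | nat =>
    refine le_of_le_iSup h fun k q hq hk => le_of_le_iSup (hq.trans h') fun l r hr hl => ?_
    refine le_trans ?_ (le_iSup _ (add k l))
    rw [← add_assoc']
    exact eq_trans (add_congr_left (hr.trans hk) l) hl
  | arr σ τ _ ih =>
    refine mjr_arr_iff.2 fun q hq u v huv => ⟨?_, (mjr_arr_iff.1 h' q hq u v huv).2⟩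
    -- The intermediate element is `y v`; comparing it with `z v` uses that `v` majorizes itself.
    exact ih (mjr_arr_iff.1 h q hq u v huv).1 (mjr_arr_iff.1 h' q hq v v (mjr_right huv)).1

theorem mjrT_iff {p : H} {σs : List Ty} {a b : V σs} :
    p ≤ mjrT a b ↔ ∀ τ (i : Var σs τ), p ≤ mjr (a.get i) (b.get i) := by
  induction σs with
  | nil => exact ⟨fun _ _ i => (nomatch i), fun _ => le_top⟩
  | cons σ σs ih =>
    refine le_inf_iff.trans ⟨fun h τ i => ?_, fun h => ⟨h _ .zero, ih.2 fun τ i => h τ i.succ⟩⟩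
    cases i with
    | zero => exact h.1
    | succ i => exact ih.1 h.2 τ i

theorem mjrT_right {p : H} {σs : List Ty} {a b : V σs} (h : p ≤ mjrT a b) : p ≤ mjrT b b :=
  mjrT_iff.2 fun τ i => mjr_right (mjrT_iff.1 h τ i)

theorem mjrT_trans {p : H} {σs : List Ty} {a b c : V σs} (h : p ≤ mjrT a b) (h' : p ≤ mjrT b c) :
    p ≤ mjrT a c :=
  mjrT_iff.2 fun τ i => mjr_trans (mjrT_iff.1 h τ i) (mjrT_iff.1 h' τ i)

theorem mjrT_nil {p : H} {a b : V []} : p ≤ mjrT a b := le_top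

theorem mjrT_cons {σ : Ty} {σs : List Ty} (x y : D σ) (a b : V σs) :
    mjrT (x ∷ a) (y ∷ b) = mjr x y ⊓ mjrT a b := rfl

theorem mjrT_append {σs τs : List Ty} (a b : V σs) (c d : V τs) :
    mjrT (a.append c) (b.append d) = mjrT a b ⊓ mjrT c d := by
  induction σs with
  | nil => exact (top_inf_eq _).symm
  | cons σ σs ih => exact (congrArg₂ _ rfl (ih a.tl b.tl)).trans (inf_assoc _ _ _).symm

theorem mjrT_append_iff {p : H} {σs τs : List Ty} {a b : V σs} {c d : V τs} :
    p ≤ mjrT (a.append c) (b.append d) ↔ p ≤ mjrT a b ∧ p ≤ mjrT c d := by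
  rw [mjrT_append, le_inf_iff]

theorem stT_append {σs τs : List Ty} (a : V σs) (b : V τs) :
    stT (a.append b) = stT a ⊓ stT b := by
  induction σs with
  | nil => exact (top_inf_eq _).symm
  | cons σ σs ih => exact (congrArg₂ _ rfl (ih a.tl)).trans (inf_assoc _ _ _).symm

theorem stT_iff {p : H} {σs : List Ty} {a : V σs} :
    p ≤ stT a ↔ ∀ τ (i : Var σs τ), p ≤ theModel.st (a.get i) := by
  induction σs with
  | nil => exact ⟨fun _ _ i => (nomatch i), fun _ => le_top⟩
  | cons σ σs ih =>
    refine le_inf_iff.trans ⟨fun h τ i => ?_, fun h => ⟨h _ .zero, ih.2 fun τ i => h τ i.succ⟩⟩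
    cases i with
    | zero => exact h.1
    | succ i => exact ih.1 h.2 τ i

theorem stT_of_mjrT {p : H} {σs : List Ty} {a b : V σs} (hb : p ≤ stT b) (h : p ≤ mjrT a b) :
    p ≤ stT a :=
  stT_iff.2 fun τ i => st_of_mjr (stT_iff.1 hb τ i) (mjrT_iff.1 h τ i)

theorem mjr_appD {p : H} {σs : List Ty} {τ : Ty} {f g : D (arrs σs τ)} {u v : V σs}
    (h : p ≤ mjr f g) (h' : p ≤ mjrT u v) : p ≤ mjr (appD f u) (appD g v) := by
  induction σs with
  | nil => exact h
  | cons σ σs ih =>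
    have h' := le_inf_iff.1 h'
    exact ih (mjr_app (σ := σ) (τ := arrs σs τ) h h'.1) h'.2

theorem mjr_of_appD {p : H} {σs : List Ty} {τ : Ty} {f g : D (arrs (σs) τ)}
    (h : ∀ q ≤ p, ∀ u v : V σs, q ≤ mjrT u v →
      q ≤ mjr (appD f u) (appD g v) ∧ q ≤ mjr (appD g u) (appD g v)) : p ≤ mjr f g := by
  induction σs generalizing p with
  | nil => exact (h p le_rfl Tup.nil Tup.nil mjrT_nil).1
  | cons σ σs ih =>
    refine mjr_arr_iff.2 fun q hq u v huv => ⟨ih fun r hr a b hab => ?_, ih fun r hr a b hab => ?_⟩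
    -- The second conjunct compares two values with the same head argument `v`, so the hypothesis is
    -- used once more with heads `v` and `v`.
    · have h1 := h r (hr.trans hq) (u ∷ a) (v ∷ b) (le_inf (hr.trans huv) hab)
      have h2 := h r (hr.trans hq) (v ∷ a) (v ∷ b) (le_inf (hr.trans (mjr_right huv)) hab)
      exact ⟨h1.1, h2.2⟩
    · have h1 := h r (hr.trans hq) (u ∷ a) (v ∷ b) (le_inf (hr.trans huv) hab)
      have h2 := h r (hr.trans hq) (v ∷ a) (v ∷ b) (le_inf (hr.trans (mjr_right huv)) hab)
      exact ⟨h1.2, h2.2⟩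

theorem mjrT_appT {p : H} {σs τs : List Ty} {f g : V (τs.map (arrs σs))} {u v : V σs}
    (h : p ≤ mjrT f g) (h' : p ≤ mjrT u v) : p ≤ mjrT (appT f u) (appT g v) := by
  induction τs with
  | nil => exact le_top
  | cons τ τs ih =>
    have h := le_inf_iff.1 h
    exact le_inf (mjr_appD h.1 h') (ih h.2)

theorem mjrT_of_appT {p : H} {σs τs : List Ty} {f g : V (τs.map (arrs σs))}
    (h : ∀ q ≤ p, ∀ u v : V σs, q ≤ mjrT u v →
      q ≤ mjrT (appT f u) (appT g v) ∧ q ≤ mjrT (appT g u) (appT g v)) : p ≤ mjrT f g := by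
  induction τs with
  | nil => exact le_top
  | cons τ τs ih =>
    refine le_inf (mjr_of_appD fun q hq u v huv => ?_) (ih fun q hq u v huv => ?_)
    · have := h q hq u v huv
      exact ⟨(le_inf_iff.1 this.1).1, (le_inf_iff.1 this.2).1⟩
    · have := h q hq u v huv
      exact ⟨(le_inf_iff.1 this.1).2, (le_inf_iff.1 this.2).2⟩

/-! ### Combinatory completeness -/

/-- Bracket abstraction. -/
def Term.lam {σ : Ty} {Γ : Ctx} : {τ : Ty} → Term (σ :: Γ) τ → Term Γ (.arr σ τ)
  | _, .var .zero => .app (.app (.combS σ (.arr σ σ) σ) (.combK σ (.arr σ σ))) (.combK σ σ)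
  | _, .var (.succ x) => .app (.combK _ σ) (.var x)
  | _, .zero => .app (.combK _ σ) .zero
  | _, .succ => .app (.combK _ σ) .succ
  | _, .combK a b => .app (.combK _ σ) (.combK a b)
  | _, .combS a b c => .app (.combK _ σ) (.combS a b c)
  | _, .recr i => .app (.combK _ σ) (.recr i)
  | τ, .app (σ := ρ) s t => .app (.app (.combS σ ρ τ) s.lam) t.lam

theorem Term.ev_lam {σ : Ty} {Γ : Ctx} (d : D σ) (ρ : V Γ) :
    ∀ {τ : Ty} (t : Term (σ :: Γ) τ), t.lam.ev ρ d = t.ev (d ∷ ρ)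
  | _, .var .zero => (S_app _ _ _).trans (K_app _ _)
  | _, .var (.succ _) => K_app _ _
  | _, .zero => K_app _ _
  | _, .succ => K_app _ _
  | _, .combK _ _ => K_app _ _
  | _, .combS _ _ _ => K_app _ _
  | _, .recr _ => K_app _ _
  | _, .app s t =>
    (S_app _ _ _).trans (congrArg₂ theModel.app (Term.ev_lam d ρ s) (Term.ev_lam d ρ t))

def Term.lamN : (σs : List Ty) → {Γ : Ctx} → {τ : Ty} → Term (Ctx.ext σs Γ) τ → Term Γ (arrs σs τ)
  | [], _, _, t => t
  | σ :: σs, Γ, _, t => (Term.lamN σs (Γ := σ :: Γ) t).lam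

theorem Term.ev_lamN {σs : List Ty} {τ : Ty} {Γ : Ctx} (t : Term (Ctx.ext σs Γ) τ) (a : V σs)
    (ρ : V Γ) : appD ((t.lamN σs).ev ρ) a = t.ev (Tup.ext a ρ) := by
  induction σs generalizing Γ with
  | nil => rfl
  | cons σ σs ih =>
    refine Eq.trans ?_ (ih (Γ := σ :: Γ) t a.tl (a.hd ∷ ρ))
    exact congrArg (fun f => appD (σs := σs) f a.tl)
      (Term.ev_lam a.hd ρ (Term.lamN σs (Γ := σ :: Γ) t))

def Terms.lamN (σs : List Ty) {Γ : Ctx} :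
    {τs : List Ty} → Terms (Ctx.ext σs Γ) τs → Terms Γ (τs.map (arrs σs))
  | _, .nil => .nil
  | _, .cons t ts => .cons (t.lamN σs) (Terms.lamN σs ts)

theorem Terms.ev_lamN {σs τs : List Ty} {Γ : Ctx} (ts : Terms (Ctx.ext σs Γ) τs) (a : V σs)
    (ρ : V Γ) : appT ((ts.lamN σs).ev ρ) a = ts.ev (Tup.ext a ρ) := by
  induction τs with
  | nil => cases ts; rfl
  | cons τ τs ih => cases ts with
    | cons t ts => exact Tup.cons_congr (Term.ev_lamN t a ρ) (ih ts)


/-! ### Monotone terms -/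

/-- Monotonicity in all free variables at once, at every truth value. For a closed term it amounts
to provable self-majorization. -/
def MonT {Γ : Ctx} {τ : Ty} (t : Term Γ τ) : Prop :=
  ∀ (p : H) (ρ ρ' : V Γ), p ≤ mjrT ρ ρ' → p ≤ mjr (t.ev ρ) (t.ev ρ')

def MonTs {Γ : Ctx} {τs : List Ty} (ts : Terms Γ τs) : Prop :=
  ∀ (p : H) (ρ ρ' : V Γ), p ≤ mjrT ρ ρ' → p ≤ mjrT (ts.ev ρ) (ts.ev ρ')

theorem mjrT_ren {p : H} {Γ Δ : Ctx} (r : Ren Γ Δ) {ρ ρ' : V Δ} (h : p ≤ mjrT ρ ρ') :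
    p ≤ mjrT (r.ev ρ) (r.ev ρ') := by
  refine mjrT_iff.2 fun τ i => ?_
  rw [Ren.ev, Ren.ev, Tup.get_tabulate, Tup.get_tabulate]
  exact mjrT_iff.1 h _ _

theorem MonT.var {Γ : Ctx} {τ : Ty} (x : Var Γ τ) : MonT (Term.var x) :=
  fun _ _ _ h => mjrT_iff.1 h _ x

/-- The two conjuncts of majorization at a function type are monotonicity of the body for the pairs
of valuations `ρ`, `ρ'` and `ρ'`, `ρ'`. -/
theorem MonT.lam {Γ : Ctx} {σ τ : Ty} {t : Term (σ :: Γ) τ} (ht : MonT t) : MonT t.lam := by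
  refine fun p ρ ρ' h => mjr_arr_iff.2 fun q hq u v huv => ?_
  rw [Term.ev_lam, Term.ev_lam, Term.ev_lam]
  exact ⟨ht q _ _ (le_inf huv (hq.trans h)), ht q _ _ (le_inf huv (hq.trans (mjrT_right h)))⟩

theorem MonT.lamN {σs : List Ty} {Γ : Ctx} {τ : Ty} {t : Term (Ctx.ext σs Γ) τ} (ht : MonT t) :
    MonT (t.lamN σs) := by
  induction σs generalizing Γ with
  | nil => exact ht
  | cons σ σs ih => exact MonT.lam (ih (Γ := σ :: Γ) ht)

theorem MonTs.ren {Γ Δ : Ctx} {τs : List Ty} {ts : Terms Γ τs} (h : MonTs ts) (r : Ren Γ Δ) :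
    MonTs (ts.ren r) := by
  intro p ρ ρ' hρ
  rw [Terms.ev_ren, Terms.ev_ren]
  exact h _ _ _ (mjrT_ren r hρ)

theorem MonTs.append {Γ : Ctx} {σs τs : List Ty} {ts : Terms Γ σs} {us : Terms Γ τs}
    (h : MonTs ts) (h' : MonTs us) : MonTs (ts.append us) := by
  intro p ρ ρ' hρ
  rw [Terms.ev_append, Terms.ev_append]
  exact mjrT_append_iff.2 ⟨h _ _ _ hρ, h' _ _ _ hρ⟩

theorem MonTs.cons {Γ : Ctx} {σ : Ty} {τs : List Ty} {t : Term Γ σ} {ts : Terms Γ τs}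
    (h : MonT t) (h' : MonTs ts) : MonTs (.cons t ts) :=
  fun p ρ ρ' hρ => le_inf (h p ρ ρ' hρ) (h' p ρ ρ' hρ)

theorem MonTs.vars (Γ : Ctx) : MonTs (Terms.vars Γ) := by
  intro p ρ ρ' hρ
  rwa [Terms.ev_vars, Terms.ev_vars]

theorem MonTs.fresh {Γ : Ctx} (σs : List Ty) : MonTs (Terms.fresh (Γ := Γ) σs) := by
  induction σs generalizing Γ with
  | nil => exact fun _ _ _ _ => le_top
  | cons σ σs ih => exact MonTs.cons (MonT.var _) ih

theorem MonTs.get {Γ : Ctx} {τs : List Ty} {ts : Terms Γ τs} (h : MonTs ts) {τ : Ty}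
    (i : Var τs τ) : MonT (ts.get i) := by
  intro p ρ ρ' hρ
  rw [Terms.ev_get, Terms.ev_get]
  exact mjrT_iff.1 (h p ρ ρ' hρ) _ i

theorem MonT.subst {Γ Δ : Ctx} {τ : Ty} {t : Term Γ τ} (ht : MonT t) {ts : Terms Δ Γ}
    (h : MonTs ts) : MonT (t.subst ts.toSub) := by
  intro p ρ ρ' hρ
  rw [Term.ev_subst, Term.ev_subst, Terms.ev_toSub, Terms.ev_toSub]
  exact ht _ _ _ (h p ρ ρ' hρ)

theorem MonTs.subst {Γ Δ : Ctx} {τs : List Ty} {us : Terms Γ τs} (hus : MonTs us) {ts : Terms Δ Γ}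
    (h : MonTs ts) : MonTs (us.subst ts.toSub) := by
  intro p ρ ρ' hρ
  rw [Terms.ev_subst, Terms.ev_subst, Terms.ev_toSub, Terms.ev_toSub]
  exact hus _ _ _ (h p ρ ρ' hρ)

/-! ### Monotone functionals on tuples -/

/-- A functional from tuples of types `σs` to tuples of types `τs`, given by a tuple of monotone
terms. -/
structure Mor (σs τs : List Ty) where
  tms : Terms σs τs
  mon : MonTs tms

instance {σs τs : List Ty} : CoeFun (Mor σs τs) fun _ => V σs → V τs := ⟨fun φ => φ.tms.ev⟩

theorem stT_ev {Γ : Ctx} {τ : Ty} (t : Term Γ τ) {p : H} {ρ : V Γ} (h : p ≤ stT ρ) :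
    p ≤ theModel.st (t.ev ρ) := by
  induction t with
  | var x => exact stT_iff.1 h _ x
  | app s t hs ht => exact st_app hs ht
  | zero => exact le_top.trans (st_closed .zero).ge
  | succ => exact le_top.trans (st_closed .succ).ge
  | combK σ τ => exact le_top.trans (st_closed (.combK σ τ)).ge
  | combS δ σ τ => exact le_top.trans (st_closed (.combS δ σ τ)).ge
  | recr i => exact le_top.trans (st_closed (.recr i)).ge

theorem stT_evs {Γ : Ctx} {τs : List Ty} (ts : Terms Γ τs) {p : H} {ρ : V Γ} (h : p ≤ stT ρ) :
    p ≤ stT (ts.ev ρ) := by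
  induction ts with
  | nil => exact le_top
  | cons t ts ih => exact le_inf (stT_ev t h) ih

namespace Mor

variable {σs τs υs : List Ty}

theorem mono (φ : Mor σs τs) {p : H} {a b : V σs} (h : p ≤ mjrT a b) : p ≤ mjrT (φ a) (φ b) :=
  φ.mon p a b h

theorem std (φ : Mor σs τs) {p : H} {a : V σs} (h : p ≤ stT a) : p ≤ stT (φ a) := stT_evs _ h

def id (σs : List Ty) : Mor σs σs := ⟨Terms.vars σs, MonTs.vars σs⟩

def comp (ψ : Mor τs υs) (φ : Mor σs τs) : Mor σs υs :=
  ⟨ψ.tms.subst φ.tms.toSub, ψ.mon.subst φ.mon⟩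

def pair (φ : Mor σs τs) (ψ : Mor σs υs) : Mor σs (τs ++ υs) :=
  ⟨φ.tms.append ψ.tms, φ.mon.append ψ.mon⟩

theorem _root_.EHA.mjrT_left {p : H} {a b : V (σs ++ τs)} (h : p ≤ mjrT a b) :
    p ≤ mjrT a.left b.left := by
  rw [← Tup.append_left_right a, ← Tup.append_left_right b] at h
  exact (mjrT_append_iff.1 h).1

theorem _root_.EHA.mjrT_right' {p : H} {a b : V (σs ++ τs)} (h : p ≤ mjrT a b) :
    p ≤ mjrT (a.right (σs := σs)) b.right := by
  rw [← Tup.append_left_right a, ← Tup.append_left_right b] at h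
  exact (mjrT_append_iff.1 h).2

def fst (φ : Mor σs (τs ++ υs)) : Mor σs τs :=
  ⟨φ.tms.left, fun p ρ ρ' h => by
    rw [Terms.ev_left, Terms.ev_left]
    exact mjrT_left (φ.mon p ρ ρ' h)⟩

def snd (φ : Mor σs (τs ++ υs)) : Mor σs υs :=
  ⟨φ.tms.right (σs := τs), fun p ρ ρ' h => by
    rw [Terms.ev_right, Terms.ev_right]
    exact mjrT_right' (φ.mon p ρ ρ' h)⟩

def app (φ : Mor σs (υs.map (arrs τs))) (ψ : Mor σs τs) : Mor σs υs :=
  ⟨φ.tms.apps ψ.tms, fun p ρ ρ' h => by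
    rw [Terms.ev_apps, Terms.ev_apps]
    exact mjrT_appT (φ.mon p ρ ρ' h) (ψ.mon p ρ ρ' h)⟩

theorem appT_curry (ts : Terms (σs ++ τs) υs) (a : V σs) (b : V τs) :
    appT (((ts.subst (((Terms.vars σs).wkN τs).append (Terms.fresh τs)).toSub).lamN τs).ev a) b =
      ts.ev (a.append b) := by
  rw [Terms.ev_lamN, Terms.ev_subst, Terms.ev_toSub, Terms.ev_append, Terms.ev_wkN, Terms.ev_vars,
    Terms.ev_fresh]

/-- Bracket abstraction over the second block of variables; the first block stays free. -/
def curry (φ : Mor (σs ++ τs) υs) : Mor σs (υs.map (arrs τs)) :=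
  ⟨(φ.tms.subst (((Terms.vars σs).wkN τs).append (Terms.fresh τs)).toSub).lamN τs,
    fun p ρ ρ' h => mjrT_of_appT fun q hq u v huv => by
      rw [appT_curry, appT_curry, appT_curry]
      exact ⟨φ.mono (mjrT_append_iff.2 ⟨hq.trans h, huv⟩),
        φ.mono (mjrT_append_iff.2 ⟨hq.trans (mjrT_right h), huv⟩)⟩⟩

theorem monT_default (Γ : Ctx) (σ : Ty) : MonT (Term.default (Γ := Γ) σ) := by
  induction σ with
  | nat => exact fun p ρ ρ' _ => mjr_nat_refl _
  | arr σ τ _ ih =>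
    refine fun p ρ ρ' h => mjr_arr_iff.2 fun q hq u v _ => ?_
    have h1 : ∀ (ρ : V Γ) (x : D σ), (Term.default (.arr σ τ)).ev ρ x = (Term.default τ).ev ρ :=
      fun _ _ => K_app _ _
    rw [h1, h1, h1]
    exact ⟨ih q ρ ρ' (hq.trans h), ih q ρ' ρ' (hq.trans (mjrT_right h))⟩

/-- A filler for components of a realizer or of a bound that play no role; with an empty target it
is the only tuple. -/
def zero (σs τs : List Ty) : Mor σs τs :=
  ⟨Terms.tabulate fun τ _ => Term.default τ, fun p ρ ρ' h => mjrT_iff.2 fun τ i => by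
    rw [Terms.ev_tabulate, Terms.ev_tabulate, Tup.get_tabulate, Tup.get_tabulate]
    exact monT_default _ _ p ρ ρ' h⟩

@[simp] theorem id_apply (a : V σs) : id σs a = a := Terms.ev_vars a

@[simp] theorem comp_apply (ψ : Mor τs υs) (φ : Mor σs τs) (a : V σs) : ψ.comp φ a = ψ (φ a) := by
  show (Terms.subst _ _).ev a = _
  rw [Terms.ev_subst, Terms.ev_toSub]

@[simp] theorem pair_apply (φ : Mor σs τs) (ψ : Mor σs υs) (a : V σs) :
    φ.pair ψ a = (φ a).append (ψ a) := Terms.ev_append _ _ _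

@[simp] theorem fst_apply (φ : Mor σs (τs ++ υs)) (a : V σs) : φ.fst a = (φ a).left :=
  Terms.ev_left _ _

@[simp] theorem snd_apply (φ : Mor σs (τs ++ υs)) (a : V σs) : φ.snd a = (φ a).right :=
  Terms.ev_right _ _

@[simp] theorem app_apply (φ : Mor σs (υs.map (arrs τs))) (ψ : Mor σs τs) (a : V σs) :
    φ.app ψ a = appT (φ a) (ψ a) := Terms.ev_apps _ _ _

@[simp] theorem curry_apply (φ : Mor (σs ++ τs) υs) (a : V σs) (b : V τs) :
    appT (φ.curry a) b = φ (a.append b) := appT_curry _ _ _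

end Mor

/-! ### Maxima -/

/-- A monotone upper bound of `s` and `t`. -/
def Term.max : (σ : Ty) → {Γ : Ctx} → Term Γ σ → Term Γ σ → Term Γ σ
  | .nat, _, s, t => s.add t
  | .arr ρ τ, _, s, t =>
    (Term.max τ (.app (s.wk ρ) (.var .zero)) (.app (t.wk ρ) (.var .zero))).lam

theorem Term.ev_max_arr {σ τ : Ty} {Γ : Ctx} (s t : Term Γ (.arr σ τ)) (ρ : V Γ) (u : D σ) :
    (Term.max (.arr σ τ) s t).ev ρ u =
      (Term.max τ (.app (s.wk σ) (.var .zero)) (.app (t.wk σ) (.var .zero))).ev (u ∷ ρ) :=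
  Term.ev_lam _ _ _

/-- The three claims are proved together: at a function type, being an upper bound includes
monotonicity of the bound. At type `0` the bound is the sum, which avoids any comparison of numbers.
-/
theorem Term.max_spec {σ : Ty} {Γ : Ctx} {p : H} {s s' t t' : Term Γ σ} {ρ ρ' : V Γ}
    (hs : p ≤ mjr (s.ev ρ) (s'.ev ρ')) (ht : p ≤ mjr (t.ev ρ) (t'.ev ρ')) :
    p ≤ mjr ((Term.max σ s t).ev ρ) ((Term.max σ s' t').ev ρ') ∧
      p ≤ mjr (s.ev ρ) ((Term.max σ s' t').ev ρ') ∧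
      p ≤ mjr (t.ev ρ) ((Term.max σ s' t').ev ρ') := by
  induction σ generalizing Γ p with
  | nat =>
    refine ⟨?_, mjr_trans hs (mjr_add_right _ _), mjr_trans ht ?_⟩
    · refine le_of_le_iSup hs fun k q hq hk => le_of_le_iSup (hq.trans ht) fun l r hr hl => ?_
      refine le_trans ?_ (le_iSup _ (EHA.add k l))
      have h1 : EHA.add ((s.add t).ev ρ) (EHA.add k l) =
          EHA.add (EHA.add (s.ev ρ) k) (EHA.add (t.ev ρ) l) := by
        rw [Term.ev_add, add_assoc', ← add_assoc' (t.ev ρ), add_comm' (t.ev ρ), add_assoc',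
          add_assoc']
      refine le_of_le_of_eq ?_ (congrArg (fun x => theModel.eq x _) h1.symm)
      exact eq_trans (add_congr_left (hr.trans hk) _) (add_congr_right _ hl)
    · rw [Term.max, Term.ev_add, add_comm']
      exact mjr_add_right _ _
  | arr σ τ _ ih =>
    have key : ∀ q ≤ p, ∀ u v : D σ, q ≤ mjr u v → _ := fun q hq u v huv =>
      ih (Γ := σ :: Γ) (p := q) (s := .app (s.wk σ) (.var .zero))
        (s' := .app (s'.wk σ) (.var .zero))
        (t := .app (t.wk σ) (.var .zero)) (t' := .app (t'.wk σ) (.var .zero))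
        (ρ := u ∷ ρ) (ρ' := v ∷ ρ')
        (by
          simp only [Term.ev_app, Term.ev_wk]
          exact mjr_app (hq.trans hs) huv)
        (by
          simp only [Term.ev_app, Term.ev_wk]
          exact mjr_app (hq.trans ht) huv)
    -- The same induction hypothesis with the majorants on both sides; it supplies the second
    -- conjunct of majorization in all three claims.
    have key' : ∀ q ≤ p, ∀ u v : D σ, q ≤ mjr u v → _ := fun q hq u v huv =>
      ih (Γ := σ :: Γ) (p := q) (s := .app (s'.wk σ) (.var .zero))
        (s' := .app (s'.wk σ) (.var .zero))
        (t := .app (t'.wk σ) (.var .zero)) (t' := .app (t'.wk σ) (.var .zero))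
        (ρ := u ∷ ρ') (ρ' := v ∷ ρ')
        (by
          simp only [Term.ev_app, Term.ev_wk]
          exact mjr_app (hq.trans (mjr_right hs)) huv)
        (by
          simp only [Term.ev_app, Term.ev_wk]
          exact mjr_app (hq.trans (mjr_right ht)) huv)
    simp only [Term.ev_app, Term.ev_wk] at key key'
    refine ⟨mjr_arr_iff.2 fun q hq u v huv => ?_, mjr_arr_iff.2 fun q hq u v huv => ?_,
      mjr_arr_iff.2 fun q hq u v huv => ?_⟩
    all_goals
      simp only [Term.ev_max_arr]
    · exact ⟨(key q hq u v huv).1, (key' q hq u v huv).1⟩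
    · exact ⟨(key q hq u v huv).2.1, (key' q hq u v huv).1⟩
    · exact ⟨(key q hq u v huv).2.2, (key' q hq u v huv).1⟩

def Terms.max {Γ : Ctx} {σs : List Ty} (s t : Terms Γ σs) : Terms Γ σs :=
  Terms.tabulate fun τ i => Term.max τ (s.get i) (t.get i)

theorem Terms.max_spec {Γ : Ctx} {σs : List Ty} {p : H} {s t : Terms Γ σs} {ρ ρ' : V Γ}
    (hs : p ≤ mjrT (s.ev ρ) (s.ev ρ')) (ht : p ≤ mjrT (t.ev ρ) (t.ev ρ')) :
    p ≤ mjrT ((s.max t).ev ρ) ((s.max t).ev ρ') ∧ p ≤ mjrT (s.ev ρ) ((s.max t).ev ρ') ∧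
      p ≤ mjrT (t.ev ρ) ((s.max t).ev ρ') := by
  have key : ∀ τ (i : Var σs τ), _ := fun τ i =>
    Term.max_spec (s := s.get i) (s' := s.get i) (t := t.get i) (t' := t.get i) (ρ := ρ) (ρ' := ρ')
      (p := p) (by simpa only [Terms.ev_get] using mjrT_iff.1 hs τ i)
      (by simpa only [Terms.ev_get] using mjrT_iff.1 ht τ i)
  simp only [mjrT_iff, Terms.max, Terms.ev_tabulate, Tup.get_tabulate]
  simp only [Terms.ev_get] at key
  exact ⟨fun τ i => (key τ i).1, fun τ i => (key τ i).2.1, fun τ i => (key τ i).2.2⟩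

namespace Mor

variable {σs τs υs : List Ty}

def max (φ ψ : Mor σs τs) : Mor σs τs :=
  ⟨φ.tms.max ψ.tms, fun p ρ ρ' h => (Terms.max_spec (φ.mon p ρ ρ' h) (ψ.mon p ρ ρ' h)).1⟩

theorem le_max_left (φ ψ : Mor σs τs) {p : H} {a b : V σs} (h : p ≤ mjrT a b) :
    p ≤ mjrT (φ a) (φ.max ψ b) := (Terms.max_spec (φ.mon p a b h) (ψ.mon p a b h)).2.1

theorem le_max_right (φ ψ : Mor σs τs) {p : H} {a b : V σs} (h : p ≤ mjrT a b) :
    p ≤ mjrT (ψ a) (φ.max ψ b) := (Terms.max_spec (φ.mon p a b h) (ψ.mon p a b h)).2.2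

end Mor

/-! ### Recursion -/

/-- The types of the step functions of a simultaneous recursion. -/
abbrev stepTypes (ρs : List Ty) : List Ty := ρs.map (arrs (ρs ++ [.nat]))

def Terms.recs {Γ : Ctx} {ρs : List Ty} (n : Term Γ .nat) (y : Terms Γ ρs)
    (z : Terms Γ (stepTypes ρs)) : Terms Γ ρs :=
  Terms.tabulate fun _ i => ((Term.app (.recr i) n).apps y).apps z

theorem Terms.ev_recs {Γ : Ctx} {ρs : List Ty} (n : Term Γ .nat) (y : Terms Γ ρs)
    (z : Terms Γ (stepTypes ρs)) (ρ : V Γ) :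
    (Terms.recs n y z).ev ρ = recT (n.ev ρ) (y.ev ρ) (z.ev ρ) := by
  simp only [Terms.recs, Terms.ev_tabulate, Term.ev_apps, Term.ev_app]; rfl

/-- Componentwise majorizability as a formula. -/
def Formula.majs {Γ : Ctx} : {σs : List Ty} → Terms Γ σs → Terms Γ σs → Formula Γ
  | _, .nil, .nil => verum Γ
  | _, .cons s ss, .cons t ts => .and (maj s t) (Formula.majs ss ts)

theorem Formula.internal_maj {Γ : Ctx} {σ : Ty} (s t : Term Γ σ) : (maj s t).Internal := by
  induction σ generalizing Γ with
  | nat => trivial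
  | arr σ τ ih1 ih2 => exact ⟨ih1 _ _, ih2 _ _, ih2 _ _⟩

theorem Formula.internal_majs {Γ : Ctx} {σs : List Ty} (s t : Terms Γ σs) :
    (majs s t).Internal := by
  induction s with
  | nil => cases t; trivial
  | cons s ss ih => cases t with
    | cons t ts => exact ⟨internal_maj s t, ih ts⟩

theorem Formula.val_majs {Γ : Ctx} {σs : List Ty} (s t : Terms Γ σs) (ρ : V Γ) :
    (majs s t).val ρ = mjrT (s.ev ρ) (t.ev ρ) := by
  induction s with
  | nil => cases t; exact eq_refl _
  | cons s ss ih => cases t with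
    | cons t ts => exact congrArg₂ _ (val_maj s t ρ) (ih ts)

/-- Monotonicity in base and step values for a fixed number, by induction on that number.
Majorization is an internal formula, so the internal induction axiom applies. -/
theorem recT_mjr {ρs : List Ty} {p : H} {y y' : V ρs} {z z' : V (stepTypes ρs)}
    (hy : p ≤ mjrT y y') (hz : p ≤ mjrT z z') (n : D .nat) :
    p ≤ mjrT (recT n y z) (recT n y' z') := by
  let Γ : Ctx := (ρs ++ stepTypes ρs) ++ (ρs ++ stepTypes ρs)
  let A : Formula (.nat :: Γ) := majs
    (Terms.recs (.var .zero) ((Terms.vars Γ).left.left.wk .nat) ((Terms.vars Γ).left.right.wk .nat))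
    (Terms.recs (.var .zero) ((Terms.vars Γ).right.left.wk .nat)
      ((Terms.vars Γ).right.right.wk .nat))
  have hA : ∀ n, A.val (n ∷ (y.append z).append (y'.append z')) =
      mjrT (recT n y z) (recT n y' z') := fun n => by
    simp only [A, val_majs, Terms.ev_recs, Terms.ev_wk, Terms.ev_left, Terms.ev_right,
      Terms.ev_vars, Γ, Tup.left_append, Tup.right_append]
    rfl
  rw [← hA]
  refine internal_induction (internal_majs _ _) ?_ (fun n q hq h => ?_) n
  · change p ≤ A.val _
    rw [hA, recT_zero, recT_zero]
    exact hy
  · change q ≤ A.val _ at h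
    change q ≤ A.val _
    rw [hA] at h
    rw [hA, recT_succ, recT_succ]
    exact mjrT_appT (hq.trans hz) (mjrT_append_iff.2 ⟨h, le_inf (mjr_nat_refl n) le_top⟩)

theorem recT_congr {ρs : List Ty} {p : H} {n n' : D .nat} (h : p ≤ theModel.eq n n') (y : V ρs)
    (z : V (stepTypes ρs)) {τ : Ty} (i : Var ρs τ) :
    p ≤ eqD ((recT n y z).get i) ((recT n' y z).get i) := by
  rw [recT, recT, Tup.get_tabulate, Tup.get_tabulate]
  exact eqD_appD (eqD_appD (h.trans (eqD_app (σ := .nat) (theModel.R i) n n')) y) z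

/-- If each step majorizes the value it started from, the values form an increasing sequence. The
induction is on the difference `k` between the two numbers. -/
theorem recT_mjr_of_le {ρs : List Ty} {p : H} {n n' : D .nat} {y : V ρs} {z : V (stepTypes ρs)}
    (hy : p ≤ mjrT y y) (hz : p ≤ mjrT z z)
    (hstep : ∀ q ≤ p, ∀ u : V ρs, ∀ m : D .nat, q ≤ mjrT u u →
      q ≤ mjrT u (appT z (u.append (m ∷ Tup.nil)))) (hn : p ≤ mjr n n') :
    p ≤ mjrT (recT n y z) (recT n' y z) := by
  let Γ : Ctx := .nat :: (ρs ++ stepTypes ρs)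
  let Y : Terms (.nat :: Γ) ρs := ((Terms.vars (ρs ++ stepTypes ρs)).left.wk .nat).wk .nat
  let Z : Terms (.nat :: Γ) (stepTypes ρs) :=
    ((Terms.vars (ρs ++ stepTypes ρs)).right.wk .nat).wk .nat
  let A : Formula (.nat :: Γ) := majs (Terms.recs (.var (.succ .zero)) Y Z)
    (Terms.recs ((Term.var (.succ .zero)).add (.var .zero)) Y Z)
  have hA : ∀ k, A.val (k ∷ n ∷ y.append z) = mjrT (recT n y z) (recT (add n k) y z) := fun k => by
    simp only [A, Y, Z, Γ, val_majs, Terms.ev_recs, Terms.ev_wk, Terms.ev_left, Terms.ev_right,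
      Terms.ev_vars, Tup.left_append, Tup.right_append]
    rfl
  have key : ∀ k, p ≤ mjrT (recT n y z) (recT (add n k) y z) := by
    intro k
    rw [← hA]
    refine internal_induction (internal_majs _ _) ?_ (fun k q hq h => ?_) k
    · change p ≤ A.val _
      rw [hA, add_zero']
      exact recT_mjr hy hz n
    · change q ≤ A.val _ at h
      change q ≤ A.val _
      rw [hA] at h
      rw [hA, add_succ', recT_succ]
      exact mjrT_trans h (hstep q hq _ _ (mjrT_right h))
  -- The equation between `n + k` and `n'` is only forced at `q`, so it is transported by congruence
  -- and not by rewriting.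
  refine le_of_le_iSup hn fun k q hq hk => mjrT_iff.2 fun τ i => ?_
  exact mjr_congr (eqD_refl _) (recT_congr hk y z i) (mjrT_iff.1 (hq.trans (key k)) τ i)

/-- Replaces the step functions `z u n` of a recursion by the maximum of `u` and `z u n`. -/
def stepMax (ρs : List Ty) : Mor (stepTypes ρs) (stepTypes ρs) :=
  Mor.curry (σs := stepTypes ρs) (τs := ρs ++ [.nat]) (υs := ρs)
    (((Mor.id _).snd.fst).max (Mor.app (τs := ρs ++ [.nat]) (Mor.id _).fst (Mor.id _).snd))

theorem le_stepMax {ρs : List Ty} {p : H} {z z' : V (stepTypes ρs)} {u v : V (ρs ++ [.nat])}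
    (hz : p ≤ mjrT z z') (hu : p ≤ mjrT u v) :
    p ≤ mjrT u.left (appT (stepMax ρs z') v) ∧ p ≤ mjrT (appT z u) (appT (stepMax ρs z') v) := by
  rw [stepMax, Mor.curry_apply]
  have h : p ≤ mjrT (z.append u) (z'.append v) := mjrT_append_iff.2 ⟨hz, hu⟩
  have h1 := Mor.le_max_left ((Mor.id (stepTypes ρs ++ (ρs ++ [.nat]))).snd.fst)
    (Mor.app (τs := ρs ++ [.nat]) (Mor.id _).fst (Mor.id _).snd) h
  have h2 := Mor.le_max_right ((Mor.id (stepTypes ρs ++ (ρs ++ [.nat]))).snd.fst)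
    (Mor.app (τs := ρs ++ [.nat]) (Mor.id _).fst (Mor.id _).snd) h
  simp only [Mor.fst_apply, Mor.snd_apply, Mor.id_apply, Mor.app_apply, Tup.left_append,
    Tup.right_append] at h1 h2
  exact ⟨h1, h2⟩

theorem mjrT_stepMax {ρs : List Ty} {p : H} {z z' : V (stepTypes ρs)} (hz : p ≤ mjrT z z') :
    p ≤ mjrT z (stepMax ρs z') :=
  mjrT_of_appT fun _ hq _ _ huv =>
    ⟨(le_stepMax (hq.trans hz) huv).2,
      mjrT_appT (hq.trans ((stepMax ρs).mono (mjrT_right hz))) huv⟩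

/-- Recursion with the step functions `stepMax z`. -/
def Mor.recs (ρs : List Ty) : Mor (.nat :: (ρs ++ stepTypes ρs)) ρs where
  tms := Terms.recs (.var .zero) ((Mor.id (ρs ++ stepTypes ρs)).fst.tms.wk .nat)
    (((stepMax ρs).comp (Mor.id (ρs ++ stepTypes ρs)).snd).tms.wk .nat)
  mon := by
    intro p a b h
    obtain ⟨n, y, z, rfl⟩ : ∃ n y z, a = n ∷ Tup.append (σs := ρs) y z :=
      ⟨a.hd, a.tl.left, a.tl.right, Tup.cons_congr rfl (Tup.append_left_right _).symm⟩
    obtain ⟨n', y', z', rfl⟩ : ∃ n y z, b = n ∷ Tup.append (σs := ρs) y z :=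
      ⟨b.hd, b.tl.left, b.tl.right, Tup.cons_congr rfl (Tup.append_left_right _).symm⟩
    rw [mjrT_cons, mjrT_append, le_inf_iff, le_inf_iff] at h
    obtain ⟨hn, hy, hz⟩ := h
    rw [Terms.ev_recs, Terms.ev_recs, Terms.ev_wk, Terms.ev_wk, Terms.ev_wk, Terms.ev_wk,
      Mor.fst_apply, Mor.fst_apply, Mor.comp_apply, Mor.comp_apply, Mor.snd_apply, Mor.snd_apply,
      Mor.id_apply, Mor.id_apply, Tup.left_append, Tup.left_append, Tup.right_append,
      Tup.right_append]
    -- The base and step values are enlarged at the same number `n`; the number is enlarged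
    -- afterwards, with the inflationary steps `stepMax ρs z'`.
    refine mjrT_trans (recT_mjr hy ((stepMax ρs).mono hz) n) ?_
    refine recT_mjr_of_le (mjrT_right hy) ((stepMax ρs).mono (mjrT_right hz)) ?_ hn
    intro q hq u m hu
    have hm : q ≤ mjrT (σs := [.nat]) (m ∷ Tup.nil) (m ∷ Tup.nil) :=
      le_inf (mjr_nat_refl m) le_top
    have := (le_stepMax (hq.trans (mjrT_right hz)) (mjrT_append_iff.2 ⟨hu, hm⟩)).1
    rwa [Tup.left_append] at this

theorem Mor.recs_apply {ρs : List Ty} (n : D .nat) (y : V ρs) (z : V (stepTypes ρs)) :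
    Mor.recs ρs (n ∷ y.append z) = recT n y (stepMax ρs z) := by
  refine (Terms.ev_recs _ _ _ _).trans ?_
  rw [Terms.ev_wk, Terms.ev_wk, Mor.fst_apply, Mor.comp_apply, Mor.snd_apply, Mor.id_apply,
    Tup.left_append, Tup.right_append]
  rfl

/-! ### Majorants of terms -/

/-- Once `g` is known to be monotone, the second conjunct of majorization comes for free. -/
theorem mjr_of_appD_of_mon {p : H} {σs : List Ty} {τ : Ty} {f g : D (arrs σs τ)}
    (hg : p ≤ mjr g g) (h : ∀ q ≤ p, ∀ u v : V σs, q ≤ mjrT u v → q ≤ mjr (appD f u) (appD g v)) :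
    p ≤ mjr f g :=
  mjr_of_appD fun q hq u v huv => ⟨h q hq u v huv, mjr_appD (hq.trans hg) huv⟩

/-- A majorant of the recursor. -/
def recrMajorant (Γ : Ctx) {ρs : List Ty} {τ : Ty} (i : Var ρs τ) :
    Term Γ (.arr .nat (arrs ρs (arrs (stepTypes ρs) τ))) :=
  (((((Mor.recs ρs).tms.get i).subst (Terms.toSub
    (Δ := Ctx.ext (stepTypes ρs) (Ctx.ext ρs (.nat :: Γ)))
    (.cons (((Term.var .zero).ren (Ren.wkN ρs)).ren (Ren.wkN (stepTypes ρs)))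
      (((Terms.fresh ρs).wkN (stepTypes ρs)).append (Terms.fresh (stepTypes ρs)))))).lamN
    (stepTypes ρs)).lamN ρs).lam

theorem ev_recrMajorant {Γ : Ctx} {ρs : List Ty} {τ : Ty} (i : Var ρs τ) (ρ : V Γ) (n : D .nat)
    (y : V ρs) (z : V (stepTypes ρs)) :
    appD (appD ((recrMajorant Γ i).ev ρ n) y) z = (Mor.recs ρs (n ∷ y.append z)).get i := by
  rw [recrMajorant, Term.ev_lam, Term.ev_lamN, Term.ev_lamN, Term.ev_subst, Terms.ev_toSub,
    Terms.ev_get]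
  congr 2
  refine Tup.cons_congr ?_ ?_
  · rw [Term.ev_ren, Ren.ev_wkN, Term.ev_ren, Ren.ev_wkN]; rfl
  · rw [Terms.ev_append, Terms.ev_wkN, Terms.ev_fresh, Terms.ev_fresh]

theorem monT_recrMajorant {Γ : Ctx} {ρs : List Ty} {τ : Ty} (i : Var ρs τ) :
    MonT (recrMajorant Γ i) := by
  refine MonT.lam (MonT.lamN (MonT.lamN (MonT.subst ((Mor.recs ρs).mon.get i) ?_)))
  exact MonTs.cons (MonT.var _) (((MonTs.fresh ρs).ren _).append (MonTs.fresh _))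

/-- The recursor is majorized not by itself but by recursion with inflationary steps. At equal
numbers the latter dominates because its steps do, and it is monotone in the number. -/
theorem recr_mjr {Γ : Ctx} {ρs : List Ty} {τ : Ty} (i : Var ρs τ) (p : H) (ρ ρ' : V Γ)
    (h : p ≤ mjrT ρ ρ') : p ≤ mjr (theModel.R i) ((recrMajorant Γ i).ev ρ') := by
  have hm := monT_recrMajorant i p ρ' ρ' (mjrT_right h)
  refine mjr_of_appD_of_mon (σs := [.nat]) hm fun q hq n n' hn => ?_
  have hm1 := mjr_appD (σs := [.nat]) (hq.trans hm) (mjrT_right hn)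
  refine mjr_of_appD_of_mon (σs := ρs) hm1 fun r hr y y' hy => ?_
  have hm2 := mjr_appD (σs := ρs) (hr.trans hm1) (mjrT_right hy)
  refine mjr_of_appD_of_mon (σs := stepTypes ρs) hm2 fun s hs z z' hz => ?_
  change s ≤ mjr _ (appD (appD (theModel.app ((recrMajorant Γ i).ev ρ') n'.hd) y') z')
  rw [ev_recrMajorant, Mor.recs_apply]
  have hn' := (hs.trans hr).trans hn
  have hy' := hs.trans hy
  have h1 : s ≤ mjrT (recT n.hd y z) (recT n.hd y' (stepMax ρs z')) :=
    recT_mjr hy' (mjrT_stepMax hz) n.hd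
  have h2 := (Mor.recs ρs).mono (a := n.hd ∷ y'.append z') (b := n'.hd ∷ y'.append z') (p := s)
    (le_inf (le_inf_iff.1 hn').1 (mjrT_append_iff.2 ⟨mjrT_right hy', mjrT_right hz⟩))
  rw [Mor.recs_apply, Mor.recs_apply] at h2
  have h3 := mjrT_iff.1 (mjrT_trans h1 h2) _ i
  rw [recT, Tup.get_tabulate] at h3
  exact h3

/-- Every term has a majorant. -/
theorem Term.exists_majorant {Γ : Ctx} {τ : Ty} (t : Term Γ τ) :
    ∃ t' : Term Γ τ, ∀ (p : H) (ρ ρ' : V Γ), p ≤ mjrT ρ ρ' → p ≤ mjr (t.ev ρ) (t'.ev ρ') := by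
  induction t with
  | var x => exact ⟨.var x, MonT.var x⟩
  | zero => exact ⟨.zero, fun _ _ _ _ => mjr_nat_refl _⟩
  | succ =>
    refine ⟨.succ, fun p ρ ρ' _ => mjr_arr_iff.2 fun q hq u v huv => ?_⟩
    have : q ≤ mjr (σ := .nat) (theModel.succ u) (theModel.succ v) := by
      refine le_of_le_iSup huv fun k r hr hk => le_trans ?_ (le_iSup _ k)
      rw [succ_add']
      exact le_eq_succ hk
    exact ⟨this, this⟩
  | combK σ τ =>
    refine ⟨.combK σ τ, fun p ρ ρ' _ => mjr_of_appD (σs := [σ, τ]) fun q hq u v huv => ?_⟩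
    have h1 : ∀ u : V [σ, τ], appD (σs := [σ, τ]) (τ := σ) (theModel.K σ τ) u = u.hd :=
      fun u => K_app _ _
    have : q ≤ mjr (appD (σs := [σ, τ]) (τ := σ) (theModel.K σ τ) u)
        (appD (σs := [σ, τ]) (τ := σ) (theModel.K σ τ) v) := by
      rw [h1, h1]; exact (le_inf_iff.1 huv).1
    exact ⟨this, this⟩
  | combS δ σ τ =>
    refine ⟨.combS δ σ τ, fun p ρ ρ' _ =>
      mjr_of_appD (σs := [.arr δ (.arr σ τ), .arr δ σ, δ]) fun q hq u v huv => ?_⟩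
    have h1 : ∀ u : V [.arr δ (.arr σ τ), .arr δ σ, δ],
        appD (σs := [.arr δ (.arr σ τ), .arr δ σ, δ]) (τ := τ) (theModel.S δ σ τ) u =
          (u.hd u.tl.tl.hd) (u.tl.hd u.tl.tl.hd) := fun u => S_app _ _ _
    have : q ≤ mjr (appD (σs := [.arr δ (.arr σ τ), .arr δ σ, δ]) (τ := τ) (theModel.S δ σ τ) u)
        (appD (σs := [.arr δ (.arr σ τ), .arr δ σ, δ]) (τ := τ) (theModel.S δ σ τ) v) := by
      rw [h1, h1]
      have h2 := le_inf_iff.1 huv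
      have h3 := le_inf_iff.1 h2.2
      have h4 := le_inf_iff.1 h3.2
      exact mjr_app (mjr_app h2.1 h4.1) (mjr_app h3.1 h4.1)
    exact ⟨this, this⟩
  | recr i => exact ⟨recrMajorant _ i, recr_mjr i⟩
  | app s t hs ht =>
    obtain ⟨s', hs⟩ := hs
    obtain ⟨t', ht⟩ := ht
    exact ⟨.app s' t', fun p ρ ρ' h => mjr_app (hs p ρ ρ' h) (ht p ρ ρ' h)⟩


/-! ### Bounded quantification -/

/-- Quantification over the monotone tuples below `c`. -/
def ball {σs : List Ty} (c : V σs) (φ : V σs → H) : H :=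
  ⨅ a : V σs, mjrT a a ⊓ mjrT a c ⇨ φ a

theorem le_ball_iff {p : H} {σs : List Ty} {c : V σs} {φ : V σs → H} :
    p ≤ ball c φ ↔ ∀ q ≤ p, ∀ a, q ≤ mjrT a a → q ≤ mjrT a c → q ≤ φ a := by
  simp only [ball, le_iInf_iff, le_himp_iff_forall, le_inf_iff]
  exact ⟨fun h q hq a h1 h2 => h a q hq ⟨h1, h2⟩, fun h a q hq h12 => h q hq a h12.1 h12.2⟩

/-- A monotone bound is one of the admissible instances. This is how a bounded hypothesis about
challenges is put to use at the bound. -/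
theorem ball_self {p : H} {σs : List Ty} {c : V σs} {φ : V σs → H} (h : p ≤ ball c φ)
    (hc : p ≤ mjrT c c) : p ≤ φ c := le_ball_iff.1 h p le_rfl c hc hc

theorem ball_mono {p : H} {σs : List Ty} {c c' : V σs} {φ : V σs → H} (h : p ≤ ball c φ)
    (hc : p ≤ mjrT c' c) : p ≤ ball c' φ :=
  le_ball_iff.2 fun q hq a h1 h2 =>
    le_ball_iff.1 h q hq a h1 (mjrT_trans h2 (hq.trans hc))

/-- Standard monotone tuples. -/
def sm {σs : List Ty} (a : V σs) : H := stT a ⊓ mjrT a a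

theorem sm_mon {p : H} {σs : List Ty} {a : V σs} (h : p ≤ sm a) : p ≤ mjrT a a :=
  h.trans inf_le_right

theorem sm_st {p : H} {σs : List Ty} {a : V σs} (h : p ≤ sm a) : p ≤ stT a :=
  h.trans inf_le_left

theorem sm_nil {p : H} {a : V []} : p ≤ sm a := le_inf le_top le_top

theorem sm_append {p : H} {σs τs : List Ty} {a : V σs} {b : V τs} (ha : p ≤ sm a)
    (hb : p ≤ sm b) : p ≤ sm (a.append b) :=
  le_inf ((stT_append a b).symm ▸ le_inf (sm_st ha) (sm_st hb))
    (mjrT_append_iff.2 ⟨sm_mon ha, sm_mon hb⟩)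

theorem sm_append_iff {p : H} {σs τs : List Ty} {a : V σs} {b : V τs} :
    p ≤ sm (a.append b) ↔ p ≤ sm a ∧ p ≤ sm b := by
  simp only [sm, stT_append, mjrT_append, le_inf_iff]
  tauto

theorem sm_left {p : H} {σs τs : List Ty} {a : V (σs ++ τs)} (h : p ≤ sm a) :
    p ≤ sm (Tup.left a) := by
  rw [← Tup.append_left_right a] at h
  exact (sm_append_iff.1 h).1

theorem sm_right {p : H} {σs τs : List Ty} {a : V (σs ++ τs)} (h : p ≤ sm a) :
    p ≤ sm (Tup.right (σs := σs) a) := by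
  rw [← Tup.append_left_right a] at h
  exact (sm_append_iff.1 h).2

theorem Mor.sm {σs τs : List Ty} (φ : Mor σs τs) {p : H} {a : V σs} (h : p ≤ sm a) :
    p ≤ sm (φ a) := le_inf (φ.std (sm_st h)) (φ.mono (sm_mon h))

/-- Anything majorized by a standard element is standard. Hence the bounded quantifiers in the
matrices, which do not mention standardness, range over standard tuples whenever the bound is
standard. -/
theorem sm_of_mjrT {p : H} {σs : List Ty} {a b : V σs} (hb : p ≤ sm b) (ha : p ≤ mjrT a a)
    (h : p ≤ mjrT a b) : p ≤ sm a := le_inf (stT_of_mjrT (sm_st hb) h) ha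

/-! ### The interpretation in the model -/

/-- The truth value of the matrix of the interpretation. -/
def sem : {Γ : Ctx} → (A : Formula Γ) → V Γ → V (exTypes A) → V (allTypes A) → H
  | _, .eq s t, ρ, _, _ => theModel.eq (s.ev ρ) (t.ev ρ)
  | _, .st t, ρ, b, _ => mjr (t.ev ρ) (Tup.hd b)
  | _, .and A B, ρ, b, c =>
    sem A ρ (Tup.left (σs := exTypes A) b) (Tup.left (σs := allTypes A) c) ⊓
      sem B ρ (Tup.right (σs := exTypes A) b) (Tup.right (σs := allTypes A) c)
  | _, .or A B, ρ, b, c =>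
    ball (Tup.left (σs := allTypes A) c) (sem A ρ (Tup.left (σs := exTypes A) b)) ⊔
      ball (Tup.right (σs := allTypes A) c) (sem B ρ (Tup.right (σs := exTypes A) b))
  | _, .imp A B, ρ, b, c =>
    ball (appT (Tup.right (σs := (exTypes B).map (arrs (exTypes A))) b) c)
        (sem A ρ (Tup.left (σs := exTypes A) c)) ⇨
      sem B ρ (appT (Tup.left (σs := (exTypes B).map (arrs (exTypes A))) b)
        (Tup.left (σs := exTypes A) c)) (Tup.right (σs := exTypes A) c)
  | _, .all σ A, ρ, b, c => ⨅ d : D σ, sem A (d ∷ ρ) b c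
  | _, .ex σ A, ρ, b, c => ⨆ d : D σ, ball c (sem A (d ∷ ρ) b)

/-- Ties the syntactic matrix to its semantic counterpart, so that de Bruijn bookkeeping ends here.
-/
theorem val_matrix {Γ Δ : Ctx} (A : Formula Γ) (s : Sub Γ Δ) (b : Terms Δ (exTypes A))
    (c : Terms Δ (allTypes A)) (ρ : V Δ) :
    (matrix A s b c).val ρ = sem A (s.ev ρ) (b.ev ρ) (c.ev ρ) := by
  induction A generalizing Δ with
  | eq t u => exact congrArg₂ theModel.eq (Term.ev_subst s t ρ) (Term.ev_subst s u ρ)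
  | st t =>
    refine (Formula.val_maj _ _ _).trans (congrArg₂ mjr (Term.ev_subst s t ρ) ?_)
    cases b
    rfl
  | and A B hA hB =>
    refine congrArg₂ (· ⊓ ·) ((hA _ _ _ _).trans ?_) ((hB _ _ _ _).trans ?_)
    · rw [Terms.ev_left, Terms.ev_left]
    · rw [Terms.ev_right, Terms.ev_right]
  | or A B hA hB =>
    refine congrArg₂ (· ⊔ ·) ((Formula.val_allMonMaj _ _ _).trans ?_)
      ((Formula.val_allMonMaj _ _ _).trans ?_)
    · rw [Terms.ev_left]
      refine iInf_congr fun a => congrArg₂ _ rfl ((hA _ _ _ _).trans ?_)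
      rw [Sub.ev_wkN, Terms.ev_wkN, Terms.ev_fresh, Terms.ev_left]
    · rw [Terms.ev_right]
      refine iInf_congr fun a => congrArg₂ _ rfl ((hB _ _ _ _).trans ?_)
      rw [Sub.ev_wkN, Terms.ev_wkN, Terms.ev_fresh, Terms.ev_right]
  | imp A B hA hB =>
    refine congrArg₂ (· ⇨ ·) ((Formula.val_allMonMaj _ _ _).trans ?_) ((hB _ _ _ _).trans ?_)
    · rw [Terms.ev_apps, Terms.ev_right]
      refine iInf_congr fun a => congrArg₂ _ rfl ((hA _ _ _ _).trans ?_)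
      rw [Sub.ev_wkN, Terms.ev_wkN, Terms.ev_fresh, Terms.ev_left]
    · rw [Terms.ev_apps, Terms.ev_right, Terms.ev_left, Terms.ev_left]
  | all σ A hA =>
    refine iInf_congr fun d => (hA _ _ _ _).trans ?_
    rw [Sub.ev_lift', Terms.ev_wk, Terms.ev_wk]
  | ex σ A hA =>
    refine iSup_congr fun d => (Formula.val_allMonMaj _ _ _).trans ?_
    rw [Terms.ev_wk]
    refine iInf_congr fun a => congrArg₂ _ rfl ((hA _ _ _ _).trans ?_)
    rw [Sub.ev_wkN, Terms.ev_wkN, Terms.ev_fresh, Sub.ev_lift', Terms.ev_wk]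

/-! ### Problems -/

/-- Monotone `∃∀`-problems with parameters: the objects into which formulas are translated. -/
structure Prob (Γ : Ctx) where
  X : List Ty
  Y : List Ty
  rel : V Γ → V X → V Y → H
  mono : ∀ {p : H} {ρ : V Γ} {b b' : V X} {c : V Y}, p ≤ mjrT b b' → p ≤ mjrT c c →
    p ≤ rel ρ b c → p ≤ rel ρ b' c

namespace Prob

variable {Γ Δ : Ctx}

theorem mono_ball (P : Prob Γ) {p : H} {ρ : V Γ} {b b' : V P.X} {c : V P.Y}
    (hb : p ≤ mjrT b b') (h : p ≤ ball c (P.rel ρ b)) : p ≤ ball c (P.rel ρ b') :=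
  le_ball_iff.2 fun q hq a h1 h2 => P.mono (hq.trans hb) h1 (le_ball_iff.1 h q hq a h1 h2)

@[reducible] def and (P Q : Prob Γ) : Prob Γ where
  X := P.X ++ Q.X
  Y := P.Y ++ Q.Y
  rel ρ b c := P.rel ρ (Tup.left (σs := P.X) b) (Tup.left (σs := P.Y) c) ⊓
    Q.rel ρ (Tup.right (σs := P.X) b) (Tup.right (σs := P.Y) c)
  mono hb hc h := le_inf (P.mono (mjrT_left hb) (mjrT_left hc) (h.trans inf_le_left))
    (Q.mono (mjrT_right' hb) (mjrT_right' hc) (h.trans inf_le_right))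

@[reducible] def or (P Q : Prob Γ) : Prob Γ where
  X := P.X ++ Q.X
  Y := P.Y ++ Q.Y
  rel ρ b c := ball (Tup.left (σs := P.Y) c) (P.rel ρ (Tup.left (σs := P.X) b)) ⊔
    ball (Tup.right (σs := P.Y) c) (Q.rel ρ (Tup.right (σs := P.X) b))
  mono hb _ h := le_of_le_sup h
    (fun _ hq h => (P.mono_ball (mjrT_left (hq.trans hb)) h).trans le_sup_left)
    (fun _ hq h => (Q.mono_ball (mjrT_right' (hq.trans hb)) h).trans le_sup_right)

@[reducible] def imp (P Q : Prob Γ) : Prob Γ where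
  X := Q.X.map (arrs P.X) ++ P.Y.map (arrs (P.X ++ Q.Y))
  Y := P.X ++ Q.Y
  rel ρ b c := ball (appT (Tup.right (σs := Q.X.map (arrs P.X)) b) c)
      (P.rel ρ (Tup.left (σs := P.X) c)) ⇨
    Q.rel ρ (appT (Tup.left (σs := Q.X.map (arrs P.X)) b) (Tup.left (σs := P.X) c))
      (Tup.right (σs := P.X) c)
  -- A larger challenge bound only strengthens the premise, and a larger realizer of the conclusion
  -- is handled by monotonicity of `Q`.
  mono hb hc h := le_himp_iff_forall.2 fun _ hq h' =>
    Q.mono (hq.trans (mjrT_appT (mjrT_left hb) (mjrT_left hc))) (hq.trans (mjrT_right' hc))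
      (le_himp_iff_forall.1 h _ hq (ball_mono h' (hq.trans (mjrT_appT (mjrT_right' hb) hc))))

@[reducible] def all (σ : Ty) (P : Prob (σ :: Γ)) : Prob Γ where
  X := P.X
  Y := P.Y
  rel ρ b c := ⨅ d : D σ, P.rel (d ∷ ρ) b c
  mono hb hc h := le_iInf fun d => P.mono hb hc (h.trans (iInf_le _ d))

@[reducible] def ex (σ : Ty) (P : Prob (σ :: Γ)) : Prob Γ where
  X := P.X
  Y := P.Y
  rel ρ b c := ⨆ d : D σ, ball c (P.rel (d ∷ ρ) b)
  mono hb _ h := le_of_le_iSup h fun d _ hq h =>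
    (P.mono_ball (hq.trans hb) h).trans (le_iSup (fun d => ball _ (P.rel (d ∷ _) _)) d)

/-- Reparametrization. -/
@[reducible] def pull (P : Prob Γ) (r : V Δ → V Γ) : Prob Δ where
  X := P.X
  Y := P.Y
  rel ρ := P.rel (r ρ)
  mono := P.mono

/-- The problem of a truth value. -/
@[reducible] def pure (h : V Γ → H) : Prob Γ where
  X := []
  Y := []
  rel ρ _ _ := h ρ
  mono _ _ h := h

/-- The standardness problem. -/
@[reducible] def stP {σ : Ty} (t : V Γ → D σ) : Prob Γ where
  X := [σ]
  Y := []
  rel ρ b _ := mjr (t ρ) (Tup.hd b)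
  mono hb _ h := mjr_trans h (le_inf_iff.1 hb).1

/-! ### Realizers and reductions -/

/-- A problem is realized if there is a tuple of closed monotone terms solving it. -/
def Realized (P : Prob Γ) : Prop :=
  ∃ t : Mor [] P.X, ∀ (p : H) (ρ : V Γ) (c : V P.Y), p ≤ sm c → p ≤ P.rel ρ (t Tup.nil) c

/-- Reducibility of problems. -/
def Le (P Q : Prob Γ) : Prop :=
  ∃ (f : Mor P.X Q.X) (g : Mor (P.X ++ Q.Y) P.Y), ∀ (p : H) (ρ : V Γ) (b : V P.X) (e : V Q.Y),
    p ≤ sm b → p ≤ sm e → p ≤ ball (g (b.append e)) (P.rel ρ b) → p ≤ Q.rel ρ (f b) e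

/-- Currying: closed functionals applied to arguments on one side, monotone terms with free
variables for those arguments on the other. -/
theorem realized_imp_iff {P Q : Prob Γ} : (P.imp Q).Realized ↔ Le P Q := by
  constructor
  · rintro ⟨t, ht⟩
    refine ⟨Mor.app (τs := P.X)
        (Mor.fst (τs := Q.X.map (arrs P.X)) (t.comp (Mor.zero _ []))) (Mor.id _),
      Mor.app (τs := P.X ++ Q.Y)
        (Mor.snd (τs := Q.X.map (arrs P.X)) (t.comp (Mor.zero _ []))) (Mor.id _),
      fun p ρ b e hb he h => ?_⟩
    have := le_himp_iff_forall.1 (ht p ρ (b.append e) (sm_append hb he)) p le_rfl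
    simp only [Tup.left_append, Tup.right_append] at this
    simp only [Mor.app_apply, Mor.fst_apply, Mor.snd_apply, Mor.comp_apply, Mor.id_apply] at h ⊢
    exact this h
  · rintro ⟨f, g, h⟩
    refine ⟨Mor.pair (Mor.curry (σs := []) (τs := P.X) f)
      (Mor.curry (σs := []) (τs := P.X ++ Q.Y) g), fun p ρ c hc => ?_⟩
    refine le_himp_iff_forall.2 fun q hq h' => ?_
    rw [← Tup.append_left_right c] at hc h' ⊢
    simp only [Mor.pair_apply, Tup.left_append, Tup.right_append, Mor.curry_apply] at h' ⊢
    have hc := sm_append_iff.1 (hq.trans hc)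
    exact h q ρ _ _ hc.1 hc.2 h'

theorem Realized.mp {P Q : Prob Γ} (hP : P.Realized) (h : Le P Q) : Q.Realized := by
  obtain ⟨t, ht⟩ := hP
  obtain ⟨f, g, h⟩ := h
  refine ⟨f.comp t, fun p ρ c hc => ?_⟩
  have hb : p ≤ sm (t Tup.nil) := t.sm sm_nil
  rw [Mor.comp_apply]
  refine h p ρ _ _ hb hc (le_ball_iff.2 fun q hq a ha1 ha2 => ht q ρ a ?_)
  -- The realizer of `P` is only guaranteed against standard challenges; those below the standard
  -- bound produced by `g` are standard.
  exact sm_of_mjrT (g.sm (sm_append (hq.trans hb) (hq.trans hc))) ha1 ha2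

/-! ### Reducibility as a preorder, and the propositional rules -/

theorem Le.refl (P : Prob Γ) : Le P P := by
  refine ⟨Mor.id _, (Mor.id _).snd, fun p ρ b e hb he h => ?_⟩
  simp only [Mor.snd_apply, Mor.id_apply, Tup.right_append] at h ⊢
  exact ball_self h (sm_mon he)

/-- The bound for challenges to `P` is computed from the bound for challenges to `Q`. Each actual
challenge to `Q` lies below that bound, and monotonicity of `g` carries the estimate over to `P`. -/
theorem Le.trans {P Q R : Prob Γ} (h1 : Le P Q) (h2 : Le Q R) : Le P R := by
  obtain ⟨f, g, h1⟩ := h1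
  obtain ⟨f', g', h2⟩ := h2
  refine ⟨f'.comp f, g.comp ((Mor.id _).fst.pair
    (g'.comp ((f.comp (Mor.id _).fst).pair (Mor.id _).snd))), fun p ρ b e hb he h => ?_⟩
  simp only [Mor.comp_apply, Mor.pair_apply, Mor.fst_apply, Mor.snd_apply, Mor.id_apply,
    Tup.left_append, Tup.right_append] at h ⊢
  have hfb := f.sm hb
  refine h2 p ρ _ _ hfb he (le_ball_iff.2 fun q hq d hd1 hd2 => ?_)
  have hd : q ≤ sm d := sm_of_mjrT (hq.trans (g'.sm (sm_append hfb he))) hd1 hd2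
  refine h1 q ρ _ _ (hq.trans hb) hd (ball_mono (hq.trans h) (g.mono ?_))
  exact mjrT_append_iff.2 ⟨hq.trans (sm_mon hb), hd2⟩

/-- To extract one conjunct, the unused half of the tuple is filled with its own bound; this is why
both bounds must be monotone. -/
theorem ball_and_iff {p : H} {σs τs : List Ty} {c : V σs} {d : V τs} {φ : V σs → H}
    {ψ : V τs → H} (hc : p ≤ mjrT c c) (hd : p ≤ mjrT d d) :
    p ≤ ball (c.append d) (fun x => φ (Tup.left x) ⊓ ψ (Tup.right (σs := σs) x)) ↔
      p ≤ ball c φ ∧ p ≤ ball d ψ := by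
  constructor
  · intro h
    refine ⟨le_ball_iff.2 fun q hq a h1 h2 => ?_, le_ball_iff.2 fun q hq a h1 h2 => ?_⟩
    · have := le_ball_iff.1 h q hq (a.append d) (mjrT_append_iff.2 ⟨h1, hq.trans hd⟩)
        (mjrT_append_iff.2 ⟨h2, hq.trans hd⟩)
      rw [Tup.left_append] at this
      exact this.trans inf_le_left
    · have := le_ball_iff.1 h q hq (c.append a) (mjrT_append_iff.2 ⟨hq.trans hc, h1⟩)
        (mjrT_append_iff.2 ⟨hq.trans hc, h2⟩)
      rw [Tup.right_append] at this
      exact this.trans inf_le_right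
  · rintro ⟨h1, h2⟩
    refine le_ball_iff.2 fun q hq a ha1 ha2 => ?_
    rw [← Tup.append_left_right a] at ha1 ha2
    have ha1 := mjrT_append_iff.1 ha1
    have ha2 := mjrT_append_iff.1 ha2
    exact le_inf (le_ball_iff.1 h1 q hq _ ha1.1 ha2.1) (le_ball_iff.1 h2 q hq _ ha1.2 ha2.2)

/-- The critical case of functional interpretations. Two challenges to `P` must be answered by one
bound, and their maximum serves, with no need to decide which challenge succeeds. -/
theorem and_contr (P : Prob Γ) : Le P (P.and P) := by
  refine ⟨(Mor.id _).pair (Mor.id _), Mor.max (Mor.id (P.X ++ (P.Y ++ P.Y))).snd.fst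
    (Mor.id (P.X ++ (P.Y ++ P.Y))).snd.snd, fun p ρ b e hb he h => ?_⟩
  have hbe := sm_mon (sm_append hb he)
  have h1 := Mor.le_max_left (Mor.id (P.X ++ (P.Y ++ P.Y))).snd.fst
    (Mor.id (P.X ++ (P.Y ++ P.Y))).snd.snd hbe
  have h2 := Mor.le_max_right (Mor.id (P.X ++ (P.Y ++ P.Y))).snd.fst
    (Mor.id (P.X ++ (P.Y ++ P.Y))).snd.snd hbe
  simp only [Mor.fst_apply, Mor.snd_apply, Mor.id_apply, Tup.right_append] at h1 h2
  show p ≤ P.rel _ _ _ ⊓ P.rel _ _ _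
  simp only [Mor.pair_apply, Mor.id_apply, Tup.left_append, Tup.right_append]
  exact le_inf (ball_self (ball_mono h h1) (sm_mon (sm_left he)))
    (ball_self (ball_mono h h2) (sm_mon (sm_right he)))

/-- The realizer does not record which disjunct holds; the maximum of both candidates works in
either case because `P` is monotone in its realizer. -/
theorem or_contr (P : Prob Γ) : Le (P.or P) P := by
  refine ⟨Mor.max (Mor.id (P.X ++ P.X)).fst (Mor.id _).snd,
    (Mor.id _).snd.pair (Mor.id _).snd, fun p ρ b e hb he h => ?_⟩
  have h1 := Mor.le_max_left (Mor.id (P.X ++ P.X)).fst (Mor.id (P.X ++ P.X)).snd (sm_mon hb)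
  have h2 := Mor.le_max_right (Mor.id (P.X ++ P.X)).fst (Mor.id (P.X ++ P.X)).snd (sm_mon hb)
  simp only [Mor.fst_apply, Mor.snd_apply, Mor.id_apply] at h1 h2
  simp only [Mor.pair_apply, Mor.snd_apply, Mor.id_apply, Tup.right_append] at h
  have he' := sm_mon he
  have h3 : p ≤ ball _ _ ⊔ ball _ _ := ball_self h (mjrT_append_iff.2 ⟨he', he'⟩)
  simp only [Tup.left_append, Tup.right_append] at h3
  refine le_of_le_sup h3 (fun q hq h4 => ?_) (fun q hq h4 => ?_)
  · exact P.mono (hq.trans h1) (hq.trans he') (ball_self h4 (hq.trans he'))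
  · exact P.mono (hq.trans h2) (hq.trans he') (ball_self h4 (hq.trans he'))

theorem or_weak (P Q : Prob Γ) : Le P (P.or Q) := by
  refine ⟨(Mor.id _).pair (Mor.zero _ _), (Mor.id (P.X ++ (P.Y ++ Q.Y))).snd.fst,
    fun p ρ b e hb he h => ?_⟩
  simp only [Mor.fst_apply, Mor.snd_apply, Mor.id_apply, Tup.right_append] at h
  refine le_trans ?_ le_sup_left
  simp only [Mor.pair_apply, Mor.id_apply, Tup.left_append]
  exact h

theorem and_weak (P Q : Prob Γ) : Le (P.and Q) P := by
  refine ⟨(Mor.id (P.X ++ Q.X)).fst, (Mor.id _).snd.pair (Mor.zero _ _),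
    fun p ρ b e hb he h => ?_⟩
  have h1 := sm_mon (((Mor.id ((P.X ++ Q.X) ++ P.Y)).snd.pair (Mor.zero _ Q.Y)).sm
    (sm_append hb he))
  simp only [Mor.pair_apply, Mor.snd_apply, Mor.id_apply, Tup.right_append] at h h1
  have h2 : p ≤ _ ⊓ _ := ball_self h h1
  simp only [Tup.left_append] at h2
  simp only [Mor.fst_apply, Mor.id_apply]
  exact h2.trans inf_le_left

theorem or_perm (P Q : Prob Γ) : Le (P.or Q) (Q.or P) := by
  refine ⟨(Mor.id (P.X ++ Q.X)).snd.pair (Mor.id (P.X ++ Q.X)).fst,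
    (Mor.id ((P.X ++ Q.X) ++ (Q.Y ++ P.Y))).snd.snd.pair
      (Mor.id ((P.X ++ Q.X) ++ (Q.Y ++ P.Y))).snd.fst, fun p ρ b e hb he h => ?_⟩
  simp only [Mor.pair_apply, Mor.fst_apply, Mor.snd_apply, Mor.id_apply, Tup.right_append] at h
  have h1 : p ≤ ball _ _ ⊔ ball _ _ :=
    ball_self h (sm_mon (sm_append (sm_right he) (sm_left he)))
  simp only [Tup.left_append, Tup.right_append] at h1
  show p ≤ ball _ _ ⊔ ball _ _
  simp only [Mor.pair_apply, Mor.fst_apply, Mor.snd_apply, Mor.id_apply, Tup.left_append,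
    Tup.right_append]
  exact sup_comm (ball (Tup.left e) _) _ ▸ h1

theorem and_perm (P Q : Prob Γ) : Le (P.and Q) (Q.and P) := by
  refine ⟨(Mor.id (P.X ++ Q.X)).snd.pair (Mor.id (P.X ++ Q.X)).fst,
    (Mor.id ((P.X ++ Q.X) ++ (Q.Y ++ P.Y))).snd.snd.pair
      (Mor.id ((P.X ++ Q.X) ++ (Q.Y ++ P.Y))).snd.fst, fun p ρ b e hb he h => ?_⟩
  simp only [Mor.pair_apply, Mor.fst_apply, Mor.snd_apply, Mor.id_apply, Tup.right_append] at h
  have h1 : p ≤ _ ⊓ _ := ball_self h (sm_mon (sm_append (sm_right he) (sm_left he)))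
  simp only [Tup.left_append, Tup.right_append] at h1
  show p ≤ _ ⊓ _
  simp only [Mor.pair_apply, Mor.fst_apply, Mor.snd_apply, Mor.id_apply, Tup.left_append,
    Tup.right_append]
  exact le_inf (h1.trans inf_le_right) (h1.trans inf_le_left)

/-- Currying in the realizer of `Q`. The challenge bound of the premise is a pair: its first half
becomes the challenge to `P`, its second half the bound functional inside the implication. -/
theorem exportation {P Q R : Prob Γ} (h : Le (P.and Q) R) : Le P (Q.imp R) := by
  obtain ⟨f, g, h⟩ := h
  let assoc : Mor (P.X ++ (Q.X ++ R.Y)) ((P.X ++ Q.X) ++ R.Y) :=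
    ((Mor.id _).fst.pair (Mor.id (P.X ++ (Q.X ++ R.Y))).snd.fst).pair (Mor.id _).snd.snd
  refine ⟨(Mor.curry (τs := Q.X) f).pair (Mor.curry (τs := Q.X ++ R.Y)
    (Mor.snd (τs := P.Y) (g.comp assoc))), Mor.fst (υs := Q.Y) (g.comp assoc),
    fun p ρ a e ha he h' => le_himp_iff_forall.2 fun q hq h'' => ?_⟩
  rw [← Tup.append_left_right e] at he h' h'' ⊢
  have he := sm_append_iff.1 (hq.trans he)
  have hg := sm_mon (g.sm (sm_append (sm_append (hq.trans ha) he.1) he.2))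
  simp only [assoc, Mor.pair_apply, Mor.fst_apply, Mor.snd_apply, Mor.id_apply, Mor.curry_apply,
    Mor.comp_apply, Tup.left_append, Tup.right_append] at h' h'' ⊢
  refine h q ρ _ _ (sm_append (hq.trans ha) he.1) he.2 ?_
  rw [← Tup.append_left_right (g _)] at hg ⊢
  have hg := mjrT_append_iff.1 hg
  refine (ball_and_iff hg.1 hg.2).2 ?_
  rw [Tup.left_append, Tup.right_append]
  exact ⟨hq.trans h', h''⟩

theorem importation {P Q R : Prob Γ} (h : Le P (Q.imp R)) : Le (P.and Q) R := by
  obtain ⟨f, g, h⟩ := h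
  refine ⟨Mor.app (τs := Q.X) (Mor.fst (f.comp (Mor.id (P.X ++ Q.X)).fst)) (Mor.id _).snd,
    (g.comp ((Mor.id ((P.X ++ Q.X) ++ R.Y)).fst.fst.pair
      ((Mor.id ((P.X ++ Q.X) ++ R.Y)).fst.snd.pair (Mor.id _).snd))).pair
      (Mor.app (τs := Q.X ++ R.Y) (Mor.snd (τs := R.X.map (arrs Q.X))
        (f.comp (Mor.id ((P.X ++ Q.X) ++ R.Y)).fst.fst))
        ((Mor.id ((P.X ++ Q.X) ++ R.Y)).fst.snd.pair (Mor.id _).snd)), fun p ρ b e hb he h' => ?_⟩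
  have ha := sm_left (σs := P.X) hb
  have hb := sm_right (σs := P.X) hb
  simp only [Mor.pair_apply, Mor.fst_apply, Mor.snd_apply, Mor.id_apply, Mor.comp_apply,
    Mor.app_apply, Tup.left_append, Tup.right_append] at h' ⊢
  have hbe := sm_append hb he
  have h1 := (ball_and_iff (φ := P.rel ρ (Tup.left b)) (ψ := Q.rel ρ (Tup.right (σs := P.X) b))
    (sm_mon (g.sm (sm_append ha hbe)))
    (mjrT_appT (mjrT_right' (sm_mon (f.sm ha))) (sm_mon hbe))).1 h'
  have h2 := le_himp_iff_forall.1 (h p ρ _ _ ha hbe h1.1) p le_rfl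
  simp only [Tup.left_append, Tup.right_append] at h2
  exact h2 h1.2

theorem expansion (R : Prob Γ) {P Q : Prob Γ} (h : Le P Q) : Le (R.or P) (R.or Q) := by
  obtain ⟨f, g, h⟩ := h
  refine ⟨(Mor.id (R.X ++ P.X)).fst.pair (f.comp (Mor.id _).snd),
    (Mor.id ((R.X ++ P.X) ++ (R.Y ++ Q.Y))).snd.fst.pair
      (g.comp ((Mor.id ((R.X ++ P.X) ++ (R.Y ++ Q.Y))).fst.snd.pair
        (Mor.id ((R.X ++ P.X) ++ (R.Y ++ Q.Y))).snd.snd)), fun p ρ b e hb he h' => ?_⟩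
  have hb2 := sm_right (σs := R.X) hb
  have he2 := sm_right (σs := R.Y) he
  have hG := g.sm (sm_append hb2 he2)
  simp only [Mor.pair_apply, Mor.fst_apply, Mor.snd_apply, Mor.id_apply, Mor.comp_apply,
    Tup.left_append, Tup.right_append] at h'
  have h1 : p ≤ ball _ _ ⊔ ball _ _ := ball_self h' (sm_mon (sm_append (sm_left he) hG))
  show p ≤ ball _ _ ⊔ ball _ _
  simp only [Mor.pair_apply, Mor.fst_apply, Mor.snd_apply, Mor.id_apply, Mor.comp_apply,
    Tup.left_append, Tup.right_append] at h1 ⊢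
  refine le_of_le_sup h1 (fun q hq h2 => h2.trans le_sup_left)
    (fun q hq h2 => le_trans (le_ball_iff.2 fun r hr e' he1' he2' => ?_) le_sup_right)
  refine h r ρ _ _ ((hr.trans hq).trans hb2)
    -- The disjunct must hold for all challenges `e'` below the given one. The bound `g` was
    -- computed at the given challenge and dominates its value at `e'`.
    (sm_of_mjrT ((hr.trans hq).trans he2) he1' he2') (ball_mono (hr.trans h2) (g.mono ?_))
  exact mjrT_append_iff.2 ⟨(hr.trans hq).trans (sm_mon hb2), he2'⟩

/-! ### The quantifier rules -/

theorem all_elim {σ : Ty} (P : Prob (σ :: Γ)) (t : V Γ → D σ) :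
    Le (all σ P) (P.pull fun ρ => t ρ ∷ ρ) := by
  refine ⟨Mor.id _, (Mor.id _).snd, fun p ρ b e hb he h => ?_⟩
  simp only [Mor.snd_apply, Mor.id_apply, Tup.right_append] at h ⊢
  exact (ball_self h (sm_mon he)).trans (iInf_le _ (t ρ))

theorem ex_intro {σ : Ty} (P : Prob (σ :: Γ)) (t : V Γ → D σ) :
    Le (P.pull fun ρ => t ρ ∷ ρ) (ex σ P) := by
  refine ⟨Mor.id _, (Mor.id _).snd, fun p ρ b e hb he h => ?_⟩
  simp only [Mor.snd_apply, Mor.id_apply, Tup.right_append] at h ⊢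
  exact h.trans (le_iSup (fun d => ball _ (P.rel (d ∷ ρ) b)) (t ρ))

/-- Reductions consist of terms in the realizers and challenges alone and never depend on the
valuation, so the same pair works uniformly. -/
theorem all_intro {σ : Ty} {P : Prob (σ :: Γ)} {Q : Prob Γ} (h : Le (Q.pull Tup.tl) P) :
    Le Q (all σ P) := by
  obtain ⟨f, g, h⟩ := h
  exact ⟨f, g, fun p ρ b e hb he h' => le_iInf fun d => h p (d ∷ ρ) b e hb he h'⟩

theorem ex_elim {σ : Ty} {P : Prob (σ :: Γ)} {Q : Prob Γ} (h : Le P (Q.pull Tup.tl)) :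
    Le (ex σ P) Q := by
  obtain ⟨f, g, h⟩ := h
  refine ⟨f, g, fun p ρ b e hb he h' => ?_⟩
  have h1 : p ≤ ⨆ d, ball _ _ := ball_self h' (sm_mon (g.sm (sm_append hb he)))
  exact le_of_le_iSup h1 fun d q hq h2 => h q (d ∷ ρ) b e (hq.trans hb) (hq.trans he) h2

end Prob


/-! ### The problem of a formula -/

/-- In each inductive step the induction hypotheses make problems of the subformulas, and the
monotonicity built into the matching operation on problems finishes the case. -/
theorem sem_mono {Γ : Ctx} (A : Formula Γ) {p : H} {ρ : V Γ} {b b' : V (exTypes A)}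
    {c : V (allTypes A)} (hb : p ≤ mjrT b b') (hc : p ≤ mjrT c c) (h : p ≤ sem A ρ b c) :
    p ≤ sem A ρ b' c := by
  induction A generalizing p with
  | eq s t => exact h
  | st t => exact (Prob.stP t.ev).mono (ρ := ρ) (c := c) hb hc h
  | and A B hA hB =>
    exact (Prob.and ⟨_, _, sem A, hA⟩ ⟨_, _, sem B, hB⟩).mono (ρ := ρ) hb hc h
  | or A B hA hB =>
    exact (Prob.or ⟨_, _, sem A, hA⟩ ⟨_, _, sem B, hB⟩).mono (ρ := ρ) hb hc h
  | imp A B hA hB =>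
    exact (Prob.imp ⟨_, _, sem A, hA⟩ ⟨_, _, sem B, hB⟩).mono (ρ := ρ) hb hc h
  | all σ A hA => exact (Prob.all σ ⟨_, _, sem A, hA⟩).mono (ρ := ρ) hb hc h
  | ex σ A hA => exact (Prob.ex σ ⟨_, _, sem A, hA⟩).mono (ρ := ρ) hb hc h

@[reducible] def prob {Γ : Ctx} (A : Formula Γ) : Prob Γ :=
  ⟨exTypes A, allTypes A, sem A, sem_mono A⟩

section

variable {Γ Δ : Ctx}

theorem prob_imp (A B : Formula Γ) : prob (imp A B) = (prob A).imp (prob B) := rfl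

theorem Prob.pull_all {σ : Ty} (P : Prob (σ :: Γ)) {r : V Δ → V Γ} {r' : V (σ :: Δ) → V (σ :: Γ)}
    (h : ∀ d ρ, r' (d ∷ ρ) = d ∷ r ρ) : (P.pull r').all σ = (P.all σ).pull r := by
  have : (fun (ρ : V Δ) (b : V P.X) (c : V P.Y) => ⨅ d : D σ, P.rel (r' (d ∷ ρ)) b c) =
      fun ρ b c => ⨅ d : D σ, P.rel (d ∷ r ρ) b c := by simp only [h]
  simp only [Prob.all, Prob.pull, this]

theorem Prob.pull_ex {σ : Ty} (P : Prob (σ :: Γ)) {r : V Δ → V Γ} {r' : V (σ :: Δ) → V (σ :: Γ)}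
    (h : ∀ d ρ, r' (d ∷ ρ) = d ∷ r ρ) : (P.pull r').ex σ = (P.ex σ).pull r := by
  have : (fun (ρ : V Δ) (b : V P.X) (c : V P.Y) => ⨆ d : D σ, ball c (P.rel (r' (d ∷ ρ)) b)) =
      fun ρ b c => ⨆ d : D σ, ball c (P.rel (d ∷ r ρ) b) := by simp only [h]
  simp only [Prob.ex, Prob.pull, this]

/-- An equality of whole problems, types included. Stating it this way avoids casts, although the
type lists of `A.subst s` and `A` agree only by induction on `A`. -/
theorem prob_subst (s : Sub Γ Δ) (A : Formula Γ) : prob (A.subst s) = (prob A).pull s.ev := by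
  induction A generalizing Δ with
  | eq t u =>
    have : sem (eq (t.subst s) (u.subst s)) = fun ρ => sem (eq t u) (s.ev ρ) := by
      funext ρ b c
      exact congrArg₂ theModel.eq (Term.ev_subst s t ρ) (Term.ev_subst s u ρ)
    exact congrArg (fun f => Prob.pure f) (funext fun ρ => congrFun₃ this ρ Tup.nil Tup.nil)
  | st t => exact congrArg Prob.stP (funext fun ρ => Term.ev_subst s t ρ)
  | and A B hA hB => exact congrArg₂ Prob.and (hA s) (hB s)
  | or A B hA hB => exact congrArg₂ Prob.or (hA s) (hB s)
  | imp A B hA hB => exact congrArg₂ Prob.imp (hA s) (hB s)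
  | all σ A hA =>
    exact (congrArg (Prob.all σ) (hA _)).trans (Prob.pull_all _ fun d ρ => Sub.ev_lift' s d ρ)
  | ex σ A hA =>
    exact (congrArg (Prob.ex σ) (hA _)).trans (Prob.pull_ex _ fun d ρ => Sub.ev_lift' s d ρ)

theorem prob_ren (r : Ren Γ Δ) (A : Formula Γ) : prob (A.ren r) = (prob A).pull r.ev := by
  rw [Formula.ren_eq_subst, prob_subst]; rfl

theorem prob_inst {σ : Ty} (A : Formula (σ :: Γ)) (t : Term Γ σ) :
    prob (A.inst t) = (prob A).pull fun ρ => t.ev ρ ∷ ρ := by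
  rw [Formula.inst, prob_subst]
  exact congrArg _ (funext fun ρ => Sub.ev_inst t ρ)

theorem prob_wk (σ : Ty) (A : Formula Γ) : prob (A.wk σ) = (prob A).pull Tup.tl := by
  rw [Formula.wk, prob_ren]
  exact congrArg _ (funext fun ρ => Ren.ev_succ ρ.hd ρ.tl)

theorem ball_nil {c : V []} {φ : V [] → H} : ball c φ = φ Tup.nil :=
  le_antisymm (ball_self le_rfl mjrT_nil) (le_ball_iff.2 fun _ hq _ _ _ => hq)

/-- All tuples are empty, so the bounded quantifiers added by the interpretation have just one
trivial instance. -/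
theorem prob_internal {A : Formula Γ} (hA : A.Internal) : prob A = Prob.pure A.val := by
  induction A with
  | eq t u => rfl
  | st t => exact hA.elim
  | and A B iA iB => exact congrArg₂ Prob.and (iA hA.1) (iB hA.2)
  | or A B iA iB =>
    refine (congrArg₂ Prob.or (iA hA.1) (iB hA.2)).trans ?_
    simp only [Prob.or, ball_nil]
    rfl
  | imp A B iA iB =>
    refine (congrArg₂ Prob.imp (iA hA.1) (iB hA.2)).trans ?_
    simp only [Prob.imp, ball_nil]
    rfl
  | all σ A iA => exact congrArg (Prob.all σ) (iA hA)
  | ex σ A iA =>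
    refine (congrArg (Prob.ex σ) (iA hA)).trans ?_
    simp only [Prob.ex, ball_nil]
    rfl

theorem realized_of_internal {A : Formula Γ} (hA : A.Internal) (h : EHAst A) :
    (prob A).Realized := by
  rw [prob_internal hA]
  exact ⟨Mor.id [], fun p ρ c _ => le_top.trans_eq (h.val_eq_top ρ).symm⟩

theorem Formula.internal_eqT {σ : Ty} (s t : Term Γ σ) : (eqT σ s t).Internal := by
  induction σ generalizing Γ with
  | nat => trivial
  | arr σ τ _ ih => exact ih _ _

theorem ArithAxiom.internal {A : Formula Γ} (h : ArithAxiom A) : A.Internal := by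
  induction h with
  | eq_refl | eq_symm | eq_trans | succ_ne_zero | succ_inj => simp [Formula.Internal, Formula.bot]
  | extensionality => exact ⟨Formula.internal_eqT _ _, Formula.internal_eqT _ _⟩
  | induction A hA => exact ⟨⟨hA.subst _, hA, hA.subst _⟩, hA⟩
  | combK | combS | recr_zero | recr_succ => exact Formula.internal_eqT _ _

/-! ### Falsity and the standardness axioms -/

namespace Prob

theorem ex_falso (P : Prob Γ) : Le (prob bot) P :=
  ⟨Mor.zero _ _, Mor.zero _ _, fun _ _ _ _ _ _ h =>
    (ball_self (σs := []) h mjrT_nil).trans (bot_le' _)⟩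

theorem stP_congr {σ : Ty} (s t : V Γ → D σ) :
    Le (pure fun ρ => eqD (s ρ) (t ρ)) ((stP s).imp (stP t)) := by
  refine exportation ⟨Mor.id [σ], Mor.zero [σ] [], fun p ρ b e hb he h => ?_⟩
  have h1 : p ≤ eqD (s ρ) (t ρ) ⊓ mjr (s ρ) (Tup.hd b) := ball_self (σs := []) h mjrT_nil
  show p ≤ mjr (t ρ) (Tup.hd (Mor.id [σ] (b : V [σ])))
  rw [Mor.id_apply]
  exact mjr_congr (h1.trans inf_le_left) (eqD_refl _) (h1.trans inf_le_right)

/-- A majorant of `t` is a majorant of `s` by transitivity, so the realizer is passed on unchanged.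
-/
theorem stP_maj {σ : Ty} (s t : V Γ → D σ) :
    Le (stP t) ((pure fun ρ => mjr (s ρ) (t ρ)).imp (stP s)) := by
  refine exportation ⟨Mor.id [σ], Mor.zero [σ] [], fun p ρ b e hb he h => ?_⟩
  have h1 : p ≤ mjr (t ρ) (Tup.hd b) ⊓ mjr (s ρ) (t ρ) := ball_self (σs := []) h mjrT_nil
  show p ≤ mjr (s ρ) (Tup.hd (Mor.id [σ] (b : V [σ])))
  rw [Mor.id_apply]
  exact mjr_trans (h1.trans inf_le_right) (h1.trans inf_le_left)

/-- The only place where the existence of majorants for all closed terms is used. -/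
theorem stP_closed {σ : Ty} (t : Term [] σ) : (stP (Γ := Γ) fun _ => t.ev Tup.nil).Realized := by
  obtain ⟨t', ht'⟩ := t.exists_majorant
  exact ⟨⟨.cons t' .nil, fun p ρ ρ' h => le_inf (mjr_right (ht' p ρ ρ' h)) le_top⟩,
    fun p ρ c _ => ht' p _ _ mjrT_nil⟩

theorem stP_app {σ τ : Ty} (s : V Γ → D (.arr σ τ)) (t : V Γ → D σ) :
    Le (stP s) ((stP t).imp (stP fun ρ => s ρ (t ρ))) := by
  refine exportation ⟨Mor.app (τs := [σ]) (υs := [τ]) (Mor.id ([.arr σ τ] ++ [σ])).fst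
    (Mor.id _).snd, Mor.zero ([.arr σ τ] ++ [σ]) [], fun p ρ b e hb he h => ?_⟩
  have h1 : p ≤ mjr (s ρ) (Tup.hd b) ⊓ mjr (t ρ) (Tup.hd (Tup.tl b)) :=
    ball_self (σs := []) h mjrT_nil
  rw [Mor.app_apply, Mor.fst_apply, Mor.snd_apply, Mor.id_apply]
  exact mjr_app (h1.trans inf_le_left) (h1.trans inf_le_right)

end Prob

theorem StAxiom.realized {A : Formula Γ} (h : StAxiom A) : (prob A).Realized := by
  induction h with
  | @congr σ s t =>
    rw [prob_imp, prob_imp, Prob.realized_imp_iff, prob_internal (Formula.internal_eqT _ _)]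
    have := Prob.stP_congr (Γ := Γ) s.ev t.ev
    rwa [show (fun ρ => eqD (s.ev ρ) (t.ev ρ)) = (eqT σ s t).val from
      funext fun ρ => (Formula.val_eqT s t ρ).symm] at this
  | @maj σ s t =>
    rw [prob_imp, prob_imp, Prob.realized_imp_iff, prob_internal (Formula.internal_maj _ _)]
    have := Prob.stP_maj (Γ := Γ) s.ev t.ev
    rwa [show (fun ρ => mjr (s.ev ρ) (t.ev ρ)) = (Formula.maj s t).val from
      funext fun ρ => (Formula.val_maj s t ρ).symm] at this
  | @closed σ t =>
    have := Prob.stP_closed (Γ := Γ) t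
    rwa [show (fun _ => t.ev Tup.nil) = (t.ofClosed Γ).ev from
      funext fun ρ => (Term.ev_ofClosed t ρ).symm] at this
  | app s t => exact Prob.realized_imp_iff.2 (Prob.stP_app s.ev t.ev)

end


/-! ### External induction -/

theorem Prob.realized_all_iff {Γ : Ctx} {σ : Ty} {P : Prob (σ :: Γ)} :
    (P.all σ).Realized ↔ P.Realized :=
  ⟨fun ⟨t, ht⟩ => ⟨t, fun p ρ c hc => (ht p ρ.tl c hc).trans (iInf_le _ ρ.hd)⟩,
    fun ⟨t, ht⟩ => ⟨t, fun p ρ c hc => le_iInf fun d => ht p (d ∷ ρ) c hc⟩⟩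

theorem mjrT_cell {p : H} (n : D .nat) : p ≤ mjrT (n ∷ Tup.nil : V [.nat]) (n ∷ Tup.nil) :=
  le_inf (mjr_nat_refl n) le_top

theorem sm_cell {p : H} {n : D .nat} (h : p ≤ theModel.st n) : p ≤ sm (n ∷ Tup.nil : V [.nat]) :=
  le_inf (le_inf h le_top) (mjrT_cell n)

/-- A primitive recursive functional with initial value `t` and monotone step function `f`. -/
theorem Mor.exists_recs {X : List Ty} (t : Mor [] X) (f : Mor ([.nat] ++ X) X) :
    ∃ h : Mor [.nat] X, h (theModel.zero ∷ Tup.nil) = t Tup.nil ∧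
      ∀ (p : H) (n : D .nat),
        p ≤ mjrT (f (n ∷ h (n ∷ Tup.nil))) (h (theModel.succ n ∷ Tup.nil)) := by
  -- The recursor hands the previous value and then the number to its step, while `f` expects them
  -- in the opposite order.
  let z : Mor [] (stepTypes X) := Mor.curry (σs := []) (τs := X ++ [.nat])
    (f.comp ((Mor.id (X ++ [.nat])).snd.pair (Mor.id (X ++ [.nat])).fst))
  let h : Mor [.nat] X := (Mor.recs X).comp
    ((Mor.id [.nat]).pair ((t.comp (Mor.zero _ [])).pair (z.comp (Mor.zero _ []))))
  have hh : ∀ n, h (n ∷ Tup.nil) = recT n (t Tup.nil) (stepMax X (z Tup.nil)) := by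
    intro n
    refine (Mor.comp_apply _ _ _).trans ?_
    rw [Mor.pair_apply, Mor.pair_apply, Mor.comp_apply, Mor.comp_apply, Mor.id_apply]
    exact Mor.recs_apply _ _ _
  refine ⟨h, (hh _).trans (recT_zero _ _), fun p n => ?_⟩
  rw [hh (theModel.succ n), recT_succ, ← hh]
  have h1 := h.mono (p := p) (mjrT_cell n)
  -- Replacing the step by a maximum leaves only majorization at successors. That suffices, since
  -- problems are monotone in their realizers.
  have h2 := (le_stepMax (ρs := X) (z.mono (p := p) (a := Tup.nil) (b := Tup.nil) mjrT_nil)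
    (mjrT_append_iff.2 ⟨h1, mjrT_cell n⟩)).2
  have h3 : appT (z Tup.nil) ((h (n ∷ Tup.nil)).append (n ∷ Tup.nil)) =
      f (n ∷ h (n ∷ Tup.nil)) := by
    refine (Mor.curry_apply (σs := []) _ _ _).trans ?_
    refine (Mor.comp_apply _ _ _).trans ?_
    rw [Mor.pair_apply, Mor.fst_apply, Mor.snd_apply, show Mor.id (X ++ [.nat])
      (Tup.append (σs := []) (τs := X ++ [.nat]) Tup.nil ((h (n ∷ Tup.nil)).append (n ∷ Tup.nil))) =
        (h (n ∷ Tup.nil)).append (n ∷ Tup.nil) from Mor.id_apply _, Tup.left_append,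
      Tup.right_append]
    rfl
  rwa [h3] at h2

/-- Transfers the external induction rule to the model through completeness. As it is a rule and not
an axiom, its premises are required at all conditions and valuations. -/
theorem external_induction_val {Γ : Ctx} (A : Formula (.nat :: Γ))
    (h0 : ∀ ρ, A.val (theModel.zero ∷ ρ) = ⊤)
    (h1 : ∀ p n ρ, p ≤ theModel.st n → p ≤ A.val (n ∷ ρ) → p ≤ A.val (theModel.succ n ∷ ρ))
    {p : H} {n : D .nat} (ρ : V Γ) (hn : p ≤ theModel.st n) : p ≤ A.val (n ∷ ρ) := by
  have key : EHAst (allSt [.nat] A) := by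
    refine .external_induction A (EHAst.of_val fun ρ => ?_) (EHAst.of_val fun ρ => ?_)
    · rw [Formula.inst, Formula.val_subst, Sub.ev_inst]
      exact h0 ρ
    · refine top_le_iff.1 (le_iInf fun n => le_himp_iff_forall.2 fun p _ hp =>
        le_himp_iff_forall.2 fun q hq h => ?_)
      refine (h1 q n ρ (hq.trans hp) h).trans (le_of_eq ?_)
      rw [← Sub.ev_incr, ← Formula.val_subst]
      rfl
  have := (le_top.trans_eq (key.val_eq_top ρ).symm : p ≤ _).trans (iInf_le _ n)
  exact le_himp_iff_forall.1 this p le_rfl hn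

theorem external_induction_realized {Γ : Ctx} (A : Formula (.nat :: Γ))
    (h0 : (prob (A.inst .zero)).Realized)
    (h1 : (prob (allSt [.nat] (imp A (A.subst (Sub.incr Γ))))).Realized) :
    (prob (allSt [.nat] A)).Realized := by
  rw [prob_inst] at h0
  have h1' : (Prob.all .nat ((Prob.stP (Term.var .zero).ev).imp
      ((prob A).imp ((prob A).pull (Sub.incr Γ).ev)))).Realized := by
    rw [← prob_subst]
    exact h1
  obtain ⟨t, ht⟩ := h0
  obtain ⟨f, g, hfg⟩ := Prob.importation (Prob.realized_imp_iff.1 (Prob.realized_all_iff.1 h1'))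
  obtain ⟨h, hz, hs⟩ := Mor.exists_recs (X := exTypes A) t f
  have key : ∀ (p : H) (n : D .nat) (ρ : V Γ) (e : V (allTypes A)), p ≤ theModel.st n → p ≤ sm e →
      p ≤ sem A (n ∷ ρ) (h (n ∷ Tup.nil)) e := by
    -- The statement that `h n` solves the problem at `n`, written as a formula. It quantifies over
    -- standard challenges, so in general it is external and internal induction does not cover it.
    let C : Formula (.nat :: Γ) := allStMon (allTypes A) (matrix A ((Sub.id _).wkN (allTypes A))
      ((h.tms.subst (Terms.toSub (.cons (.var .zero) .nil))).wkN (allTypes A)) (Terms.fresh _))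
    have hC : ∀ n ρ, C.val (n ∷ ρ) =
        ⨅ e : V (allTypes A), stT e ⊓ mjrT e e ⇨ sem A (n ∷ ρ) (h (n ∷ Tup.nil)) e := by
      intro n ρ
      refine (Formula.val_allStMon _ _).trans (iInf_congr fun e => congrArg₂ _ rfl ?_)
      rw [val_matrix, Sub.ev_wkN, Sub.ev_id, Terms.ev_wkN, Terms.ev_fresh, Terms.ev_subst,
        Terms.ev_toSub]
      rfl
    have hC' : ∀ p n ρ, p ≤ C.val (n ∷ ρ) ↔ ∀ q ≤ p, ∀ e, q ≤ sm e →
        q ≤ sem A (n ∷ ρ) (h (n ∷ Tup.nil)) e := by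
      intro p n ρ
      rw [hC, le_iInf_iff]
      simp only [le_himp_iff_forall]
      exact ⟨fun h q hq e => h e q hq, fun h e q hq => h q hq e⟩
    intro p n ρ e hn he
    refine (hC' p n ρ).1 (external_induction_val C (fun ρ => ?_) (fun p n ρ hn hp => ?_) ρ hn)
      p le_rfl e he
    · refine top_le_iff.1 ((hC' _ _ _).2 fun q _ e he => ?_)
      rw [hz]
      exact ht q ρ e he
    · refine (hC' _ _ _).2 fun q hq e he => ?_
      have hq' := hq.trans hn
      have hb := sm_append (sm_cell hq') (h.sm (sm_cell hq'))
      have h1 := hfg q (n ∷ ρ) ((n ∷ Tup.nil : V [.nat]).append (h (n ∷ Tup.nil))) e hb he ?_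
      · refine sem_mono A (hs q n) (sm_mon he) ?_
        rw [← Sub.ev_incr]
        exact h1
      -- Here `n` serves as its own majorant, and the challenges `a` are standard because the bound
      -- given by `g` is; the induction hypothesis therefore meets them.
      · refine le_ball_iff.2 fun r hr a ha1 ha2 => le_inf (mjr_nat_refl n) ?_
        have ha := sm_of_mjrT (hr.trans (g.sm (sm_append hb he))) ha1 ha2
        exact (hC' _ _ _).1 hp r (hr.trans hq) a ha
  refine Prob.realized_all_iff.2 ((Prob.realized_imp_iff
    (P := Prob.stP (Term.var .zero).ev) (Q := prob A)).2 ⟨h, Mor.zero _ _,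
    fun p ρ b e hb he hp => ?_⟩)
  have hp : p ≤ mjr ρ.hd (Tup.hd b) := ball_self (σs := []) hp mjrT_nil
  -- The realizer only receives a standard majorant `b` of `n`. This makes `n` standard, so `h n` is
  -- correct, and `h b` majorizes `h n`.
  have hst : p ≤ theModel.st ρ.hd := st_of_mjr ((sm_st hb).trans inf_le_left) hp
  exact sem_mono A (h.mono (a := ρ.hd ∷ Tup.nil) (b := b) (le_inf hp le_top)) (sm_mon he)
    (key p ρ.hd ρ.tl e hst he)


/-! ### Equivalence of problems -/

namespace Prob

variable {Γ Δ : Ctx}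

/-- The universal property of `∀`; the next two lemmas give those of `∃` and of implication. Later
equivalences are derived from these properties without touching realizers. -/
theorem le_all_iff {σ : Ty} {P : Prob (σ :: Γ)} {Q : Prob Γ} :
    Le Q (P.all σ) ↔ Le (Q.pull Tup.tl) P :=
  ⟨fun ⟨f, g, h⟩ => ⟨f, g, fun p ρ b e hb he h' => (h p ρ.tl b e hb he h').trans (iInf_le _ ρ.hd)⟩,
    all_intro⟩

theorem ex_le_iff {σ : Ty} {P : Prob (σ :: Γ)} {Q : Prob Γ} :
    Le (P.ex σ) Q ↔ Le P (Q.pull Tup.tl) :=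
  ⟨fun ⟨f, g, h⟩ => ⟨f, g, fun p ρ b e hb he h' => h p ρ.tl b e hb he (le_ball_iff.2
    fun _ hq a _ ha => le_trans (ball_mono (hq.trans h') ha)
      (le_iSup (fun d => ball a (P.rel (d ∷ ρ.tl) b)) ρ.hd))⟩, ex_elim⟩

theorem le_imp_iff {P Q R : Prob Γ} : Le P (Q.imp R) ↔ Le (P.and Q) R :=
  ⟨importation, exportation⟩

theorem Le.pull {P Q : Prob Γ} (h : Le P Q) (r : V Δ → V Γ) : Le (P.pull r) (Q.pull r) := by
  obtain ⟨f, g, h⟩ := h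
  exact ⟨f, g, fun p ρ b e hb he h' => h p (r ρ) b e hb he h'⟩

theorem and_weak_right (P Q : Prob Γ) : Le (P.and Q) Q := (and_perm P Q).trans (and_weak Q P)

theorem le_and {P Q R : Prob Γ} (h1 : Le P Q) (h2 : Le P R) : Le P (Q.and R) :=
  (and_contr P).trans (importation (h1.trans (le_imp_iff.2 ((and_perm _ _).trans
    (importation (h2.trans (le_imp_iff.2 (and_perm _ _))))))))

theorem Le.and {P P' Q Q' : Prob Γ} (h1 : Le P P') (h2 : Le Q Q') : Le (P.and Q) (P'.and Q') :=
  le_and ((and_weak _ _).trans h1) ((and_weak_right _ _).trans h2)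

theorem Le.imp {P P' Q Q' : Prob Γ} (h1 : Le P' P) (h2 : Le Q Q') : Le (P.imp Q) (P'.imp Q') :=
  le_imp_iff.2 (((Le.refl _).and h1).trans ((importation (Le.refl _)).trans h2))

/-! ### Quantification of problems over tuples -/

/-- Quantification over all values of a tuple of parameters. -/
@[reducible] def allT (xs : List Ty) (P : Prob (Ctx.ext xs Γ)) : Prob Γ where
  X := P.X
  Y := P.Y
  rel ρ b c := ⨅ x : V xs, P.rel (Tup.ext x ρ) b c
  mono hb hc h := le_iInf fun x => P.mono hb hc (h.trans (iInf_le _ x))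

@[reducible] def exT (xs : List Ty) (P : Prob (Ctx.ext xs Γ)) : Prob Γ where
  X := P.X
  Y := P.Y
  rel ρ b c := ⨆ x : V xs, ball c (P.rel (Tup.ext x ρ) b)
  mono hb _ h := le_of_le_iSup h fun x _ hq h =>
    (P.mono_ball (hq.trans hb) h).trans (le_iSup (fun x => ball _ (P.rel (Tup.ext x _) _)) x)

/-- Every valuation of an extended context splits into values of the new variables and values of the
old ones. -/
theorem _root_.EHA.Tup.ext_eta {xs : List Ty} (ρ : V (Ctx.ext xs Γ)) :
    Tup.ext ((Terms.fresh xs).ev ρ) ((Ren.wkN xs).ev ρ) = ρ := by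
  induction xs generalizing Γ with
  | nil => exact Tup.tabulate_get ρ
  | cons σ xs ih => exact ih (Γ := σ :: Γ) ρ

theorem le_allT_iff {xs : List Ty} {P : Prob (Ctx.ext xs Γ)} {Q : Prob Γ} :
    Le Q (P.allT xs) ↔ Le (Q.pull (Ren.wkN xs).ev) P := by
  constructor
  · rintro ⟨f, g, h⟩
    refine ⟨f, g, fun p ρ b e hb he h' => (h p _ b e hb he h').trans ?_⟩
    refine (iInf_le _ ((Terms.fresh xs).ev ρ)).trans (le_of_eq ?_)
    rw [Tup.ext_eta]
  · rintro ⟨f, g, h⟩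
    refine ⟨f, g, fun p ρ b e hb he h' => le_iInf fun x => h p _ b e hb he ?_⟩
    show p ≤ ball _ (Q.rel ((Ren.wkN xs).ev (Tup.ext x ρ)) b)
    rwa [Ren.ev_wkN]

theorem exT_le_iff {xs : List Ty} {P : Prob (Ctx.ext xs Γ)} {Q : Prob Γ} :
    Le (P.exT xs) Q ↔ Le P (Q.pull (Ren.wkN xs).ev) := by
  constructor
  · rintro ⟨f, g, h⟩
    refine ⟨f, g, fun p ρ b e hb he h' => h p _ b e hb he (le_ball_iff.2 fun q hq a _ ha => ?_)⟩
    refine le_trans (ball_mono (hq.trans h') ha) (le_trans (le_of_eq ?_) (le_iSup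
      (fun x => ball a (P.rel (Tup.ext x ((Ren.wkN xs).ev ρ)) b)) ((Terms.fresh xs).ev ρ)))
    rw [Tup.ext_eta]
  · rintro ⟨f, g, h⟩
    refine ⟨f, g, fun p ρ b e hb he h' => ?_⟩
    have h1 : p ≤ ⨆ x, ball _ _ := ball_self h' (sm_mon (g.sm (sm_append hb he)))
    refine le_of_le_iSup h1 fun x q hq h2 => ?_
    have := h q (Tup.ext x ρ) b e (hq.trans hb) (hq.trans he) h2
    rwa [show (Q.pull (Ren.wkN xs).ev).rel (Tup.ext x ρ) = Q.rel ρ from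
      congrArg Q.rel (Ren.ev_wkN x ρ)] at this

theorem Le.allT {xs : List Ty} {P Q : Prob (Ctx.ext xs Γ)} (h : Le P Q) :
    Le (P.allT xs) (Q.allT xs) :=
  le_allT_iff.2 ((le_allT_iff.1 (Le.refl _)).trans h)

theorem Le.exT {xs : List Ty} {P Q : Prob (Ctx.ext xs Γ)} (h : Le P Q) :
    Le (P.exT xs) (Q.exT xs) :=
  exT_le_iff.2 (h.trans (exT_le_iff.1 (Le.refl _)))

/-! ### The calculus of mutual reducibility -/

/-- Mutual reducibility. -/
def Eqv (P Q : Prob Γ) : Prop := Le P Q ∧ Le Q P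

theorem Eqv.refl (P : Prob Γ) : Eqv P P := ⟨Le.refl P, Le.refl P⟩

theorem Eqv.trans {P Q R : Prob Γ} (h : Eqv P Q) (h' : Eqv Q R) : Eqv P R :=
  ⟨h.1.trans h'.1, h'.2.trans h.2⟩

theorem Eqv.pull {P Q : Prob Γ} (h : Eqv P Q) (r : V Δ → V Γ) : Eqv (P.pull r) (Q.pull r) :=
  ⟨h.1.pull r, h.2.pull r⟩

theorem Eqv.and {P P' Q Q' : Prob Γ} (h1 : Eqv P P') (h2 : Eqv Q Q') :
    Eqv (P.and Q) (P'.and Q') := ⟨h1.1.and h2.1, h1.2.and h2.2⟩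

theorem Eqv.imp {P P' Q Q' : Prob Γ} (h1 : Eqv P P') (h2 : Eqv Q Q') :
    Eqv (P.imp Q) (P'.imp Q') := ⟨h1.2.imp h2.1, h1.1.imp h2.2⟩

theorem Eqv.allT {xs : List Ty} {P Q : Prob (Ctx.ext xs Γ)} (h : Eqv P Q) :
    Eqv (P.allT xs) (Q.allT xs) := ⟨h.1.allT, h.2.allT⟩

theorem Eqv.exT {xs : List Ty} {P Q : Prob (Ctx.ext xs Γ)} (h : Eqv P Q) :
    Eqv (P.exT xs) (Q.exT xs) := ⟨h.1.exT, h.2.exT⟩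

/-- A Yoneda argument: a problem is determined, up to mutual reducibility, by what reduces to it.
The next lemma is the dual. -/
theorem Eqv.of_le_iff {P P' : Prob Γ} (h : ∀ Q, Le Q P ↔ Le Q P') : Eqv P P' :=
  ⟨(h P).1 (Le.refl P), (h P').2 (Le.refl P')⟩

theorem Eqv.of_iff_le {P P' : Prob Γ} (h : ∀ Q, Le P Q ↔ Le P' Q) : Eqv P P' :=
  ⟨(h P').2 (Le.refl P'), (h P).1 (Le.refl P)⟩

theorem Eqv.of_eq {P Q : Prob Γ} (h : P = Q) : Eqv P Q := h ▸ Eqv.refl P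

theorem and_assoc_le (P Q R : Prob Γ) : Le ((P.and Q).and R) (P.and (Q.and R)) :=
  le_and ((and_weak _ _).trans (and_weak _ _))
    ((and_weak_right P Q).and (Le.refl R))

theorem le_and_assoc (P Q R : Prob Γ) : Le (P.and (Q.and R)) ((P.and Q).and R) :=
  le_and ((Le.refl P).and (and_weak _ _)) ((and_weak_right _ _).trans (and_weak_right _ _))

theorem and_assoc_iff {P Q R S : Prob Γ} :
    Le ((P.and Q).and R) S ↔ Le (P.and (Q.and R)) S :=
  ⟨(le_and_assoc P Q R).trans, (and_assoc_le P Q R).trans⟩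

theorem le_imp_iff' {P Q R : Prob Γ} : Le P (Q.imp R) ↔ Le (Q.and P) R :=
  le_imp_iff.trans ⟨(and_perm _ _).trans, (and_perm _ _).trans⟩

theorem pull_wkN_cons (P : Prob Γ) (σ : Ty) (σs : List Ty) :
    (P.pull Tup.tl).pull (Ren.wkN (Γ := σ :: Γ) σs).ev = P.pull (Ren.wkN (σ :: σs)).ev := rfl

theorem pull_wkN_nil (P : Prob Γ) : P.pull (Ren.wkN (Γ := Γ) []).ev = P :=
  congrArg P.pull (funext fun ρ => Tup.tabulate_get ρ)

end Prob

open Prob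

/-! ### Quantification over tuples -/

section

variable {Γ : Ctx}

theorem eqv_alls {xs : List Ty} (A : Formula (Ctx.ext xs Γ)) :
    Eqv (prob (alls xs A)) ((prob A).allT xs) := by
  refine Eqv.of_le_iff fun Q => Iff.trans ?_ le_allT_iff.symm
  induction xs generalizing Γ with
  | nil => rw [pull_wkN_nil]; rfl
  | cons σ xs ih => exact le_all_iff.trans (ih A _)

theorem eqv_exs {xs : List Ty} (A : Formula (Ctx.ext xs Γ)) :
    Eqv (prob (exs xs A)) ((prob A).exT xs) := by
  refine Eqv.of_iff_le fun Q => Iff.trans ?_ exT_le_iff.symm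
  induction xs generalizing Γ with
  | nil => rw [pull_wkN_nil]; rfl
  | cons σ xs ih => exact ex_le_iff.trans (ih A _)

end

/-! ### Guarded quantifiers -/

/-- Conditions restricting the members of a tuple of bound variables. -/
inductive Guards : Ctx → List Ty → Type
  | nil {Γ : Ctx} : Guards Γ []
  | cons {Γ : Ctx} {σ : Ty} {σs : List Ty} :
    Formula (σ :: Γ) → Guards (σ :: Γ) σs → Guards Γ (σ :: σs)

namespace Guards

def all : {Γ : Ctx} → {σs : List Ty} → Guards Γ σs → Formula (Ctx.ext σs Γ) → Formula Γ
  | _, _, nil, A => A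
  | _, _, cons G Gs, A => Formula.all _ (imp G (Gs.all A))

def ex : {Γ : Ctx} → {σs : List Ty} → Guards Γ σs → Formula (Ctx.ext σs Γ) → Formula Γ
  | _, _, nil, A => A
  | _, _, cons G Gs, A => Formula.ex _ (and G (Gs.ex A))

/-- The conjunction of the conditions. -/
def conj : {Γ : Ctx} → {σs : List Ty} → Guards Γ σs → Formula (Ctx.ext σs Γ)
  | Γ, _, nil => verum Γ
  | _, _ :: σs, cons G Gs => and (G.ren (Ren.wkN σs)) Gs.conj

variable {Γ : Ctx}

theorem _root_.EHA.and_verum_le (P Q : Prob Γ) : Le (P.and (prob (verum Γ))) Q ↔ Le P Q := by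
  refine ⟨(le_and (Le.refl P) ?_).trans, (and_weak _ _).trans⟩
  exact ⟨Mor.zero _ [], Mor.zero _ _, fun p ρ b e hb he _ => le_eq_refl _⟩

/-- Compare what reduces to either side. Peeling off one quantifier and its guard moves the guard to
the left of the reduction, where the guards accumulate into one conjunction. -/
theorem eqv_all {σs : List Ty} (Gs : Guards Γ σs) (A : Formula (Ctx.ext σs Γ)) :
    Eqv (prob (Gs.all A)) (((prob Gs.conj).imp (prob A)).allT σs) := by
  refine Eqv.of_le_iff fun Q => Iff.trans ?_ (le_allT_iff.trans le_imp_iff).symm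
  induction Gs with
  | nil => rw [pull_wkN_nil]; exact (and_verum_le _ _).symm
  | @cons Γ σ σs G Gs ih =>
    show Le Q (((prob G).imp (prob (Gs.all A))).all σ) ↔
      Le ((Q.pull _).and ((prob (G.ren (Ren.wkN σs))).and (prob Gs.conj))) (prob A)
    rw [le_all_iff, le_imp_iff, ih, ← and_assoc_iff, prob_ren, ← pull_wkN_cons]

theorem eqv_ex {σs : List Ty} (Gs : Guards Γ σs) (A : Formula (Ctx.ext σs Γ)) :
    Eqv (prob (Gs.ex A)) (((prob Gs.conj).and (prob A)).exT σs) := by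
  refine Eqv.of_iff_le fun Q => Iff.trans ?_ exT_le_iff.symm
  induction Gs with
  | @nil Γ =>
    show Le (prob A) Q ↔ Le ((prob (verum Γ)).and (prob A)) _
    rw [pull_wkN_nil, ← le_imp_iff', le_imp_iff, and_verum_le]
  | @cons Γ σ σs G Gs ih =>
    show Le (((prob G).and (prob (Gs.ex A))).ex σ) Q ↔
      Le (((prob (G.ren (Ren.wkN σs))).and (prob Gs.conj)).and (prob A)) (Q.pull _)
    rw [ex_le_iff, ← le_imp_iff', ih, and_assoc_iff, prob_ren, ← pull_wkN_cons]
    exact le_imp_iff' (Q := (prob G).pull (Ren.wkN σs).ev)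
      (R := (Q.pull Tup.tl).pull (Ren.wkN σs).ev)

end Guards

end

end EHA

namespace EHA

noncomputable section

open Formula Prob

variable {Γ : Ctx}

/-! ### Guards of the relativized and bounded quantifiers -/

namespace Guards

def stMon : {Γ : Ctx} → (σs : List Ty) → Guards Γ σs
  | _, [] => nil
  | _, _ :: σs => cons (and (st (.var .zero)) (mon (.var .zero))) (stMon σs)

def std : {Γ : Ctx} → (σs : List Ty) → Guards Γ σs
  | _, [] => nil
  | _, _ :: σs => cons (st (.var .zero)) (std σs)

def bdd : {Γ : Ctx} → {σs : List Ty} → Terms Γ σs → Guards Γ σs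
  | _, [], _ => nil
  | _, σ :: _, .cons t ts => cons (maj (.var .zero) (t.wk σ)) (bdd (ts.wk σ))

def monBdd : {Γ : Ctx} → {σs : List Ty} → Terms Γ σs → Guards Γ σs
  | _, [], _ => nil
  | _, σ :: _, .cons t ts =>
    cons (and (mon (.var .zero)) (maj (.var .zero) (t.wk σ))) (monBdd (ts.wk σ))

theorem all_stMon {σs : List Ty} (A : Formula (Ctx.ext σs Γ)) :
    (stMon σs).all A = allStMon σs A := by
  induction σs generalizing Γ with
  | nil => rfl
  | cons σ σs ih => exact congrArg (fun B => Formula.all σ (imp _ B)) (ih A)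

theorem ex_stMon {σs : List Ty} (A : Formula (Ctx.ext σs Γ)) :
    (stMon σs).ex A = exStMon σs A := by
  induction σs generalizing Γ with
  | nil => rfl
  | cons σ σs ih => exact congrArg (fun B => Formula.ex σ (and _ B)) (ih A)

theorem all_std {σs : List Ty} (A : Formula (Ctx.ext σs Γ)) :
    (std σs).all A = allSt σs A := by
  induction σs generalizing Γ with
  | nil => rfl
  | cons σ σs ih => exact congrArg (fun B => Formula.all σ (imp _ B)) (ih A)

theorem ex_std {σs : List Ty} (A : Formula (Ctx.ext σs Γ)) :
    (std σs).ex A = exSt σs A := by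
  induction σs generalizing Γ with
  | nil => rfl
  | cons σ σs ih => exact congrArg (fun B => Formula.ex σ (and _ B)) (ih A)

theorem ex_bdd {σs : List Ty} (ts : Terms Γ σs) (A : Formula (Ctx.ext σs Γ)) :
    (bdd ts).ex A = exMaj σs ts A := by
  induction σs generalizing Γ with
  | nil => cases ts; rfl
  | cons σ σs ih =>
    cases ts
    exact congrArg (fun B => Formula.ex σ (and _ B)) (ih _ A)

theorem ex_monBdd {σs : List Ty} (ts : Terms Γ σs) (A : Formula (Ctx.ext σs Γ)) :
    (monBdd ts).ex A = exMonMaj σs ts A := by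
  induction σs generalizing Γ with
  | nil => cases ts; rfl
  | cons σ σs ih =>
    cases ts
    exact congrArg (fun B => Formula.ex σ (and _ B)) (ih _ A)

end Guards

/-! ### The problems of the conditions -/

/-- Without challenges, a pointwise inequality is already a reduction, with the identity on
realizers. -/
theorem Prob.Le.of_le {X : List Ty} {r r' : V Γ → V X → V [] → H} {m m'}
    (h : ∀ ρ b, r ρ b Tup.nil ≤ r' ρ b Tup.nil) : Le (Γ := Γ) ⟨X, [], r, m⟩ ⟨X, [], r', m'⟩ := by
  refine ⟨Mor.id X, Mor.zero _ _, fun p ρ b e _ _ hp => ?_⟩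
  rw [Mor.id_apply]
  exact (ball_self (σs := []) hp mjrT_nil).trans (h ρ b)

theorem Prob.Eqv.of_eq_rel {X : List Ty} {r r' : V Γ → V X → V [] → H} {m m'}
    (h : ∀ ρ b, r ρ b Tup.nil = r' ρ b Tup.nil) : Eqv (Γ := Γ) ⟨X, [], r, m⟩ ⟨X, [], r', m'⟩ :=
  ⟨Le.of_le fun ρ b => (h ρ b).le, Le.of_le fun ρ b => (h ρ b).ge⟩

/-- The values of the bound variables. -/
def bound (xs : List Ty) (ρ : V (Ctx.ext xs Γ)) : V xs := (Terms.fresh xs).ev ρ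

/-- The values of the parameters. -/
def params (xs : List Ty) (ρ : V (Ctx.ext xs Γ)) : V Γ := (Ren.wkN xs).ev ρ

@[simp] theorem bound_ext {xs : List Ty} (x : V xs) (ρ : V Γ) : bound xs (Tup.ext x ρ) = x :=
  Terms.ev_fresh x ρ

@[simp] theorem params_ext {xs : List Ty} (x : V xs) (ρ : V Γ) : params xs (Tup.ext x ρ) = ρ :=
  Ren.ev_wkN x ρ

/-- The bound variables have a standard majorant. -/
@[reducible] def stG (Γ : Ctx) (xs : List Ty) : Prob (Ctx.ext xs Γ) where
  X := xs
  Y := []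
  rel ρ w _ := mjrT (bound xs ρ) w
  mono hb _ h := mjrT_trans h hb

/-- The bound variables are monotone and have a standard majorant. -/
@[reducible] def smG (Γ : Ctx) (xs : List Ty) : Prob (Ctx.ext xs Γ) where
  X := xs
  Y := []
  rel ρ w _ := mjrT (bound xs ρ) (bound xs ρ) ⊓ mjrT (bound xs ρ) w
  mono hb _ h := le_inf (h.trans inf_le_left) (mjrT_trans (h.trans inf_le_right) hb)

@[reducible] def bddG {xs : List Ty} (t : V Γ → V xs) : Prob (Ctx.ext xs Γ) :=
  pure fun ρ => mjrT (bound xs ρ) (t (params xs ρ))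

@[reducible] def monBddG {xs : List Ty} (t : V Γ → V xs) : Prob (Ctx.ext xs Γ) :=
  pure fun ρ => mjrT (bound xs ρ) (bound xs ρ) ⊓ mjrT (bound xs ρ) (t (params xs ρ))

theorem eqv_conj_std (xs : List Ty) : Eqv (prob (Guards.std (Γ := Γ) xs).conj) (stG Γ xs) := by
  induction xs generalizing Γ with
  | nil => exact Eqv.of_eq_rel (X := []) fun ρ b => eq_refl _
  | cons σ xs ih =>
    let x : Term (Ctx.ext xs (σ :: Γ)) σ := .var (Ren.wkN xs _ .zero)
    refine Eqv.trans (Q := (prob (st x)).and (stG (σ :: Γ) xs))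
      (Eqv.and (P := prob (st x)) (Eqv.refl _) ih) ?_
    exact Eqv.of_eq_rel (X := σ :: xs) fun ρ b => rfl

theorem eqv_conj_stMon (xs : List Ty) :
    Eqv (prob (Guards.stMon (Γ := Γ) xs).conj) (smG Γ xs) := by
  induction xs generalizing Γ with
  | nil => exact Eqv.of_eq_rel (X := []) fun ρ b => (eq_refl _).trans (inf_idem _).symm
  | cons σ xs ih =>
    let x : Term (Ctx.ext xs (σ :: Γ)) σ := .var (Ren.wkN xs _ .zero)
    have h : Eqv (prob ((mon (Term.var (Var.zero (Γ := Γ) (σ := σ)))).ren (Ren.wkN xs)))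
        (pure fun ρ => mjr (x.ev ρ) (x.ev ρ)) := by
      refine Eqv.of_eq ?_
      rw [prob_ren, mon, prob_internal (Formula.internal_maj _ _)]
      refine congrArg Prob.pure (funext fun ρ => (Formula.val_maj _ _ _).trans ?_)
      rw [← Term.ev_ren]
      rfl
    refine Eqv.trans (Q := ((prob (st x)).and (pure fun ρ => mjr (x.ev ρ) (x.ev ρ))).and
      (smG (σ :: Γ) xs)) (Eqv.and (Eqv.and (P := prob (st x)) (Eqv.refl _) h) ih) ?_
    refine Eqv.of_eq_rel (X := σ :: xs) fun ρ b => ?_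
    show (mjr _ _ ⊓ mjr _ _) ⊓ (mjrT _ _ ⊓ mjrT _ _) =
      (mjr _ _ ⊓ mjrT _ _) ⊓ (mjr _ _ ⊓ mjrT _ _)
    exact (congrArg₂ _ (inf_comm _ _) rfl).trans (inf_inf_inf_comm _ _ _ _)

theorem Guards.internal_bdd {xs : List Ty} (ts : Terms Γ xs) : (bdd ts).conj.Internal := by
  induction xs generalizing Γ with
  | nil => trivial
  | cons σ xs ih =>
    cases ts
    refine ⟨?_, ih _⟩
    rw [Formula.ren_eq_subst]
    exact (Formula.internal_maj _ _).subst _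

theorem Guards.internal_monBdd {xs : List Ty} (ts : Terms Γ xs) :
    (monBdd ts).conj.Internal := by
  induction xs generalizing Γ with
  | nil => trivial
  | cons σ xs ih =>
    cases ts with | cons t ts =>
    refine ⟨?_, ih _⟩
    rw [Formula.ren_eq_subst]
    exact (show Formula.Internal (and (mon (.var .zero)) (maj (.var .zero) (t.wk σ))) from
      ⟨Formula.internal_maj _ _, Formula.internal_maj _ _⟩).subst _

theorem Guards.val_bdd {xs : List Ty} (ts : Terms Γ xs) (x : V xs) (ρ : V Γ) :
    (bdd ts).conj.val (Tup.ext x ρ) = mjrT x (ts.ev ρ) := by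
  induction xs generalizing Γ with
  | nil => exact eq_refl _
  | cons σ xs ih =>
    cases ts with | cons t ts =>
    refine congrArg₂ (· ⊓ ·) ((Formula.val_ren _ _ _).trans ?_) ((ih _ x.tl (x.hd ∷ ρ)).trans ?_)
    · rw [show (Ren.wkN (Γ := σ :: Γ) xs).ev (Tup.ext (σs := σ :: xs) x ρ) = x.hd ∷ ρ from
        Ren.ev_wkN x.tl (x.hd ∷ ρ),
        Formula.val_maj, Term.ev_wk]
      rfl
    · rw [Terms.ev_wk]; rfl

theorem Guards.val_monBdd {xs : List Ty} (ts : Terms Γ xs) (x : V xs) (ρ : V Γ) :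
    (monBdd ts).conj.val (Tup.ext x ρ) = mjrT x x ⊓ mjrT x (ts.ev ρ) := by
  induction xs generalizing Γ with
  | nil => exact (eq_refl _).trans (inf_idem _).symm
  | cons σ xs ih =>
    cases ts with | cons t ts =>
    refine (congrArg₂ (· ⊓ ·) ((Formula.val_ren _ _ _).trans ?_)
      ((ih _ x.tl (x.hd ∷ ρ)).trans ?_)).trans (inf_inf_inf_comm _ _ _ _)
    · rw [show (Ren.wkN (Γ := σ :: Γ) xs).ev (Tup.ext (σs := σ :: xs) x ρ) = x.hd ∷ ρ from
        Ren.ev_wkN x.tl (x.hd ∷ ρ)]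
      refine congrArg₂ (· ⊓ ·) (Formula.val_maj _ _ _) ((Formula.val_maj _ _ _).trans ?_)
      rw [Term.ev_wk]
      rfl
    · rw [Terms.ev_wk]; rfl

theorem prob_bdd {xs : List Ty} (ts : Terms Γ xs) :
    prob (Guards.bdd ts).conj = bddG ts.ev := by
  rw [prob_internal (Guards.internal_bdd ts)]
  refine congrArg Prob.pure (funext fun ρ => ?_)
  conv_lhs => rw [← Tup.ext_eta ρ]
  exact Guards.val_bdd ts _ _

theorem prob_monBdd {xs : List Ty} (ts : Terms Γ xs) :
    prob (Guards.monBdd ts).conj = monBddG ts.ev := by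
  rw [prob_internal (Guards.internal_monBdd ts)]
  refine congrArg Prob.pure (funext fun ρ => ?_)
  conv_lhs => rw [← Tup.ext_eta ρ]
  exact Guards.val_monBdd ts _ _

theorem eqv_allStMon {xs : List Ty} (A : Formula (Ctx.ext xs Γ)) {P : Prob (Ctx.ext xs Γ)}
    (h : Eqv (prob A) P) : Eqv (prob (allStMon xs A)) (((smG Γ xs).imp P).allT xs) :=
  Guards.all_stMon A ▸ (Guards.eqv_all _ A).trans (Eqv.imp (eqv_conj_stMon xs) h).allT

theorem eqv_exStMon {xs : List Ty} (A : Formula (Ctx.ext xs Γ)) {P : Prob (Ctx.ext xs Γ)}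
    (h : Eqv (prob A) P) : Eqv (prob (exStMon xs A)) (((smG Γ xs).and P).exT xs) :=
  Guards.ex_stMon A ▸ (Guards.eqv_ex _ A).trans (Eqv.and (eqv_conj_stMon xs) h).exT

theorem eqv_allSt {xs : List Ty} (A : Formula (Ctx.ext xs Γ)) {P : Prob (Ctx.ext xs Γ)}
    (h : Eqv (prob A) P) : Eqv (prob (allSt xs A)) (((stG Γ xs).imp P).allT xs) :=
  Guards.all_std A ▸ (Guards.eqv_all _ A).trans (Eqv.imp (eqv_conj_std xs) h).allT

theorem eqv_exSt {xs : List Ty} (A : Formula (Ctx.ext xs Γ)) {P : Prob (Ctx.ext xs Γ)}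
    (h : Eqv (prob A) P) : Eqv (prob (exSt xs A)) (((stG Γ xs).and P).exT xs) :=
  Guards.ex_std A ▸ (Guards.eqv_ex _ A).trans (Eqv.and (eqv_conj_std xs) h).exT

theorem eqv_exMaj {xs : List Ty} (ts : Terms Γ xs) (A : Formula (Ctx.ext xs Γ))
    {P : Prob (Ctx.ext xs Γ)} (h : Eqv (prob A) P) :
    Eqv (prob (exMaj xs ts A)) (((bddG ts.ev).and P).exT xs) :=
  Guards.ex_bdd ts A ▸ (Guards.eqv_ex _ A).trans
    (Eqv.and (Eqv.of_eq (prob_bdd ts)) h).exT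

theorem eqv_exMonMaj {xs : List Ty} (ts : Terms Γ xs) (A : Formula (Ctx.ext xs Γ))
    {P : Prob (Ctx.ext xs Γ)} (h : Eqv (prob A) P) :
    Eqv (prob (exMonMaj xs ts A)) (((monBddG ts.ev).and P).exT xs) :=
  Guards.ex_monBdd ts A ▸ (Guards.eqv_ex _ A).trans
    (Eqv.and (Eqv.of_eq (prob_monBdd ts)) h).exT

end

end EHA

namespace EHA

noncomputable section

open Formula Prob

/-! ### The characteristic principles -/

namespace Prob

variable {Γ : Ctx}

/-- In the normal forms of a principle, premise and conclusion have the same challenge types, so the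
challenge is passed back unchanged and only the map of realizers has to be given. -/
theorem Le.of_mor {X X' Y : List Ty} {r : V Γ → V X → V Y → H} {r' : V Γ → V X' → V Y → H} {m m'}
    (f : Mor X X')
    (h : ∀ p ρ b c, p ≤ sm b → p ≤ sm c → p ≤ ball c (r ρ b) → p ≤ r' ρ (f b) c) :
    Le (Γ := Γ) ⟨X, Y, r, m⟩ ⟨X', Y, r', m'⟩ := by
  refine ⟨f, (Mor.id _).snd, fun p ρ b e hb he hp => ?_⟩
  rw [Mor.snd_apply, Mor.id_apply, Tup.right_append] at hp
  exact h p ρ b e hb he hp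

theorem Le.of_forall {X Y : List Ty} {r r' : V Γ → V X → V Y → H} {m m'}
    (h : ∀ p ρ b c, p ≤ sm b → p ≤ sm c → p ≤ ball c (r ρ b) → p ≤ r' ρ b c) :
    Le (Γ := Γ) ⟨X, Y, r, m⟩ ⟨X, Y, r', m'⟩ := by
  refine Le.of_mor (Mor.id X) fun p ρ b e hb he hp => ?_
  rw [Mor.id_apply]
  exact h p ρ b e hb he hp

theorem le_exT {xs : List Ty} {P : Prob (Ctx.ext xs Γ)} {p : H} {ρ : V Γ} {b : V P.X} {c : V P.Y}
    (x : V xs)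
    (h : ∀ q ≤ p, ∀ a, q ≤ mjrT a a → q ≤ mjrT a c → q ≤ P.rel (Tup.ext x ρ) b a) :
    p ≤ (P.exT xs).rel ρ b c :=
  (le_ball_iff.2 h).trans (le_iSup (fun x => ball c (P.rel (Tup.ext x ρ) b)) x)

theorem exT_elim {xs : List Ty} {P : Prob (Ctx.ext xs Γ)} {p r : H} {ρ : V Γ} {b : V P.X}
    {c : V P.Y} (h : p ≤ (P.exT xs).rel ρ b c)
    (k : ∀ x, ∀ q ≤ p, q ≤ ball c (P.rel (Tup.ext x ρ) b) → q ≤ r) : p ≤ r :=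
  le_of_le_iSup h k

theorem le_allT {xs : List Ty} {P : Prob (Ctx.ext xs Γ)} {p : H} {ρ : V Γ} {b : V P.X} {c : V P.Y}
    (h : ∀ x, p ≤ P.rel (Tup.ext x ρ) b c) : p ≤ (P.allT xs).rel ρ b c := le_iInf h

theorem allT_elim {xs : List Ty} {P : Prob (Ctx.ext xs Γ)} {p : H} {ρ : V Γ} {b : V P.X}
    {c : V P.Y} (h : p ≤ (P.allT xs).rel ρ b c) (x : V xs) : p ≤ P.rel (Tup.ext x ρ) b c :=
  h.trans (iInf_le _ x)

end Prob

variable {Γ : Ctx}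

/-- A realizer of the premise already contains a majorant for `y` that does not depend on `x`,
because quantifiers are uniform. That majorant is the required `z`, and the realizer is kept as it
is. -/
theorem realization_le (xs ys : List Ty) (A : Formula (Ctx.ext ys (Ctx.ext xs Γ))) :
    Le (prob (alls xs (exSt ys A)))
      (prob (exStMon ys (alls xs (exMaj ys ((Terms.fresh ys).wkN xs)
          (A.ren (((Ren.wkN ys).liftN xs).liftN ys)))))) := by
  refine ((eqv_alls _).trans (eqv_exSt A (Eqv.refl _)).allT).1.trans (Le.trans ?_
    (eqv_exStMon _ ((eqv_alls _).trans
      (Eqv.allT (eqv_exMaj _ _ (Eqv.of_eq (prob_ren _ _)))))).2)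
  refine Le.of_forall fun p ρ b c hb hc h => ?_
  have hb1 : p ≤ mjrT (Tup.left (σs := ys) b) (Tup.left (σs := ys) b) := mjrT_left (sm_mon hb)
  refine le_exT (Tup.left (σs := ys) b) fun q hq a ha1 ha2 => le_inf (le_inf ?_ ?_)
    (le_allT fun x => ?_)
  · rw [bound_ext]; exact hq.trans hb1
  · rw [bound_ext]; exact hq.trans hb1
  · have h1 := allT_elim (le_ball_iff.1 h q hq a ha1 ha2) x
    refine exT_elim h1 fun y q' hq' h2 => le_exT y fun r hr c hc1 hc2 => ?_
    have h3 := le_ball_iff.1 h2 r hr c hc1 hc2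
    refine le_inf ((h3.trans inf_le_left).trans (le_of_eq ?_))
      ((h3.trans inf_le_right).trans (le_of_eq ?_))
    · show mjrT _ _ = mjrT _ _
      rw [bound_ext, bound_ext, params_ext, Terms.ev_wkN, Terms.ev_fresh]
    · show sem A _ _ _ = sem A _ _ _
      rw [Ren.ev_liftN, Ren.ev_liftN, Ren.ev_wkN]
      rfl

theorem Formula.Internal.ren {Δ : Ctx} {A : Formula Γ} (hA : A.Internal) (r : Ren Γ Δ) :
    (A.ren r).Internal := by
  rw [Formula.ren_eq_subst]
  exact hA.subst _

theorem Formula.Internal.imp {A B : Formula Γ} (hA : A.Internal) (hB : B.Internal) :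
    (imp A B).Internal := ⟨hA, hB⟩

theorem Formula.Internal.exs {xs : List Ty} {A : Formula (Ctx.ext xs Γ)} (hA : A.Internal) :
    (exs xs A).Internal := by
  induction xs generalizing Γ with
  | nil => exact hA
  | cons σ xs ih => exact ih hA

theorem Formula.Internal.allMaj {xs : List Ty} {ts : Terms Γ xs} {A : Formula (Ctx.ext xs Γ)}
    (hA : A.Internal) : (allMaj xs ts A).Internal := by
  induction xs generalizing Γ with
  | nil => exact hA
  | cons σ xs ih => cases ts; exact ⟨Formula.internal_maj _ _, ih hA⟩

theorem Formula.Internal.allMonMaj {xs : List Ty} {ts : Terms Γ xs} {A : Formula (Ctx.ext xs Γ)}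
    (hA : A.Internal) : (allMonMaj xs ts A).Internal := by
  induction xs generalizing Γ with
  | nil => exact hA
  | cons σ xs ih =>
    cases ts
    exact ⟨⟨Formula.internal_maj _ _, Formula.internal_maj _ _⟩, ih hA⟩

theorem Prob.eqv_internal {A : Formula Γ} (hA : A.Internal) : Eqv (prob A) (pure A.val) :=
  Eqv.of_eq (prob_internal hA)

theorem eqv_imp {A B : Formula Γ} {P Q : Prob Γ} (hA : Eqv (prob A) P) (hB : Eqv (prob B) Q) :
    Eqv (prob (imp A B)) (P.imp Q) := Eqv.imp hA hB

theorem smG_intro {xs : List Ty} {p : H} {x w : V xs} {ρ : V Γ} (h : p ≤ mjrT x x)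
    (h' : p ≤ mjrT x w) {c : V []} : p ≤ (smG Γ xs).rel (Tup.ext x ρ) w c :=
  le_inf (by rwa [bound_ext]) (by rwa [bound_ext])

theorem smG_ball {xs : List Ty} {p : H} {x w : V xs} {ρ : V Γ} (h : p ≤ mjrT x x)
    (h' : p ≤ mjrT x w) {c : V []} : p ≤ ball c ((smG Γ xs).rel (Tup.ext x ρ) w) :=
  le_ball_iff.2 fun _ hq _ _ _ => smG_intro (hq.trans h) (hq.trans h')

theorem smG_elim {xs : List Ty} {p : H} {x w : V xs} {ρ : V Γ} {c : V []}
    (h : p ≤ (smG Γ xs).rel (Tup.ext x ρ) w c) : p ≤ mjrT x x ∧ p ≤ mjrT x w := by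
  have h : p ≤ mjrT _ _ ⊓ mjrT _ _ := h
  rw [bound_ext] at h
  exact le_inf_iff.1 h

/-- On both sides there is nothing to realize, and a challenge is a standard bound for `y`. The
premise is used with `z` equal to that bound; in the conclusion `x` may depend on the challenge. -/
theorem idealization_le (xs ys : List Ty) (A : Formula (Ctx.ext ys (Ctx.ext xs Γ)))
    (hA : A.Internal) :
    Le (prob (allStMon ys (exs xs (allMaj ys ((Terms.fresh ys).wkN xs)
          (A.ren (((Ren.wkN ys).liftN xs).liftN ys))))))
      (prob (exs xs (allSt ys A))) := by
  refine (eqv_allStMon _ (eqv_internal (hA.ren _).allMaj.exs)).1.trans (Le.trans ?_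
    ((eqv_exs _).trans (eqv_allSt A (eqv_internal hA)).exT).2)
  refine Le.of_forall fun p ρ b c hb hc h => ?_
  have hw : p ≤ mjrT (Tup.left (σs := ys) c) (Tup.left (σs := ys) c) := mjrT_left (sm_mon hc)
  have h1 := le_himp_iff_forall.1 (allT_elim (ball_self h (sm_mon hc)) (Tup.left (σs := ys) c))
    p le_rfl (smG_ball hw hw)
  change p ≤ Formula.val _ _ at h1
  rw [Formula.val_exs] at h1
  refine le_of_le_iSup h1 fun x q hq h2 => le_exT x fun r hr c' _ hc' => le_allT fun y =>
    le_himp_iff_forall.2 fun s hs h3 => ?_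
  have h3 := ball_self (σs := []) h3 mjrT_nil
  change s ≤ mjrT _ _ at h3
  rw [bound_ext] at h3
  rw [Formula.val_allMaj, Terms.ev_wkN, Terms.ev_fresh] at h2
  have h4 := le_himp_iff_forall.1 (h2.trans (iInf_le _ y)) s (hs.trans hr)
    (mjrT_trans h3 (hs.trans (mjrT_left hc')))
  rwa [Formula.val_ren, Ren.ev_liftN, Ren.ev_liftN, Ren.ev_wkN] at h4

/-- A realizer of the premise is a bound for the challenges to its universal hypothesis, and this
bound is the `y` of the conclusion. -/
theorem MP_le (xs : List Ty) (A : Formula (Ctx.ext xs Γ)) (hA : A.Internal) (B : Formula Γ)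
    (hB : B.Internal) :
    Le (prob (imp (allStMon xs A) B))
      (prob (exStMon xs (imp
          (allMonMaj xs (Terms.fresh xs) (A.ren ((Ren.wkN xs).liftN xs)))
          (B.ren (Ren.wkN xs))))) := by
  refine (Eqv.imp (eqv_allStMon _ (eqv_internal hA)) (eqv_internal hB)).1.trans (Le.trans ?_
    (eqv_exStMon _ (eqv_internal ((hA.ren _).allMonMaj.imp (hB.ren _)))).2)
  -- The realizer is formally a tuple of functions of no arguments; applying it to the empty tuple
  -- only changes the form of its type.
  let f : Mor ((xs ++ []).map (arrs [])) (xs ++ []) := Mor.app (τs := []) (Mor.id _) (Mor.zero _ _)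
  refine Le.of_mor f fun p ρ b c hb hc h => ?_
  have hw : p ≤ mjrT (Tup.left (σs := xs) (f b)) (Tup.left (σs := xs) (f b)) :=
    mjrT_left (sm_mon (f.sm hb))
  refine le_exT (Tup.left (σs := xs) (f b)) fun q hq c' _ hc' => le_inf
    (smG_intro (hq.trans hw) (hq.trans hw)) ?_
  change q ≤ Formula.val _ _ ⇨ Formula.val _ _
  rw [Formula.val_allMonMaj, Terms.ev_fresh, Formula.val_ren, Ren.ev_wkN]
  refine le_himp_iff_forall.2 fun r hr h1 => ?_
  refine le_himp_iff_forall.1 (ball_self (σs := []) h mjrT_nil) r (hr.trans hq)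
    (le_ball_iff.2 fun s hs a ha1 ha2 => le_allT fun x => le_himp_iff_forall.2 fun t ht h2 => ?_)
  have h2 := smG_elim (ball_self (σs := []) h2 mjrT_nil)
  have h3 := le_himp_iff_forall.1 ((ht.trans hs).trans (h1.trans (iInf_le _ x))) t le_rfl
    (le_inf h2.1 (mjrT_trans h2.2 (ht.trans (mjrT_left ?_))))
  · rwa [Formula.val_ren, Ren.ev_liftN, Ren.ev_wkN] at h3
  · rw [Mor.app_apply, Mor.id_apply]
    exact ha2

/-- The realizer of standardness of `x` is a standard monotone majorant of `x`, and it serves both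
as `y` and as its own majorant. -/
theorem MAJ_realized (σ : Ty) :
    (prob (allSt (Γ := Γ) [σ]
      (exSt [σ] (maj (.var (Var.succ Var.zero)) (.var Var.zero))))).Realized := by
  refine realized_all_iff.2 ((realized_imp_iff (P := stP (Term.var .zero).ev)
    (Q := prob (exSt [σ] (maj (.var (Var.succ Var.zero)) (.var Var.zero))))).2 (Le.trans ?_
      (eqv_exSt _ (eqv_internal (Formula.internal_maj _ _))).2))
  refine Le.of_forall fun p ρ b c hb hc h => ?_
  refine le_exT b fun q hq c' _ hc' => le_inf ?_ ?_
  · show q ≤ mjrT _ _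
    rw [bound_ext]
    exact hq.trans (sm_mon hb)
  · change q ≤ Formula.val _ _
    rw [Formula.val_maj]
    exact hq.trans (ball_self (σs := []) h mjrT_nil)

/-- The hypothesis `∀̃ˢᵗx A` with `A` internal has no realizers, so the bound for `y` produced by
the premise depends on nothing and can be pulled out in front. -/
theorem IP_le (xs ys : List Ty) (A : Formula (Ctx.ext xs Γ)) (hA : A.Internal)
    (B : Formula (Ctx.ext ys Γ)) :
    Le (prob (imp (allStMon xs A) (exStMon ys B)))
      (prob (exStMon ys (imp ((allStMon xs A).ren (Ren.wkN ys))
          (exMonMaj ys (Terms.fresh ys) (B.ren ((Ren.wkN ys).liftN ys)))))) := by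
  have hA' := eqv_allStMon A (eqv_internal hA)
  refine (Eqv.imp hA' (eqv_exStMon B (Eqv.refl _))).1.trans (Le.trans ?_
    (eqv_exStMon _ (eqv_imp ((Eqv.of_eq (prob_ren _ _)).trans (hA'.pull _))
      (eqv_exMonMaj _ _ (Eqv.of_eq (prob_ren _ _))))).2)
  let X := (ys ++ exTypes B).map (arrs [])
  let Z := (xs ++ []).map (arrs (allTypes B))
  let K : Mor (X ++ Z) (ys ++ exTypes B) :=
    Mor.app (τs := []) (Mor.id (X ++ Z)).fst (Mor.zero _ _)
  -- A regrouping only: the bound for `y` moves out of the implication, while the realizers of `B`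
  -- and the challenge bounds stay inside.
  let f : Mor (X ++ Z) (ys ++ ((exTypes B).map (arrs []) ++ Z)) := K.fst.pair
    ((Mor.curry (σs := X ++ Z) (τs := []) (K.snd.comp (Mor.id ((X ++ Z) ++ [])).fst)).pair
      (Mor.id (X ++ Z)).snd)
  refine Le.of_mor f fun p ρ b c hb hc h => ?_
  have hK : K b = appT (Tup.left (σs := X) b) Tup.nil := by
    rw [Mor.app_apply, Mor.fst_apply, Mor.id_apply]
    rfl
  have hf1 : Tup.left (σs := ys) (f b) = Tup.left (K b) := by
    rw [Mor.pair_apply, Tup.left_append, Mor.fst_apply]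
  have hf2 : appT (Tup.left (σs := (exTypes B).map (arrs []))
      (Tup.right (σs := ys) (f b))) Tup.nil = Tup.right (σs := ys) (K b) := by
    rw [Mor.pair_apply, Tup.right_append, Mor.pair_apply, Tup.left_append]
    refine (Mor.curry_apply _ _ _).trans ?_
    rw [Mor.comp_apply, Mor.fst_apply, Mor.id_apply, Tup.left_append, Mor.snd_apply]
  have hf3 : Tup.right (σs := (exTypes B).map (arrs [])) (Tup.right (σs := ys) (f b)) =
      Tup.right (σs := X) b := by
    rw [Mor.pair_apply, Tup.right_append, Mor.pair_apply, Tup.right_append, Mor.snd_apply,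
      Mor.id_apply]
  have hw : p ≤ mjrT (Tup.left (σs := ys) (f b)) (Tup.left (σs := ys) (f b)) :=
    mjrT_left (sm_mon (f.sm hb))
  refine le_exT (Tup.left (σs := ys) (f b)) fun q hq c' hc1 hc2 => le_inf
    (smG_intro (hq.trans hw) (hq.trans hw)) (le_himp_iff_forall.2 fun r hr h1 => ?_)
  have h1 : r ≤ ball (appT (Tup.right (σs := (exTypes B).map (arrs []))
      (Tup.right (σs := ys) (f b))) c') ((((smG Γ xs).imp (pure A.val)).allT xs).rel
        ((Ren.wkN ys).ev (Tup.ext (Tup.left (σs := ys) (f b)) ρ)) Tup.nil) := h1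
  rw [hf3, Ren.ev_wkN] at h1
  have h2 := le_himp_iff_forall.1 (le_ball_iff.1 h q hq c' hc1 hc2) r hr h1
  refine exT_elim h2 fun y s hs h3 => le_exT y fun t ht c'' hc1'' hc2'' => ?_
  have h4 := le_ball_iff.1 h3 t ht c'' hc1'' hc2''
  have h5 := smG_elim (h4.trans inf_le_left)
  refine le_inf ?_ ((h4.trans inf_le_right).trans (le_of_eq ?_))
  · show t ≤ mjrT _ _ ⊓ mjrT _ _
    rw [bound_ext, params_ext, Terms.ev_fresh, hf1, hK]
    exact le_inf h5.1 h5.2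
  · show sem B _ (Tup.right (σs := ys) (appT _ Tup.nil)) _ =
      sem B _ (appT (Tup.left (σs := (exTypes B).map (arrs []))
      (Tup.right (σs := ys) (f b))) Tup.nil) _
    rw [hf2, hK, Ren.ev_liftN, Ren.ev_wkN]

/-- A realizer of the premise is a tuple of functions from majorants of `x` to bounds for `y`
together with realizers of `A`. Its first block is the function `f`; as a monotone `x` majorizes
itself, that block may be evaluated at `x`. -/
theorem mAC_le (xs ys : List Ty) (A : Formula (Ctx.ext ys (Ctx.ext xs Γ))) :
    Le (prob (allStMon xs (exStMon ys A)))
      (prob (exStMon (ys.map (arrs xs)) (allStMon xs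
          (exMonMaj ys (((Terms.fresh (ys.map (arrs xs))).wkN xs).apps (Terms.fresh xs))
            (A.ren (((Ren.wkN (ys.map (arrs xs))).liftN xs).liftN ys)))))) := by
  refine (eqv_allStMon _ (eqv_exStMon A (Eqv.refl _))).1.trans (Le.trans ?_
    (eqv_exStMon _ (eqv_allStMon _ (eqv_exMonMaj _ _ (Eqv.of_eq (prob_ren _ _))))).2)
  let X := (ys ++ exTypes A).map (arrs xs) ++ []
  let K : Mor (X ++ xs) (ys ++ exTypes A) := Mor.app (τs := xs)
    (Mor.fst (τs := (ys ++ exTypes A).map (arrs xs)) (Mor.id (X ++ xs)).fst) (Mor.id _).snd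
  let f : Mor X (ys.map (arrs xs) ++ ((exTypes A).map (arrs xs) ++ [])) :=
    K.fst.curry.pair (K.snd.curry.pair (Mor.zero _ _))
  refine Le.of_mor f fun p ρ b c hb hc h => ?_
  have hK : ∀ a, K (b.append a) =
      appT (Tup.left (σs := (ys ++ exTypes A).map (arrs xs)) b) a := by
    intro a
    rw [Mor.app_apply, Mor.fst_apply, Mor.fst_apply, Mor.snd_apply, Mor.id_apply, Tup.left_append,
      Tup.right_append]
  have hf1 : ∀ a, appT (Tup.left (σs := ys.map (arrs xs)) (f b)) a =
      Tup.left (K (b.append a)) := by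
    intro a
    rw [Mor.pair_apply, Tup.left_append, Mor.curry_apply, Mor.fst_apply]
  have hf2 : ∀ a, appT (Tup.left (σs := (exTypes A).map (arrs xs))
      (Tup.right (σs := ys.map (arrs xs)) (f b))) a = Tup.right (σs := ys) (K (b.append a)) := by
    intro a
    rw [Mor.pair_apply, Tup.right_append, Mor.pair_apply, Tup.left_append, Mor.curry_apply,
      Mor.snd_apply]
  have hw : p ≤ mjrT (Tup.left (σs := ys.map (arrs xs)) (f b))
      (Tup.left (σs := ys.map (arrs xs)) (f b)) := mjrT_left (sm_mon (f.sm hb))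
  refine le_exT (Tup.left (σs := ys.map (arrs xs)) (f b)) fun q hq c' hc1 hc2 => le_inf
    (smG_intro (hq.trans hw) (hq.trans hw)) (le_allT fun x => le_himp_iff_forall.2
      fun r hr h1 => ?_)
  have h1 := smG_elim (ball_self (σs := []) h1 mjrT_nil)
  have hc3 : r ≤ mjrT (Tup.left (σs := xs) c') (Tup.left (σs := xs) c') :=
    hr.trans (mjrT_left hc1)
  have hc4 : r ≤ mjrT (Tup.right (σs := xs) c') (Tup.right (σs := xs) c') :=
    hr.trans (mjrT_right' hc1)
  -- The premise is challenged with `x` itself in place of the given majorant of `x`, since the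
  -- bound for `y` is to be `f x`.
  have h2 := le_ball_iff.1 h r (hr.trans hq) (x.append (Tup.right (σs := xs) c'))
    (mjrT_append_iff.2 ⟨h1.1, hc4⟩) ?_
  · have h3 := le_himp_iff_forall.1 (allT_elim h2 x) r le_rfl (smG_ball h1.1
      (by rw [Tup.left_append]; exact h1.1))
    rw [Tup.left_append, Tup.right_append] at h3
    refine exT_elim h3 fun y s hs h4 => le_exT y fun t ht c'' hc1'' hc2'' => ?_
    have h5 := le_ball_iff.1 h4 t ht c'' hc1'' hc2''
    have h6 := smG_elim (h5.trans inf_le_left)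
    refine le_inf ?_ ?_
    · show t ≤ mjrT _ _ ⊓ mjrT _ _
      rw [bound_ext, params_ext, Terms.ev_apps, Terms.ev_wkN, Terms.ev_fresh, Terms.ev_fresh,
        hf1, hK]
      exact le_inf h6.1 h6.2
    · show t ≤ sem A _ (appT (Tup.left (σs := (exTypes A).map (arrs xs))
        (Tup.right (σs := ys.map (arrs xs)) (f b))) (Tup.left (σs := xs) c')) _
      rw [hf2, Ren.ev_liftN, Ren.ev_liftN, Ren.ev_wkN]
      -- The realizer of `A` obtained at `x` is raised to its value at the majorant of `x` in the
      -- challenge, the only argument available to the new realizer.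
      refine sem_mono A ?_ hc1'' (h5.trans inf_le_right)
      show t ≤ mjrT (Tup.right (σs := ys) (appT _ x)) _
      rw [← hK]
      refine mjrT_right' (K.mono (mjrT_append_iff.2 ⟨?_, (ht.trans hs).trans h1.2⟩))
      exact (((ht.trans hs).trans hr).trans hq).trans (sm_mon hb)
  · have h7 := hr.trans hc2
    have h8 : r ≤ mjrT (x.append (Tup.right (σs := xs) c'))
        (Tup.append (Tup.left (σs := xs) c) (Tup.right (σs := xs) c)) :=
      mjrT_append_iff.2 ⟨mjrT_trans h1.2 (mjrT_left h7), mjrT_right' h7⟩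
    rwa [Tup.append_left_right] at h8

end

end EHA

namespace EHA

noncomputable section

open Formula Prob

/-! ### Soundness -/

theorem realized_imp {Γ : Ctx} {A B : Formula Γ} :
    (prob (imp A B)).Realized ↔ Le (prob A) (prob B) :=
  realized_imp_iff (P := prob A) (Q := prob B)

theorem Principle.realized {Γ : Ctx} {A : Formula Γ} (h : Principle A) : (prob A).Realized := by
  cases h with
  | mAC xs ys A => exact realized_imp.2 (mAC_le xs ys A)
  | realization xs ys A => exact realized_imp.2 (realization_le xs ys A)
  | idealization xs ys A hA => exact realized_imp.2 (idealization_le xs ys A hA)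
  | IP xs ys A hA B => exact realized_imp.2 (IP_le xs ys A hA B)
  | MP xs A hA B hB => exact realized_imp.2 (MP_le xs A hA B hB)
  | MAJ σ => exact MAJ_realized σ

/-- Induction on derivations: an implication becomes a reduction, and each axiom or rule is then a
property of reducibility. The induction never leaves the fixed model of E-HA^ω_st, although the
derivations use the additional principles. -/
theorem Derivable.realized {Γ : Ctx} {A : Formula Γ} (h : Derivable Principle A) :
    (prob A).Realized := by
  induction h with
  | or_contr A => exact realized_imp.2 (Prob.or_contr (prob A))
  | and_contr A => exact realized_imp.2 (Prob.and_contr (prob A))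
  | or_weak A B => exact realized_imp.2 (Prob.or_weak (prob A) (prob B))
  | and_weak A B => exact realized_imp.2 (Prob.and_weak (prob A) (prob B))
  | or_perm A B => exact realized_imp.2 (Prob.or_perm (prob A) (prob B))
  | and_perm A B => exact realized_imp.2 (Prob.and_perm (prob A) (prob B))
  | ex_falso A => exact realized_imp.2 (Prob.ex_falso (prob A))
  | all_elim A t =>
    refine realized_imp.2 ?_
    rw [prob_inst]
    exact Prob.all_elim (prob A) t.ev
  | ex_intro A t =>
    refine realized_imp.2 ?_
    rw [prob_inst]
    exact Prob.ex_intro (prob A) t.ev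
  | mp _ _ ih1 ih2 => exact ih1.mp (realized_imp.1 ih2)
  | syll _ _ ih1 ih2 => exact realized_imp.2 ((realized_imp.1 ih1).trans (realized_imp.1 ih2))
  | @exportation Γ A B C _ ih =>
    exact realized_imp.2 (Prob.exportation (P := prob A) (Q := prob B) (R := prob C)
      (realized_imp.1 ih))
  | @importation Γ A B C _ ih =>
    exact realized_imp.2 (Prob.importation (P := prob A) (Q := prob B) (R := prob C)
      (realized_imp.1 ih))
  | expansion C _ ih => exact realized_imp.2 (Prob.expansion (prob C) (realized_imp.1 ih))
  | @all_intro Γ σ B A _ ih =>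
    refine realized_imp.2 (Prob.all_intro (P := prob A) (Q := prob B) ?_)
    rw [← prob_wk]
    exact realized_imp.1 ih
  | @ex_elim Γ σ A B _ ih =>
    refine realized_imp.2 (Prob.ex_elim (P := prob A) (Q := prob B) ?_)
    rw [← prob_wk]
    exact realized_imp.1 ih
  | arith h => exact realized_of_internal h.internal (.arith h)
  | standardness h => exact h.realized
  | external_induction A _ _ ih1 ih2 => exact external_induction_realized A ih1 ih2
  | ax h => exact h.realized

theorem Terms.monotone_of_mjrT {σs : List Ty} (t : Terms [] σs)
    (h : ⊤ ≤ mjrT (t.ev Tup.nil) (t.ev Tup.nil)) : t.Monotone := by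
  induction t with
  | nil => trivial
  | cons t ts ih =>
    refine ⟨EHAst.of_val fun ρ => top_le_iff.1 ?_, ih (h.trans inf_le_right)⟩
    rw [mon, Formula.val_maj]
    exact h.trans inf_le_left

end

end EHA

open EHA in
theorem mainTheorem1 {Γ : Ctx} (A : Formula Γ) (hA : Derivable Principle A) :
    ∃ t : Terms [] (exTypes A), t.Monotone ∧ EHAst (allMatrix A t) := by
  obtain ⟨t, ht⟩ := hA.realized
  -- Completeness of the model turns the forced statements, monotonicity of the terms and
  -- correctness of the realizer, back into derivations in E-HA^ω_st.
  refine ⟨t.tms, Terms.monotone_of_mjrT _ (t.mono mjrT_nil), EHAst.of_val fun ρ => ?_⟩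
  rw [allMatrix, Formula.val_allStMon]
  refine top_le_iff.1 (le_iInf fun c => le_himp_iff_forall.2 fun p _ hc => ?_)
  rw [val_matrix, Sub.ev_wkN, Sub.ev_id, Terms.ev_ofClosed, Terms.ev_fresh]
  exact ht p ρ c hc
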